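/- **Theorem 6 (cluster expansion).** Let $R$ be a commutative ring with unit containing $\mathbb{Q}$, $n\ge 0$, $[n]$ an index set with $n$ elements, and let $F=(F_i)_{i\in[n]}$ be power series without constant term in $R[[X_1,\ldots,X_n]]$, $$F_i(X)=\sum_{d\ge1}\frac1{d!}\sum_{j_1,\ldots,j_d\in[n]}F^{[d]}_{i,j_1\ldots j_d}X_{j_1}\cdots X_{j_d},$$ with $F^{[d]}_{i,j_1\ldots j_d}$ symmetric in $j_1,\ldots,j_d$. Assume that $A=(F^{[1]}_{i,j})_{i,j}$ is in $GL_n(R)$, and put $H_i=-\sum_{d\ge2}\frac1{d!}\sum_{j_1,\ldots,j_d}F^{[d]}_{i,j_1\ldots j_d}X_{j_1}\cdots X_{j_d}$, $H^{[p]}=-F^{[p]}$ for $p\ge2$. Let $\overline u,u,Y$ be vectors of $n$ indeterminates each, and write $\overline uH(u)=\sum_i\overline u_iH_i(u)$, $\overline uY=\sum_i\overline u_iY_i$. *Summability.* A family in $R[[Y]]$ is summable if each monomial has a nonzero coefficient in only finitely many members; sums are taken coefficientwise. *Formal Gaussian integral.* For $\alpha_1,\alpha_2\in\mathbb N^n$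 let $$\int d\overline u\,du\,e^{-\overline uAu}\,\overline u^{\alpha_1}u^{\alpha_2}=(\det A)^{-1}\sum_\sigma\prod_{k}(A^{-1})_{\tau_2(\sigma(k))\tau_1(k)},$$ where $\tau_1:[k_1]\to[n]$, $\tau_2:[k_2]\to[n]$ are any maps taking each value $i$ exactly $(\alpha_1)_i$, resp. $(\alpha_2)_i$, times, $k\in[k_1]$, and $\sigma$ runs over the bijections $[k_1]\to[k_2]$. For $U=\sum c_{\alpha_1\alpha_2\alpha_3}\overline u^{\alpha_1}u^{\alpha_2}Y^{\alpha_3}$ in $R[[\overline u,u,Y]]$ let $\int d\overline u\,du\,e^{-\overline uAu}\,U=\sum c_{\alpha_1\alpha_2\alpha_3}Y^{\alpha_3}\int d\overline u\,du\,e^{-\overline uAu}\,\overline u^{\alpha_1}u^{\alpha_2}$, provided that this family is summable in $R[[Y]]$. *Correlation functions.* Let $I,J$ be finite sets with maps $\tau_u:I\to[n]$, $\tau_{\overline u}:J\to[n]$. Put $$\Big\langle\prod_{i\in I}u_{\tau_u(i)}\prod_{j\in J}\overline u_{\tau_{\overline u}(j)}\Big\rangle_U=(\det A)\int d\overline u\,du\,e^{-\overline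 uAu}\prod_{i\in I}u_{\tau_u(i)}\prod_{j\in J}\overline u_{\tau_{\overline u}(j)}\ e^{\overline uH(u)+\overline uY},\qquad Z=\langle1\rangle_U.$$ *Feynman diagrams.* A Feynman diagram structure $\mathcal F$ of type $(I,J)$ on a finite set $E$ consists of decompositions $E=E_u\sqcup E_{\overline u}$ and $E=E_{int}\sqcup E_{ext}$, bijections $\rho_u:I\to E_{ext}\cap E_u$ and $\rho_{\overline u}:J\to E_{ext}\cap E_{\overline u}$, disjoint sets $\pi_H,\pi_Y$ of subsets of $E$ whose union is a partition of $E_{int}$, such that $\#(B\cap E_{\overline u})=1$ and $\#(B\cap E_u)\ge2$ for $B\in\pi_H$, while $\#(B\cap E_{\overline u})=1$ and $B\cap E_u=\emptyset$ for $B\in\pi_Y$, and a bijection $\mathcal C:E_{\overline u}\to E_u$. Structures are transported along bijections $E\to E'$ in the obvious manner; this defines the isomorphism classes $[E,\mathcal F]$ and the group $Aut(E,\mathcal F)$ of permutations of $E$ that preserve $\mathcal F$. The amplitude is $$\mathcal A(E,\mathcal F,\tau_u,\tau_{\overline u})=\sum_\alpha\prod_{\overline x\in E_{\overline u}}(A^{-1})_{\alpha(\mathcal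 C(\overline x))\alpha(\overline x)}\prod_{B\in\pi_H}H(B,\alpha)\prod_{B\in\pi_Y}Y(B,\alpha)\in R[[Y]],$$ over all $\alpha:E\to[n]$ with $\alpha\circ\rho_u=\tau_u$ and $\alpha\circ\rho_{\overline u}=\tau_{\overline u}$, where $H(B,\alpha)=H^{[p]}_{\alpha(\overline x),\alpha(y_1)\ldots\alpha(y_p)}$ if $B\cap E_{\overline u}=\{\overline x\}$ and $B\cap E_u=\{y_1,\ldots,y_p\}$ has $p$ elements, and $Y(B,\alpha)=Y_{\alpha(\overline x)}$ if $B=\{\overline x\}$. The diagram is connected if $E\ne\emptyset$ and the digraph on $\{\{x\}:x\in E_{ext}\}\cup\pi_H\cup\pi_Y$, with a link from $a$ to $b$ whenever $\mathcal C(x)=y$ for some $x\in a\cap E_{\overline u}$, $y\in b\cap E_u$, is connected (orientations being disregarded). The connected correlation functions are $$\Big\langle\prod_{i\in I}u_{\tau_u(i)}\prod_{j\in J}\overline u_{\tau_{\overline u}(j)}\Big\rangle_C=\sum_{[E,\mathcal F]\ \text{connected of type }(I,J)}\frac{\mathcal A(E,\mathcal F,\tau_u,\tau_{\overline u})}{\#Aut(E,\mathcal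 F)}.$$ *Statement.* The formal Gaussian integrals that define $\langle\prod_{i\in I}u_{\tau_u(i)}\prod_{j\in J}\overline u_{\tau_{\overline u}(j)}\rangle_U$ and $Z$ exist, the families that define the connected correlation functions for the restrictions of $\tau_u,\tau_{\overline u}$ to arbitrary subsets $\tilde I\subset I$, $\tilde J\subset J$ are summable, and in $R[[Y]]$ $$\Big\langle\prod_{i\in I}u_{\tau_u(i)}\prod_{j\in J}\overline u_{\tau_{\overline u}(j)}\Big\rangle_U=Z\times\sum_\pi\ \prod_{(\tilde I,\tilde J)\in\pi}\Big\langle\prod_{i\in\tilde I}u_{\tau_u(i)}\prod_{j\in\tilde J}\overline u_{\tau_{\overline u}(j)}\Big\rangle_C,$$ where $\pi$ runs over all (unordered) sets of pairs $(\tilde I,\tilde J)$ of subsets $\tilde I\subset I$, $\tilde J\subset J$, not simultaneously empty, such that each element of $I$ lies in $\tilde I$ for exactly one pair $(\tilde I,\tilde J)\in\pi$, and each element of $J$ lies in $\tilde J$ for exactly one pair $(\tilde I,\tilde J)\in\pi$. -/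

import Mathlib

namespace FeynmanCluster

noncomputable section

/-! ### Summable families in rings of formal power series

The coefficient ring is discrete, so that a family of power series is summable if and only if each
monomial occurs in only finitely many members; the sum is then taken coefficient by coefficient. -/

/-- Summability of a family of formal power series over a discrete coefficient ring. -/
def SummableFamily {σ R ι : Type*} [CommRing R] (f : ι → MvPowerSeries σ R) : Prop :=
  ∀ d : σ →₀ ℕ, {i | MvPowerSeries.coeff d (f i) ≠ 0}.Finite

/-- The sum of a summable family of formal power series (meaningful for `SummableFamily f`). -/
def familySum {σ R ι : Type*} [CommRing R] (f : ι → MvPowerSeries σ R) : MvPowerSeries σ R :=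
  fun d => ∑ᶠ i, MvPowerSeries.coeff d (f i)

/-! ### The power series system `F`, its linear part `A` and its nonlinear part `H` -/

section System

variable {R : Type*} [CommRing R] {n : ℕ}

/-- The tensor coefficient `f^{[d]}_{j₁ … j_d} = ∂^d f / ∂X_{j₁} … ∂X_{j_d} (0)`, the indices
`j₁, …, j_d` being given as a multiset: `μ!` times the coefficient of `X ^ μ`, where `μ` is the
multiplicity multiindex. -/
def tensorCoeff (f : MvPowerSeries (Fin n) R) (j : Multiset (Fin n)) : R :=
  ((∏ i, (j.count i).factorial : ℕ) : R) * MvPowerSeries.coeff (Multiset.toFinsupp j) f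

/-- The matrix `A_{ij} = F^{[1]}_{i,j}` of the linear part of `F`. -/
def linMatrix (F : Fin n → MvPowerSeries (Fin n) R) : Matrix (Fin n) (Fin n) R :=
  Matrix.of fun i j => tensorCoeff (F i) {j}

/-- The nonlinear part: `H_i` is minus the sum of the terms of degree at least two of `F_i`. -/
def nonlinPart (F : Fin n → MvPowerSeries (Fin n) R) (i : Fin n) : MvPowerSeries (Fin n) R :=
  fun d => if 2 ≤ d.degree then -MvPowerSeries.coeff d (F i) else 0

end System

/-! ### The variables `ū`, `u`, `Y` and the formal Gaussian integral -/

/-- The index set of the indeterminates `ū_i`, `u_i`, `Y_i`. -/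
abbrev Var (n : ℕ) : Type := Fin n ⊕ (Fin n ⊕ Fin n)

abbrev ubarVar {n : ℕ} (i : Fin n) : Var n := Sum.inl i

abbrev uVar {n : ℕ} (i : Fin n) : Var n := Sum.inr (Sum.inl i)

abbrev yVar {n : ℕ} (i : Fin n) : Var n := Sum.inr (Sum.inr i)

lemma yVar_injective {n : ℕ} : Function.Injective (yVar (n := n)) :=
  Sum.inr_injective.comp Sum.inr_injective

section Gauss

variable {R : Type*} [CommRing R] {n : ℕ}

open Classical in
/-- `I_A(τ₁, τ₂) = ∑_σ ∏_k (A⁻¹)_{τ₂(σ(k)) τ₁(k)}`, over all bijections `σ` between the index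
sets; it is zero if there are none. -/
def wickSum (A : Matrix (Fin n) (Fin n) R) {κ₁ κ₂ : Type*} [Fintype κ₁] [Fintype κ₂]
    (τ₁ : κ₁ → Fin n) (τ₂ : κ₂ → Fin n) : R :=
  ∑ σ : κ₁ ≃ κ₂, ∏ k, A⁻¹ (τ₂ (σ k)) (τ₁ k)

/-- The formal Gaussian integral of the monomial `ū ^ α₁ u ^ α₂`. The index set
`Σ i, Fin (α i)` with its first projection is a family of indices with multiplicities `α`;
see `gaussMonomial_eq` for the independence of this choice. -/
def gaussMonomial (A : Matrix (Fin n) (Fin n) R) (α₁ α₂ : Fin n → ℕ) : R :=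
  Ring.inverse A.det *
    wickSum A (Sigma.fst : (Σ i : Fin n, Fin (α₁ i)) → Fin n)
      (Sigma.fst : (Σ i : Fin n, Fin (α₂ i)) → Fin n)

/-- The summand of the formal Gaussian integral of `U` that comes from the multiindex
`m = (α₁, α₂, α₃)`. -/
def gaussTerm (A : Matrix (Fin n) (Fin n) R) (U : MvPowerSeries (Var n) R) (m : Var n →₀ ℕ) :
    MvPowerSeries (Fin n) R :=
  MvPowerSeries.monomial (m.comapDomain yVar yVar_injective.injOn)
    (MvPowerSeries.coeff m U *
      gaussMonomial A (fun i => m (ubarVar i)) (fun i => m (uVar i)))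

/-- The formal Gaussian integral of `U` exists. -/
def GaussIntegrable (A : Matrix (Fin n) (Fin n) R) (U : MvPowerSeries (Var n) R) : Prop :=
  SummableFamily (gaussTerm A U)

/-- The formal Gaussian integral `∫ dū du e^{-ū A u} U` in `R[[Y]]`. -/
def gaussIntegral (A : Matrix (Fin n) (Fin n) R) (U : MvPowerSeries (Var n) R) :
    MvPowerSeries (Fin n) R :=
  familySum (gaussTerm A U)

lemma wickSum_congr (A : Matrix (Fin n) (Fin n) R) {κ₁ κ₂ κ₁' κ₂' : Type*}
    [Fintype κ₁] [Fintype κ₂] [Fintype κ₁'] [Fintype κ₂']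
    (e₁ : κ₁ ≃ κ₁') (e₂ : κ₂ ≃ κ₂') (τ₁ : κ₁' → Fin n) (τ₂ : κ₂' → Fin n) :
    wickSum A (τ₁ ∘ e₁) (τ₂ ∘ e₂) = wickSum A τ₁ τ₂ := by
  classical
  unfold wickSum
  refine Fintype.sum_equiv (Equiv.equivCongr e₁ e₂) _ _ fun σ => ?_
  refine Fintype.prod_equiv e₁ _ _ fun k => ?_
  simp [Equiv.equivCongr]

lemma exists_sigma_equiv {κ : Type*} [Fintype κ] (τ : κ → Fin n) (α : Fin n → ℕ)
    (h : ∀ i, Nat.card {k // τ k = i} = α i) :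
    ∃ e : κ ≃ (Σ i : Fin n, Fin (α i)), Sigma.fst ∘ e = τ := by
  have f : ∀ i, {k // τ k = i} ≃ Fin (α i) := fun i =>
    (Finite.equivFin _).trans (finCongr (h i))
  refine ⟨(Equiv.sigmaFiberEquiv τ).symm.trans (Equiv.sigmaCongrRight f), ?_⟩
  funext k
  rfl

/-- The Gaussian integral of a monomial may be computed with any two families of indices that have
the given multiplicities. -/
lemma gaussMonomial_eq (A : Matrix (Fin n) (Fin n) R) (α₁ α₂ : Fin n → ℕ) {k₁ k₂ : ℕ}
    (τ₁ : Fin k₁ → Fin n) (τ₂ : Fin k₂ → Fin n)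
    (h₁ : ∀ i, Nat.card {k // τ₁ k = i} = α₁ i) (h₂ : ∀ i, Nat.card {k // τ₂ k = i} = α₂ i) :
    gaussMonomial A α₁ α₂ = Ring.inverse A.det * wickSum A τ₁ τ₂ := by
  obtain ⟨e₁, rfl⟩ := exists_sigma_equiv τ₁ α₁ h₁
  obtain ⟨e₂, rfl⟩ := exists_sigma_equiv τ₂ α₂ h₂
  rw [wickSum_congr, gaussMonomial]

/-- The interaction `ū H(u) + ū Y` in `R[[ū, u, Y]]`. -/
def interaction (F : Fin n → MvPowerSeries (Fin n) R) : MvPowerSeries (Var n) R :=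
  ∑ i, MvPowerSeries.X (ubarVar i) * MvPowerSeries.rename uVar (nonlinPart F i) +
    ∑ i, MvPowerSeries.X (ubarVar i) * MvPowerSeries.X (yVar i)

variable [Algebra ℚ R]

/-- `exp(ū H(u) + ū Y)`; the exponent has no constant term. -/
def expInteraction (F : Fin n → MvPowerSeries (Fin n) R) : MvPowerSeries (Var n) R :=
  (PowerSeries.exp R).subst (interaction F)

/-- The series `(∏_{i ∈ I} u_{τ_u(i)}) (∏_{j ∈ J} ū_{τ_ū(j)}) exp(ū H(u) + ū Y)`. -/
def corrIntegrand (F : Fin n → MvPowerSeries (Fin n) R) {I J : Type*} [Fintype I] [Fintype J]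
    (τu : I → Fin n) (τubar : J → Fin n) : MvPowerSeries (Var n) R :=
  (∏ i, MvPowerSeries.X (uVar (τu i))) * (∏ j, MvPowerSeries.X (ubarVar (τubar j))) *
    expInteraction F

/-- The unnormalized correlation function `⟨∏ u ∏ ū⟩_U`. -/
def unnormCorr (F : Fin n → MvPowerSeries (Fin n) R) {I J : Type*} [Fintype I] [Fintype J]
    (τu : I → Fin n) (τubar : J → Fin n) : MvPowerSeries (Fin n) R :=
  MvPowerSeries.C (linMatrix F).det * gaussIntegral (linMatrix F) (corrIntegrand F τu τubar)

/-- The partition function `Z = ⟨1⟩_U`. -/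
def partitionFunction (F : Fin n → MvPowerSeries (Fin n) R) : MvPowerSeries (Fin n) R :=
  MvPowerSeries.C (linMatrix F).det * gaussIntegral (linMatrix F) (expInteraction F)

end Gauss

/-! ### Feynman diagrams -/

/-- A pre-Feynman diagram structure of type `(I, J)` on the finite set `E`. -/
structure PreFeynman (I J E : Type*) [Fintype E] [DecidableEq E] where
  Eubar : Finset E
  Eu : Finset E
  Eint : Finset E
  Eext : Finset E
  piH : Finset (Finset E)
  piY : Finset (Finset E)
  rhoU : I → E
  rhoUbar : J → E
  disjoint_u_ubar : Disjoint Eu Eubar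
  union_u_ubar : Eu ∪ Eubar = Finset.univ
  disjoint_int_ext : Disjoint Eint Eext
  union_int_ext : Eint ∪ Eext = Finset.univ
  bijOn_rhoU : Set.BijOn rhoU Set.univ (Eext ∩ Eu : Finset E)
  bijOn_rhoUbar : Set.BijOn rhoUbar Set.univ (Eext ∩ Eubar : Finset E)
  disjoint_piH_piY : Disjoint piH piY
  /-- The blocks of `piH ∪ piY` form a partition of `Eint`. -/
  blocks_nonempty : ∀ B ∈ piH ∪ piY, B.Nonempty
  blocks_disjoint : ∀ B ∈ piH ∪ piY, ∀ B' ∈ piH ∪ piY, B ≠ B' → Disjoint B B'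
  blocks_cover : (piH ∪ piY).biUnion id = Eint
  card_ubar_piH : ∀ B ∈ piH, (B ∩ Eubar).card = 1
  card_u_piH : ∀ B ∈ piH, 2 ≤ (B ∩ Eu).card
  card_ubar_piY : ∀ B ∈ piY, (B ∩ Eubar).card = 1
  inter_u_piY : ∀ B ∈ piY, B ∩ Eu = ∅

/-- A Feynman diagram structure of type `(I, J)` on the finite set `E`: a pre-Feynman diagram
structure with a contraction scheme, i.e. a bijection from `Eubar` to `Eu`. -/
structure Feynman (I J E : Type*) [Fintype E] [DecidableEq E] extends PreFeynman I J E where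
  contr : Eubar ≃ Eu

namespace Feynman

variable {I J E E' E'' : Type*} [Fintype E] [DecidableEq E] [Fintype E'] [DecidableEq E']
  [Fintype E''] [DecidableEq E'']

/-- The bijection `σ : E → E'` transports the Feynman diagram structure `D` to `D'`. -/
structure IsTransport (σ : E ≃ E') (D : Feynman I J E) (D' : Feynman I J E') : Prop where
  Eubar_eq : D'.Eubar = D.Eubar.image σ
  Eu_eq : D'.Eu = D.Eu.image σ
  Eint_eq : D'.Eint = D.Eint.image σ
  Eext_eq : D'.Eext = D.Eext.image σ
  piH_eq : D'.piH = D.piH.image (Finset.image σ)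
  piY_eq : D'.piY = D.piY.image (Finset.image σ)
  rhoU_eq : D'.rhoU = σ ∘ D.rhoU
  rhoUbar_eq : D'.rhoUbar = σ ∘ D.rhoUbar
  contr_eq : ∀ (x : D.Eubar) (x' : D'.Eubar), (x' : E') = σ x →
    (D'.contr x' : E') = σ (D.contr x)

lemma IsTransport.refl (D : Feynman I J E) : IsTransport (Equiv.refl E) D D where
  Eubar_eq := by simp
  Eu_eq := by simp
  Eint_eq := by simp
  Eext_eq := by simp
  piH_eq := by
    have h : Finset.image (Equiv.refl E) = (id : Finset E → Finset E) := by
      funext B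
      simp
    rw [h, Finset.image_id]
  piY_eq := by
    have h : Finset.image (Equiv.refl E) = (id : Finset E → Finset E) := by
      funext B
      simp
    rw [h, Finset.image_id]
  rhoU_eq := by ext; simp
  rhoUbar_eq := by ext; simp
  contr_eq := by
    intro x x' h
    obtain rfl : x' = x := Subtype.ext h
    rfl

lemma IsTransport.symm {σ : E ≃ E'} {D : Feynman I J E} {D' : Feynman I J E'}
    (h : IsTransport σ D D') : IsTransport σ.symm D' D where
  Eubar_eq := by simp [h.Eubar_eq, Finset.image_image]
  Eu_eq := by simp [h.Eu_eq, Finset.image_image]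
  Eint_eq := by simp [h.Eint_eq, Finset.image_image]
  Eext_eq := by simp [h.Eext_eq, Finset.image_image]
  piH_eq := by simp [h.piH_eq, Finset.image_image, Function.comp_def]
  piY_eq := by simp [h.piY_eq, Finset.image_image, Function.comp_def]
  rhoU_eq := by funext i; simp [h.rhoU_eq]
  rhoUbar_eq := by funext i; simp [h.rhoUbar_eq]
  contr_eq := by
    intro x x' hx
    rw [Equiv.eq_symm_apply]
    exact (h.contr_eq x' x (by rw [hx]; simp)).symm

lemma IsTransport.trans {σ : E ≃ E'} {σ' : E' ≃ E''} {D : Feynman I J E} {D' : Feynman I J E'}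
    {D'' : Feynman I J E''} (h : IsTransport σ D D') (h' : IsTransport σ' D' D'') :
    IsTransport (σ.trans σ') D D'' where
  Eubar_eq := by simp [h'.Eubar_eq, h.Eubar_eq, Finset.image_image]
  Eu_eq := by simp [h'.Eu_eq, h.Eu_eq, Finset.image_image]
  Eint_eq := by simp [h'.Eint_eq, h.Eint_eq, Finset.image_image]
  Eext_eq := by simp [h'.Eext_eq, h.Eext_eq, Finset.image_image]
  piH_eq := by simp [h'.piH_eq, h.piH_eq, Finset.image_image, Function.comp_def]
  piY_eq := by simp [h'.piY_eq, h.piY_eq, Finset.image_image, Function.comp_def]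
  rhoU_eq := by funext i; simp [h'.rhoU_eq, h.rhoU_eq]
  rhoUbar_eq := by funext i; simp [h'.rhoUbar_eq, h.rhoUbar_eq]
  contr_eq := by
    intro x x'' hx
    have hm : σ x ∈ D'.Eubar := by
      rw [h.Eubar_eq]
      exact Finset.mem_image_of_mem _ x.2
    have h1 := h.contr_eq x ⟨σ x, hm⟩ rfl
    have h2 := h'.contr_eq ⟨σ x, hm⟩ x'' hx
    rw [h2, h1]
    rfl

/-- The automorphism group of a Feynman diagram structure (as a set of permutations of `E`). -/
def autSet (D : Feynman I J E) : Set (Equiv.Perm E) := {σ | IsTransport σ D D}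

/-- The vertex set of the digraph of `D`: external half-lines as singletons, `H`-vertices and
`Y`-vertices. -/
def vertices (D : Feynman I J E) : Finset (Finset E) :=
  (D.Eext ∩ D.Eu).image singleton ∪ (D.Eext ∩ D.Eubar).image singleton ∪ D.piH ∪ D.piY

/-- The digraph of `D`: a link from `a` to `b` for `x ∈ a ∩ Eubar` contracted with `y ∈ b ∩ Eu`. -/
def link (D : Feynman I J E) (a b : D.vertices) : Prop :=
  ∃ x : D.Eubar, (x : E) ∈ (a : Finset E) ∧ (D.contr x : E) ∈ (b : Finset E)

/-- `D` is connected: its digraph, with orientations forgotten, connects its vertex set, which is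
not empty. -/
def IsConnected (D : Feynman I J E) : Prop := (SimpleGraph.fromRel D.link).Connected

section Amplitude

variable {R : Type*} [CommRing R] {n : ℕ}

/-- Index attributions `α : E → [n]`, compatible with the external assignments. -/
def IsAttribution (D : Feynman I J E) (τu : I → Fin n) (τubar : J → Fin n) (α : E → Fin n) :
    Prop :=
  (∀ i, α (D.rhoU i) = τu i) ∧ ∀ j, α (D.rhoUbar j) = τubar j

/-- `H(B, α) = H^{[p]}_{α(x̄), α(y₁) … α(y_p)}` for an `H`-vertex `B`, where
`B ∩ Eubar = {x̄}` (so the product has one factor) and `B ∩ Eu = {y₁, …, y_p}`. -/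
def vertexH (D : Feynman I J E) (F : Fin n → MvPowerSeries (Fin n) R) (B : Finset E)
    (α : E → Fin n) : R :=
  ∏ x ∈ B ∩ D.Eubar, tensorCoeff (nonlinPart F (α x)) ((B ∩ D.Eu).val.map α)

/-- `Y(B, α) = Y_{α(x̄)}` for a `Y`-vertex `B`, where `B ∩ Eubar = {x̄}` (so the product has one
factor). -/
def vertexY (D : Feynman I J E) (R : Type*) [CommRing R] (B : Finset E) (α : E → Fin n) :
    MvPowerSeries (Fin n) R :=
  ∏ x ∈ B ∩ D.Eubar, MvPowerSeries.X (α x)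

open Classical in
/-- The amplitude of a Feynman diagram structure. -/
def amplitude (D : Feynman I J E) (F : Fin n → MvPowerSeries (Fin n) R)
    (τu : I → Fin n) (τubar : J → Fin n) : MvPowerSeries (Fin n) R :=
  ∑ α : E → Fin n with D.IsAttribution τu τubar α,
    MvPowerSeries.C (∏ x : D.Eubar, (linMatrix F)⁻¹ (α (D.contr x)) (α x)) *
      MvPowerSeries.C (∏ B ∈ D.piH, D.vertexH F B α) *
      ∏ B ∈ D.piY, D.vertexY R B α

end Amplitude

end Feynman

/-! ### Isomorphism classes of connected diagrams and connected correlation functions -/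

/-- Pairs `(E, D)` of a finite set and a connected Feynman diagram structure of type `(I, J)` on it.
Up to isomorphism the finite set may be taken to be `Fin k`. -/
def ConnectedDiagram (I J : Type*) : Type _ :=
  {x : Σ k : ℕ, Feynman I J (Fin k) // x.2.IsConnected}

/-- Isomorphism of connected Feynman diagrams. -/
instance connectedSetoid (I J : Type*) : Setoid (ConnectedDiagram I J) where
  r x y := ∃ σ : Fin x.1.1 ≃ Fin y.1.1, Feynman.IsTransport σ x.1.2 y.1.2
  iseqv :=
    { refl := fun x => ⟨_, Feynman.IsTransport.refl x.1.2⟩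
      symm := fun ⟨_, h⟩ => ⟨_, h.symm⟩
      trans := fun ⟨_, h⟩ ⟨_, h'⟩ => ⟨_, h.trans h'⟩ }

/-- Isomorphism classes of connected Feynman diagrams of type `(I, J)`. -/
abbrev ConnectedClass (I J : Type*) : Type _ := Quotient (connectedSetoid I J)

section Correlation

variable {R : Type*} [CommRing R] [Algebra ℚ R] {n : ℕ}

/-- The contribution `amplitude / #Aut` of an isomorphism class, evaluated on a representative. -/
def connectedTerm (F : Fin n → MvPowerSeries (Fin n) R) {I J : Type*}
    (τu : I → Fin n) (τubar : J → Fin n) (c : ConnectedClass I J) : MvPowerSeries (Fin n) R :=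
  ((Nat.card c.out.1.2.autSet : ℚ)⁻¹) • c.out.1.2.amplitude F τu τubar

/-- The connected correlation function `⟨∏ u ∏ ū⟩_C`. -/
def connCorr (F : Fin n → MvPowerSeries (Fin n) R) {I J : Type*}
    (τu : I → Fin n) (τubar : J → Fin n) : MvPowerSeries (Fin n) R :=
  familySum (connectedTerm F τu τubar)

end Correlation

/-- The sets `π` of pairs `(S, T)` of subsets of `I` and `J`, not simultaneously empty, such that
the first components partition `I` and the second components partition `J` (empty components being
disregarded; distinct pairs have disjoint components). -/
def IsPairPartition {I J : Type*} (π : Finset (Finset I × Finset J)) : Prop :=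
  (∀ p ∈ π, p.1.Nonempty ∨ p.2.Nonempty) ∧
  (∀ p ∈ π, ∀ q ∈ π, p ≠ q → Disjoint p.1 q.1 ∧ Disjoint p.2 q.2) ∧
  (∀ i : I, ∃ p ∈ π, i ∈ p.1) ∧
  (∀ j : J, ∃ p ∈ π, j ∈ p.2)

end

end FeynmanCluster

namespace FeynmanCluster

noncomputable section

/-! ### Reduced diagrams and their state sums

A diagram of type `(I, J)` with interaction vertices `V` is encoded by the map
`φ : J ⊕ V → I ⊕ V` that sends the owner of a `ū`-half-line to the owner of the `u`-half-line with
which it is contracted. -/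

section StateSum

variable {L S : Type*} [CommRing S]

/-! Every interaction vertex owns exactly one `ū`-half-line. A contraction scheme is therefore the
same thing as a map `φ : J ⊕ V → I ⊕ V` from the owners of `ū`-half-lines to the owners of
`u`-half-lines. The `u`-half-lines of a vertex are told apart by their partners, so they need no
labels and no factor `1/p!` survives; the arity of `v` is the size of the fibre over `v`. One may
sum over all maps `φ`: `rootFactor` kills those with a fibre over `I` that is not a singleton, and a
vertex with a one-element fibre has weight zero because `H` starts in degree two. Empty fibres are
`Y`-vertices, fibres of size at least two are `H`-vertices.

Wick's theorem. After expansion of the exponential, the bijections in the Gaussian integral of a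
monomial are sorted by the pair `(φ, b)` of owners and labels that they induce. Each admissible pair
arises `∏ β(v)!` times, and this factor turns Taylor coefficients into tensor coefficients. Hence
the unnormalized correlation is `∑_N 1/N! ∑_φ amplitude(φ)`; see `wickMonomial_exponents`,
`sum_vertexCoeff_mul_wickMonomial` and `unnormCorr_eq`.

Cluster recursion. Amplitudes are multiplicative on disjoint unions, and the factors `1/N!` turn the
choice of a subset of the vertices into a Cauchy product. Splitting off the component of an external
half-line `x` gives `W(s) = ∑_{x ∈ B ⊆ s} C(B) W(s \ B)` for sets `s` of external half-lines.
Induction yields `W(s) = W(∅) ∑_π ∏_{B ∈ π} C(B)`, where `W(∅)` becomes `Z`; see `totalSum_eq_sum`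
and `totalSeries_eq_mul_sum`.

Symmetry factors. Isomorphisms of Feynman diagrams correspond to bijections of the vertices that
intertwine the maps `φ`. By orbit counting an isomorphism class with `N` vertices contains `N!/#Aut`
maps, so `∑_φ 1/N!` over connected `φ` is the sum of amplitude over `#Aut`; see `exists_intertwines`
and `connCorr_eq`.

Finiteness. Counting half-lines shows that a monomial of degree `k` in `Y` meets only diagrams with
at most `2k + #J` vertices. This gives all summability claims. It also lets the number of vertices
be recorded by a polynomial variable, and setting that variable to `1` is a ring homomorphism. -/

open Classical in
/-- The multiset of the labels `b x` over the fibre of `φ` at `t`. -/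
def fiberLabels {X T : Type*} [Fintype X] (φ : X → T) (b : X → L) (t : T) : Multiset L :=
  (Finset.univ.filter fun x => φ x = t).val.map b

lemma card_fiberLabels {X T : Type*} [Fintype X] (φ : X → T) (b : X → L) (t : T) :
    (fiberLabels φ b t).card = Nat.card {x // φ x = t} := by
  classical
  simp [fiberLabels, Fintype.card_subtype, Finset.card]

lemma fiberLabels_conj {X T X' T' : Type*} [Fintype X] [Fintype X'] (e : X ≃ X')
    {k : T → T'} (hk : Function.Injective k) {φ : X → T} {φ' : X' → T'}
    (h : ∀ x, φ' (e x) = k (φ x)) (b : X' → L) (t : T) :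
    fiberLabels φ' b (k t) = fiberLabels φ (b ∘ e) t := by
  classical
  have hf : (Finset.univ.filter fun x' => φ' x' = k t) =
      (Finset.univ.filter fun x => φ x = t).map e.toEmbedding := by
    ext x'
    obtain ⟨x, rfl⟩ := e.surjective x'
    simp [h, hk.eq_iff]
  simp [fiberLabels, hf]

/-- Restriction of `φ'` along an embedding whose complement does not meet the fibre. -/
lemma fiberLabels_embedding {X T X' T' : Type*} [Fintype X] [Fintype X'] (e : X ↪ X')
    {k : T → T'} (hk : Function.Injective k) {φ : X → T} {φ' : X' → T'}
    (h : ∀ x, φ' (e x) = k (φ x)) (b : X' → L) (t : T)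
    (hr : ∀ x', φ' x' = k t → x' ∈ Set.range e) :
    fiberLabels φ' b (k t) = fiberLabels φ (b ∘ e) t := by
  classical
  have hf : (Finset.univ.filter fun x' => φ' x' = k t) =
      (Finset.univ.filter fun x => φ x = t).map e := by
    ext x'
    simp only [Finset.mem_filter, Finset.mem_univ, true_and, Finset.mem_map]
    constructor
    · intro hx
      obtain ⟨x, rfl⟩ := hr x' hx
      exact ⟨x, hk (by rw [← h, hx]), rfl⟩
    · rintro ⟨x, rfl, rfl⟩
      exact h x
  simp [fiberLabels, hf]

variable {I J V I' J' V' : Type*} [Fintype I] [Fintype J] [Fintype V]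
  [Fintype I'] [Fintype J'] [Fintype V']

open Classical in
/-- The factor of an external `u`-half-line with label `k`, to which exactly one `ū`-half-line has to
be contracted. -/
def rootFactor (S : Type*) [CommRing S] (k : L) (s : Multiset L) : S := if s = {k} then 1 else 0

/-- The weight of a labelling: `a` labels the `ū`-half-lines of the vertices and `b` the
`u`-half-lines. -/
def stateWeight (P : L → L → S) (g : L → Multiset L → S) (τu : I → L) (τubar : J → L)
    (φ : J ⊕ V → I ⊕ V) (a : V → L) (b : J ⊕ V → L) : S :=
  (∏ x, P (b x) (Sum.elim τubar a x)) *
    (∏ i, rootFactor S (τu i) (fiberLabels φ b (Sum.inl i))) *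
    ∏ v, g (a v) (fiberLabels φ b (Sum.inr v))

open Classical in
/-- The amplitude of a reduced diagram. -/
def diagAmp [Fintype L] (P : L → L → S) (g : L → Multiset L → S) (τu : I → L) (τubar : J → L)
    (φ : J ⊕ V → I ⊕ V) : S :=
  ∑ a : V → L, ∑ b : J ⊕ V → L, stateWeight P g τu τubar φ a b

lemma stateWeight_conj (P : L → L → S) (g : L → Multiset L → S) (eI : I ≃ I') (eJ : J ≃ J')
    (eV : V ≃ V') (τu : I' → L) (τubar : J' → L) {φ : J ⊕ V → I ⊕ V} {φ' : J' ⊕ V' → I' ⊕ V'}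
    (h : ∀ x, φ' (Sum.map eJ eV x) = Sum.map eI eV (φ x)) (a : V' → L) (b : J' ⊕ V' → L) :
    stateWeight P g τu τubar φ' a b =
      stateWeight P g (τu ∘ eI) (τubar ∘ eJ) φ (a ∘ eV) (b ∘ Sum.map eJ eV) := by
  have hk : Function.Injective (Sum.map eI eV) :=
    Sum.map_injective.2 ⟨eI.injective, eV.injective⟩
  have hl := fun t => fiberLabels_conj (Equiv.sumCongr eJ eV) hk (φ := φ) (φ' := φ') h b t
  unfold stateWeight
  congr 1
  · congr 1
    · refine (Fintype.prod_equiv (Equiv.sumCongr eJ eV) _ _ ?_).symm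
      rintro (j | v) <;> rfl
    · refine (Fintype.prod_equiv eI _ _ fun i => ?_).symm
      have := hl (Sum.inl i)
      simp only [Sum.map_inl] at this
      rw [this]
      rfl
  · refine (Fintype.prod_equiv eV _ _ fun v => ?_).symm
    have := hl (Sum.inr v)
    simp only [Sum.map_inr] at this
    rw [this]
    rfl

lemma diagAmp_conj [Fintype L] (P : L → L → S) (g : L → Multiset L → S) (eI : I ≃ I') (eJ : J ≃ J')
    (eV : V ≃ V') (τu : I' → L) (τubar : J' → L) {φ : J ⊕ V → I ⊕ V} {φ' : J' ⊕ V' → I' ⊕ V'}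
    (h : ∀ x, φ' (Sum.map eJ eV x) = Sum.map eI eV (φ x)) :
    diagAmp P g τu τubar φ' = diagAmp P g (τu ∘ eI) (τubar ∘ eJ) φ := by
  classical
  unfold diagAmp
  refine Fintype.sum_equiv (Equiv.arrowCongr eV.symm (Equiv.refl L)) _ _ fun a => ?_
  refine Fintype.sum_equiv (Equiv.arrowCongr (Equiv.sumCongr eJ eV).symm (Equiv.refl L)) _ _
    fun b => ?_
  exact stateWeight_conj P g eI eJ eV τu τubar h a b

/-- The disjoint union of two reduced diagrams. -/
def joinDiag {I₁ I₂ J₁ J₂ V₁ V₂ : Type*} (φ₁ : J₁ ⊕ V₁ → I₁ ⊕ V₁) (φ₂ : J₂ ⊕ V₂ → I₂ ⊕ V₂) :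
    (J₁ ⊕ J₂) ⊕ (V₁ ⊕ V₂) → (I₁ ⊕ I₂) ⊕ (V₁ ⊕ V₂)
  | Sum.inl (Sum.inl j) => Sum.map Sum.inl Sum.inl (φ₁ (Sum.inl j))
  | Sum.inl (Sum.inr j) => Sum.map Sum.inr Sum.inr (φ₂ (Sum.inl j))
  | Sum.inr (Sum.inl v) => Sum.map Sum.inl Sum.inl (φ₁ (Sum.inr v))
  | Sum.inr (Sum.inr v) => Sum.map Sum.inr Sum.inr (φ₂ (Sum.inr v))

section Join

variable {I₁ I₂ J₁ J₂ V₁ V₂ : Type*} (φ₁ : J₁ ⊕ V₁ → I₁ ⊕ V₁) (φ₂ : J₂ ⊕ V₂ → I₂ ⊕ V₂)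

lemma joinDiag_left (x : J₁ ⊕ V₁) :
    joinDiag φ₁ φ₂ (Sum.map Sum.inl Sum.inl x) = Sum.map Sum.inl Sum.inl (φ₁ x) := by
  rcases x with j | v <;> rfl

lemma joinDiag_right (x : J₂ ⊕ V₂) :
    joinDiag φ₁ φ₂ (Sum.map Sum.inr Sum.inr x) = Sum.map Sum.inr Sum.inr (φ₂ x) := by
  rcases x with j | v <;> rfl

lemma map_inl_ne_map_inr (x : I₁ ⊕ V₁) (y : I₂ ⊕ V₂) :
    (Sum.map Sum.inl Sum.inl x : (I₁ ⊕ I₂) ⊕ (V₁ ⊕ V₂)) ≠ Sum.map Sum.inr Sum.inr y := by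
  rcases x with j | v <;> rcases y with j' | v' <;> simp

lemma map_inl_or_map_inr (x : (I₁ ⊕ I₂) ⊕ (V₁ ⊕ V₂)) :
    (∃ y : I₁ ⊕ V₁, x = Sum.map Sum.inl Sum.inl y) ∨
      ∃ y : I₂ ⊕ V₂, x = Sum.map Sum.inr Sum.inr y := by
  rcases x with (j | j) | (v | v)
  · exact Or.inl ⟨Sum.inl j, rfl⟩
  · exact Or.inr ⟨Sum.inl j, rfl⟩
  · exact Or.inl ⟨Sum.inr v, rfl⟩
  · exact Or.inr ⟨Sum.inr v, rfl⟩

variable [Fintype J₁] [Fintype J₂] [Fintype V₁] [Fintype V₂]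

/-- No arrow of the second part ends in the first, so a fibre over the first part consists of arrows
of the first part only. -/
lemma fiberLabels_joinDiag_left (b : (J₁ ⊕ J₂) ⊕ (V₁ ⊕ V₂) → L) (t : I₁ ⊕ V₁) :
    fiberLabels (joinDiag φ₁ φ₂) b (Sum.map Sum.inl Sum.inl t) =
      fiberLabels φ₁ (b ∘ Sum.map Sum.inl Sum.inl) t := by
  refine fiberLabels_embedding ⟨Sum.map Sum.inl Sum.inl, Sum.map_injective.2
    ⟨Sum.inl_injective, Sum.inl_injective⟩⟩ (Sum.map_injective.2
    ⟨Sum.inl_injective, Sum.inl_injective⟩) (joinDiag_left φ₁ φ₂) b t fun x hx => ?_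
  rcases map_inl_or_map_inr x with ⟨y, rfl⟩ | ⟨y, rfl⟩
  · exact ⟨y, rfl⟩
  · rw [joinDiag_right] at hx
    exact absurd hx.symm (map_inl_ne_map_inr _ _)

lemma fiberLabels_joinDiag_right (b : (J₁ ⊕ J₂) ⊕ (V₁ ⊕ V₂) → L) (t : I₂ ⊕ V₂) :
    fiberLabels (joinDiag φ₁ φ₂) b (Sum.map Sum.inr Sum.inr t) =
      fiberLabels φ₂ (b ∘ Sum.map Sum.inr Sum.inr) t := by
  refine fiberLabels_embedding ⟨Sum.map Sum.inr Sum.inr, Sum.map_injective.2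
    ⟨Sum.inr_injective, Sum.inr_injective⟩⟩ (Sum.map_injective.2
    ⟨Sum.inr_injective, Sum.inr_injective⟩) (joinDiag_right φ₁ φ₂) b t fun x hx => ?_
  rcases map_inl_or_map_inr x with ⟨y, rfl⟩ | ⟨y, rfl⟩
  · rw [joinDiag_left] at hx
    exact absurd hx (map_inl_ne_map_inr _ _)
  · exact ⟨y, rfl⟩

/-- Each of the three products runs over a sum type, and the fibres of the two parts do not mix. -/
lemma stateWeight_joinDiag [Fintype I₁] [Fintype I₂] (P : L → L → S) (g : L → Multiset L → S) (τu : I₁ ⊕ I₂ → L)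
    (τubar : J₁ ⊕ J₂ → L) (a : V₁ ⊕ V₂ → L) (b : (J₁ ⊕ J₂) ⊕ (V₁ ⊕ V₂) → L) :
    stateWeight P g τu τubar (joinDiag φ₁ φ₂) a b =
      stateWeight P g (τu ∘ Sum.inl) (τubar ∘ Sum.inl) φ₁ (a ∘ Sum.inl)
          (b ∘ Sum.map Sum.inl Sum.inl) *
        stateWeight P g (τu ∘ Sum.inr) (τubar ∘ Sum.inr) φ₂ (a ∘ Sum.inr)
          (b ∘ Sum.map Sum.inr Sum.inr) := by
  have h₁ := fiberLabels_joinDiag_left φ₁ φ₂ b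
  have h₂ := fiberLabels_joinDiag_right φ₁ φ₂ b
  have h₁i := fun i => h₁ (Sum.inl i)
  have h₁v := fun i => h₁ (Sum.inr i)
  have h₂i := fun i => h₂ (Sum.inl i)
  have h₂v := fun i => h₂ (Sum.inr i)
  simp only [Sum.map_inl, Sum.map_inr] at h₁i h₁v h₂i h₂v
  simp only [stateWeight, Fintype.prod_sum_type, h₁i, h₁v, h₂i, h₂v, Sum.elim_inl, Sum.elim_inr,
    Function.comp_apply, Sum.map_inl, Sum.map_inr]
  ring

/-- Functions on the half-lines of a disjoint union. -/
def sumSumArrowEquiv (L J₁ J₂ V₁ V₂ : Type*) :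
    ((J₁ ⊕ J₂) ⊕ (V₁ ⊕ V₂) → L) ≃ (J₁ ⊕ V₁ → L) × (J₂ ⊕ V₂ → L) :=
  (Equiv.arrowCongr (Equiv.sumSumSumComm J₁ J₂ V₁ V₂) (Equiv.refl L)).trans
    (Equiv.sumArrowEquivProdArrow _ _ _)

/-- A labelling of a disjoint union is a pair of labellings and the weight factors, so
distributivity gives the product of the two state sums. -/
lemma diagAmp_joinDiag [Fintype L] [Fintype I₁] [Fintype I₂] (P : L → L → S) (g : L → Multiset L → S) (τu : I₁ ⊕ I₂ → L)
    (τubar : J₁ ⊕ J₂ → L) :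
    diagAmp P g τu τubar (joinDiag φ₁ φ₂) =
      diagAmp P g (τu ∘ Sum.inl) (τubar ∘ Sum.inl) φ₁ *
        diagAmp P g (τu ∘ Sum.inr) (τubar ∘ Sum.inr) φ₂ := by
  classical
  unfold diagAmp
  simp only [Fintype.sum_mul_sum]
  conv_rhs => rw [← Fintype.sum_prod_type']
  refine Finset.sum_equiv (Equiv.sumArrowEquivProdArrow _ _ _) (by simp) fun a _ => ?_
  conv_rhs => rw [← Fintype.sum_prod_type']
  refine Finset.sum_equiv (sumSumArrowEquiv L J₁ J₂ V₁ V₂) (by simp) fun b _ => ?_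
  rw [stateWeight_joinDiag]
  congr 2
  · funext x
    rcases x with j | v <;> rfl
  · funext x
    rcases x with j | v <;> rfl

end Join

end StateSum

end

end FeynmanCluster

namespace FeynmanCluster

noncomputable section

/-! ### Connected components of reduced diagrams -/

section Components

variable {I J V I' J' V' : Type*}

/-- The owner of a `u`-half-line as a node of the diagram. -/
def headNode (J : Type*) : I ⊕ V → I ⊕ (J ⊕ V) := Sum.map id Sum.inr

/-- A set of nodes that is a union of connected components. -/
def IsSaturated (φ : J ⊕ V → I ⊕ V) (K : Set (I ⊕ (J ⊕ V))) : Prop :=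
  ∀ x, Sum.inr x ∈ K ↔ headNode J (φ x) ∈ K

/-- A reduced diagram is connected if its nodes form one connected component. -/
def IsConn (φ : J ⊕ V → I ⊕ V) : Prop :=
  Nonempty (I ⊕ (J ⊕ V)) ∧ ∀ K, IsSaturated φ K → K = ∅ ∨ K = Set.univ

/-- `K` is the connected component of the node `w`. -/
def IsComponent (φ : J ⊕ V → I ⊕ V) (w : I ⊕ (J ⊕ V)) (K : Set (I ⊕ (J ⊕ V))) : Prop :=
  IsSaturated φ K ∧ w ∈ K ∧ ∀ K', IsSaturated φ K' → w ∈ K' → K ⊆ K'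

lemma IsSaturated.compl {φ : J ⊕ V → I ⊕ V} {K : Set (I ⊕ (J ⊕ V))} (h : IsSaturated φ K) :
    IsSaturated φ Kᶜ := fun x => not_congr (h x)

/-- Saturation is a family of equivalences between memberships and is thus stable under
intersections; the component is the intersection of all saturated sets through `w`. -/
lemma existsUnique_isComponent (φ : J ⊕ V → I ⊕ V) (w : I ⊕ (J ⊕ V)) :
    ∃! K, IsComponent φ w K := by
  refine ⟨⋂₀ {K | IsSaturated φ K ∧ w ∈ K}, ⟨fun x => ?_, fun K hK => hK.2, fun K' h h' =>
    Set.sInter_subset_of_mem ⟨h, h'⟩⟩, fun K hK => ?_⟩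
  · simp only [Set.mem_sInter, Set.mem_ofPred_eq]
    exact forall₂_congr fun K hK => hK.1 x
  · refine Set.Subset.antisymm (Set.subset_sInter fun K' hK' => hK.2.2 K' hK'.1 hK'.2)
      (Set.sInter_subset_of_mem ⟨hK.1, hK.2.1⟩)

/-- Relabelling of the nodes. -/
def nodeEquiv (eI : I ≃ I') (eJ : J ≃ J') (eV : V ≃ V') : I ⊕ (J ⊕ V) ≃ I' ⊕ (J' ⊕ V') :=
  Equiv.sumCongr eI (Equiv.sumCongr eJ eV)

/-- Relabelling of reduced diagrams. -/
def conjDiag (eI : I ≃ I') (eJ : J ≃ J') (eV : V ≃ V') :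
    (J ⊕ V → I ⊕ V) ≃ (J' ⊕ V' → I' ⊕ V') :=
  Equiv.arrowCongr (Equiv.sumCongr eJ eV) (Equiv.sumCongr eI eV)

lemma conjDiag_apply (eI : I ≃ I') (eJ : J ≃ J') (eV : V ≃ V') (φ : J ⊕ V → I ⊕ V) (x : J ⊕ V) :
    conjDiag eI eJ eV φ (Sum.map eJ eV x) = Sum.map eI eV (φ x) := by
  have : (Equiv.sumCongr eJ eV).symm (Sum.map eJ eV x) = x :=
    (Equiv.sumCongr eJ eV).symm_apply_apply x
  simp only [conjDiag, Equiv.arrowCongr_apply, Function.comp_apply, this]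
  rfl

lemma isSaturated_conjDiag (eI : I ≃ I') (eJ : J ≃ J') (eV : V ≃ V') (φ : J ⊕ V → I ⊕ V)
    (K : Set (I' ⊕ (J' ⊕ V'))) :
    IsSaturated (conjDiag eI eJ eV φ) K ↔ IsSaturated φ (nodeEquiv eI eJ eV ⁻¹' K) := by
  have hn : ∀ t : I ⊕ V, headNode J' (Sum.map eI eV t) = nodeEquiv eI eJ eV (headNode J t) := by
    rintro (i | v) <;> rfl
  refine (Equiv.forall_congr_right (Equiv.sumCongr eJ eV)).symm.trans (forall_congr' fun x => ?_)
  have := conjDiag_apply eI eJ eV φ x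
  rw [Equiv.sumCongr_apply, this, hn]
  rfl

lemma isComponent_conjDiag (eI : I ≃ I') (eJ : J ≃ J') (eV : V ≃ V') (φ : J ⊕ V → I ⊕ V)
    (w : I ⊕ (J ⊕ V)) (K : Set (I' ⊕ (J' ⊕ V'))) :
    IsComponent (conjDiag eI eJ eV φ) (nodeEquiv eI eJ eV w) K ↔
      IsComponent φ w (nodeEquiv eI eJ eV ⁻¹' K) := by
  unfold IsComponent
  refine and_congr (isSaturated_conjDiag eI eJ eV φ K) (and_congr Iff.rfl ?_)
  -- A bijection makes every set of old nodes a preimage, so quantifying over sets may be moved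
  -- across the relabelling.
  refine Iff.trans ?_ (nodeEquiv eI eJ eV).injective.preimage_surjective.forall.symm
  refine forall_congr' fun K' => ?_
  rw [isSaturated_conjDiag, (nodeEquiv eI eJ eV).surjective.preimage_subset_preimage_iff]
  rfl

lemma isConn_conjDiag (eI : I ≃ I') (eJ : J ≃ J') (eV : V ≃ V') (φ : J ⊕ V → I ⊕ V) :
    IsConn (conjDiag eI eJ eV φ) ↔ IsConn φ := by
  refine and_congr (nodeEquiv eI eJ eV).nonempty_congr.symm ?_
  refine Iff.trans ?_ (nodeEquiv eI eJ eV).injective.preimage_surjective.forall.symm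
  refine forall_congr' fun K' => ?_
  rw [isSaturated_conjDiag, Set.preimage_eq_univ_iff, (nodeEquiv eI eJ eV).range_eq_univ,
    Set.preimage_eq_empty_iff, (nodeEquiv eI eJ eV).range_eq_univ, Set.univ_subset_iff,
    Set.disjoint_univ]

end Components

/-! ### Components of a disjoint union -/

section JoinComponents

variable {I₁ I₂ J₁ J₂ V₁ V₂ : Type*}

/-- The nodes of the first part of a disjoint union. -/
def leftNode : I₁ ⊕ (J₁ ⊕ V₁) → (I₁ ⊕ I₂) ⊕ ((J₁ ⊕ J₂) ⊕ (V₁ ⊕ V₂)) :=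
  Sum.map Sum.inl (Sum.map Sum.inl Sum.inl)

lemma leftNode_injective :
    Function.Injective (leftNode (I₁ := I₁) (I₂ := I₂) (J₁ := J₁) (J₂ := J₂) (V₁ := V₁)
      (V₂ := V₂)) :=
  Sum.map_injective.2 ⟨Sum.inl_injective, Sum.map_injective.2
    ⟨Sum.inl_injective, Sum.inl_injective⟩⟩

lemma headNode_map_inl (t : I₁ ⊕ V₁) :
    headNode (J₁ ⊕ J₂) (Sum.map Sum.inl Sum.inl t : (I₁ ⊕ I₂) ⊕ (V₁ ⊕ V₂)) =
      leftNode (headNode J₁ t) := by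
  rcases t with i | v <;> rfl

lemma headNode_map_inr_notMem (t : I₂ ⊕ V₂) :
    headNode (J₁ ⊕ J₂) (Sum.map Sum.inr Sum.inr t : (I₁ ⊕ I₂) ⊕ (V₁ ⊕ V₂)) ∉
      Set.range (leftNode (I₁ := I₁) (J₁ := J₁) (V₁ := V₁)) := by
  rintro ⟨i | j | v, h⟩ <;> rcases t with i' | v' <;> simp [leftNode, headNode] at h

lemma inr_map_inr_notMem (x : J₂ ⊕ V₂) :
    (Sum.inr (Sum.map Sum.inr Sum.inr x) : (I₁ ⊕ I₂) ⊕ ((J₁ ⊕ J₂) ⊕ (V₁ ⊕ V₂))) ∉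
      Set.range (leftNode (I₁ := I₁) (J₁ := J₁) (V₁ := V₁)) := by
  rintro ⟨i | j | v, h⟩ <;> rcases x with i' | v' <;> simp [leftNode] at h

lemma inr_map_inl (x : J₁ ⊕ V₁) :
    (Sum.inr (Sum.map Sum.inl Sum.inl x) : (I₁ ⊕ I₂) ⊕ ((J₁ ⊕ J₂) ⊕ (V₁ ⊕ V₂))) =
      leftNode (Sum.inr x) := rfl

lemma joinDiag_injective :
    Function.Injective fun p : (J₁ ⊕ V₁ → I₁ ⊕ V₁) × (J₂ ⊕ V₂ → I₂ ⊕ V₂) =>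
      joinDiag p.1 p.2 := by
  rintro ⟨φ₁, φ₂⟩ ⟨ψ₁, ψ₂⟩ h
  refine Prod.ext (funext fun x => ?_) (funext fun x => ?_)
  · have := congrFun h (Sum.map Sum.inl Sum.inl x)
    simp only [joinDiag_left] at this
    exact Sum.map_injective.2 ⟨Sum.inl_injective, Sum.inl_injective⟩ this
  · have := congrFun h (Sum.map Sum.inr Sum.inr x)
    simp only [joinDiag_right] at this
    exact Sum.map_injective.2 ⟨Sum.inr_injective, Sum.inr_injective⟩ this

/-- Arrows of the second part have both ends outside the image and impose no condition; only the
arrows of `φ₁` matter. -/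
lemma isSaturated_joinDiag_image (φ₁ : J₁ ⊕ V₁ → I₁ ⊕ V₁) (φ₂ : J₂ ⊕ V₂ → I₂ ⊕ V₂)
    (K : Set (I₁ ⊕ (J₁ ⊕ V₁))) :
    IsSaturated (joinDiag φ₁ φ₂) (leftNode '' K) ↔ IsSaturated φ₁ K := by
  have key : ∀ x, (Sum.inr (Sum.map Sum.inl Sum.inl x) ∈ leftNode (I₂ := I₂) (J₂ := J₂)
      (V₂ := V₂) '' K ↔ headNode (J₁ ⊕ J₂) (joinDiag φ₁ φ₂ (Sum.map Sum.inl Sum.inl x)) ∈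
        leftNode '' K) ↔ (Sum.inr x ∈ K ↔ headNode J₁ (φ₁ x) ∈ K) := fun x => by
    rw [inr_map_inl, joinDiag_left, headNode_map_inl, leftNode_injective.mem_set_image,
      leftNode_injective.mem_set_image]
  constructor
  · exact fun h x => (key x).1 (h _)
  · intro h x
    rcases map_inl_or_map_inr x with ⟨y, rfl⟩ | ⟨y, rfl⟩
    · exact (key y).2 (h y)
    · rw [joinDiag_right]
      exact iff_of_false (fun hx => inr_map_inr_notMem y (Set.image_subset_range _ _ hx))
        fun hx => headNode_map_inr_notMem _ (Set.image_subset_range _ _ hx)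

lemma IsSaturated.preimage_leftNode {φ₁ : J₁ ⊕ V₁ → I₁ ⊕ V₁} {φ₂ : J₂ ⊕ V₂ → I₂ ⊕ V₂}
    {K : Set ((I₁ ⊕ I₂) ⊕ ((J₁ ⊕ J₂) ⊕ (V₁ ⊕ V₂)))} (h : IsSaturated (joinDiag φ₁ φ₂) K) :
    IsSaturated φ₁ (leftNode ⁻¹' K) := fun x => by
  have := h (Sum.map Sum.inl Sum.inl x)
  rwa [inr_map_inl, joinDiag_left, headNode_map_inl] at this

/-- Saturation of the left part forbids crossing arrows: one direction of the equivalence keeps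
arrows that start on the left on the left, the other direction does the same for those on the right.
-/
lemma exists_eq_joinDiag {φ : (J₁ ⊕ J₂) ⊕ (V₁ ⊕ V₂) → (I₁ ⊕ I₂) ⊕ (V₁ ⊕ V₂)}
    (h : IsSaturated φ (Set.range leftNode)) : ∃ φ₁ φ₂, φ = joinDiag φ₁ φ₂ := by
  have h₁ : ∀ x : J₁ ⊕ V₁, ∃ y : I₁ ⊕ V₁,
      φ (Sum.map Sum.inl Sum.inl x) = Sum.map Sum.inl Sum.inl y := fun x => by
    rcases map_inl_or_map_inr (φ (Sum.map Sum.inl Sum.inl x)) with hy | ⟨y, hy⟩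
    · exact hy
    · have := (h (Sum.map Sum.inl Sum.inl x)).1 ⟨_, (inr_map_inl x).symm⟩
      rw [hy] at this
      exact absurd this (headNode_map_inr_notMem _)
  have h₂ : ∀ x : J₂ ⊕ V₂, ∃ y : I₂ ⊕ V₂,
      φ (Sum.map Sum.inr Sum.inr x) = Sum.map Sum.inr Sum.inr y := fun x => by
    rcases map_inl_or_map_inr (φ (Sum.map Sum.inr Sum.inr x)) with ⟨y, hy⟩ | hy
    · have := (h (Sum.map Sum.inr Sum.inr x)).2
      rw [hy, headNode_map_inl] at this
      exact absurd (this ⟨_, rfl⟩) (inr_map_inr_notMem _)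
    · exact hy
  choose φ₁ hφ₁ using h₁
  choose φ₂ hφ₂ using h₂
  refine ⟨φ₁, φ₂, funext fun x => ?_⟩
  rcases map_inl_or_map_inr x with ⟨y, rfl⟩ | ⟨y, rfl⟩
  · rw [hφ₁, joinDiag_left]
  · rw [hφ₂, joinDiag_right]

/-- The left part is always saturated, so it is the component of any of its nodes exactly if no
smaller saturated set contains that node. -/
lemma isComponent_joinDiag (φ₁ : J₁ ⊕ V₁ → I₁ ⊕ V₁) (φ₂ : J₂ ⊕ V₂ → I₂ ⊕ V₂)
    (w : I₁ ⊕ (J₁ ⊕ V₁)) :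
    IsComponent (joinDiag φ₁ φ₂) (leftNode w) (Set.range leftNode) ↔ IsConn φ₁ := by
  constructor
  · intro h
    have key : ∀ K, IsSaturated φ₁ K → w ∈ K → K = Set.univ := fun K hK hw => by
      have := h.2.2 (leftNode '' K) ((isSaturated_joinDiag_image φ₁ φ₂ K).2 hK) ⟨w, hw, rfl⟩
      refine Set.eq_univ_of_forall fun y => ?_
      exact (leftNode_injective.mem_set_image).1 (this ⟨y, rfl⟩)
    refine ⟨⟨w⟩, fun K hK => ?_⟩
    -- If `w` is not in `K`, the complement of `K` is saturated and contains `w`, so it is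
    -- everything.
    by_cases hw : w ∈ K
    · exact Or.inr (key K hK hw)
    · exact Or.inl (Set.compl_univ_iff.1 (key Kᶜ hK.compl hw))
  · rintro ⟨-, h⟩
    refine ⟨?_, ⟨w, rfl⟩, fun K' hK' hw => ?_⟩
    · rw [← Set.image_univ, isSaturated_joinDiag_image]
      exact fun x => Iff.rfl
    · rcases h _ hK'.preimage_leftNode with h0 | h1
      · exact absurd (show w ∈ leftNode ⁻¹' K' from hw) (by simp [h0])
      · rintro _ ⟨y, rfl⟩
        exact (h1 ▸ Set.mem_univ y : y ∈ leftNode ⁻¹' K')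

end JoinComponents

/-! ### Splitting a sum over diagrams along one component -/

section Decomposition

variable {L S : Type*} [CommRing S] [Fintype L]
variable {I J I' J' : Type*} [Fintype I] [Fintype J] [Fintype I'] [Fintype J']

open Classical in
/-- The sum of the amplitudes of all reduced diagrams with vertex set `V`. -/
def totalSum (P : L → L → S) (g : L → Multiset L → S) (τu : I → L) (τubar : J → L)
    (V : Type*) [Fintype V] : S :=
  ∑ φ : J ⊕ V → I ⊕ V, diagAmp P g τu τubar φ

open Classical in
/-- The sum of the amplitudes of all connected reduced diagrams with vertex set `V`. -/
def connSum (P : L → L → S) (g : L → Multiset L → S) (τu : I → L) (τubar : J → L)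
    (V : Type*) [Fintype V] : S :=
  ∑ φ : J ⊕ V → I ⊕ V with IsConn φ, diagAmp P g τu τubar φ

variable (P : L → L → S) (g : L → Multiset L → S)

lemma totalSum_congr (τu : I' → L) (τubar : J' → L) {V V' : Type*} [Fintype V] [Fintype V']
    (eI : I ≃ I') (eJ : J ≃ J') (eV : V ≃ V') :
    totalSum P g (τu ∘ eI) (τubar ∘ eJ) V = totalSum P g τu τubar V' :=
  Finset.sum_equiv (conjDiag eI eJ eV) (by simp) fun φ _ =>
    (diagAmp_conj P g eI eJ eV τu τubar (conjDiag_apply eI eJ eV φ)).symm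

lemma connSum_congr (τu : I' → L) (τubar : J' → L) {V V' : Type*} [Fintype V] [Fintype V']
    (eI : I ≃ I') (eJ : J ≃ J') (eV : V ≃ V') :
    connSum P g (τu ∘ eI) (τubar ∘ eJ) V = connSum P g τu τubar V' :=
  Finset.sum_equiv (conjDiag eI eJ eV) (by simp [isConn_conjDiag]) fun φ _ =>
    (diagAmp_conj P g eI eJ eV τu τubar (conjDiag_apply eI eJ eV φ)).symm

lemma totalSum_congr_vertices (τu : I → L) (τubar : J → L) {V V' : Type*} {_ : Fintype V}
    {_ : Fintype V'} (eV : V ≃ V') : totalSum P g τu τubar V = totalSum P g τu τubar V' :=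
  totalSum_congr P g τu τubar (Equiv.refl I) (Equiv.refl J) eV

lemma connSum_congr_vertices (τu : I → L) (τubar : J → L) {V V' : Type*} {_ : Fintype V}
    {_ : Fintype V'} (eV : V ≃ V') : connSum P g τu τubar V = connSum P g τu τubar V' :=
  connSum_congr P g τu τubar (Equiv.refl I) (Equiv.refl J) eV

open Classical in
-- Joining is a bijection from pairs (connected diagram, arbitrary diagram) onto the diagrams in
-- which the component of `w` is the left part, and amplitudes multiply.
lemma sum_isComponent_join {I₁ I₂ J₁ J₂ V₁ V₂ : Type*} [Fintype I₁] [Fintype I₂] [Fintype J₁]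
    [Fintype J₂] [Fintype V₁] [Fintype V₂] (τu : I₁ ⊕ I₂ → L) (τubar : J₁ ⊕ J₂ → L)
    (w : I₁ ⊕ (J₁ ⊕ V₁)) :
    ∑ φ : (J₁ ⊕ J₂) ⊕ (V₁ ⊕ V₂) → (I₁ ⊕ I₂) ⊕ (V₁ ⊕ V₂) with
        IsComponent φ (leftNode w) (Set.range leftNode), diagAmp P g τu τubar φ =
      connSum P g (τu ∘ Sum.inl) (τubar ∘ Sum.inl) V₁ *
        totalSum P g (τu ∘ Sum.inr) (τubar ∘ Sum.inr) V₂ := by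
  unfold connSum totalSum
  rw [Finset.sum_mul_sum, ← Finset.sum_product']
  symm
  refine Finset.sum_nbij (fun p => joinDiag p.1 p.2) ?_ joinDiag_injective.injOn ?_ ?_
  · rintro ⟨φ₁, φ₂⟩ hφ
    simpa [isComponent_joinDiag] using hφ
  · intro φ hφ
    simp only [Finset.coe_filter, Finset.mem_univ, true_and, Set.mem_ofPred_eq] at hφ
    obtain ⟨φ₁, φ₂, rfl⟩ := exists_eq_joinDiag hφ.1
    rw [isComponent_joinDiag] at hφ
    exact ⟨(φ₁, φ₂), by simpa using hφ, rfl⟩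
  · rintro ⟨φ₁, φ₂⟩ -
    exact (diagAmp_joinDiag φ₁ φ₂ P g τu τubar).symm

/-- The set of nodes with prescribed parts in `I`, `J` and `V`. -/
def nodeSet {V : Type*} (A : Finset I × Finset J × Finset V) : Set (I ⊕ (J ⊕ V)) :=
  {w | Sum.elim (· ∈ A.1) (Sum.elim (· ∈ A.2.1) (· ∈ A.2.2)) w}

lemma existsUnique_nodeSet {V : Type*} [Fintype V] (K : Set (I ⊕ (J ⊕ V))) :
    ∃! A : Finset I × Finset J × Finset V, nodeSet A = K := by
  classical
  refine ⟨⟨Finset.univ.filter fun i => Sum.inl i ∈ K,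
    Finset.univ.filter fun j => Sum.inr (Sum.inl j) ∈ K,
    Finset.univ.filter fun v => Sum.inr (Sum.inr v) ∈ K⟩, ?_, ?_⟩
  · ext (i | j | v) <;> simp [nodeSet]
  · rintro ⟨A, B, C⟩ rfl
    ext <;> exact ⟨fun h => Finset.mem_filter.2 ⟨Finset.mem_univ _, h⟩,
      fun h => (Finset.mem_filter.1 h).2⟩

open Classical in
/-- Splitting off the connected component of an external half-line. -/
lemma totalSum_eq_sum (τu : I → L) (τubar : J → L) {V : Type*} [Fintype V] (w : I ⊕ J) :
    totalSum P g τu τubar V =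
      ∑ A : Finset I × Finset J × Finset V with Sum.elim (· ∈ A.1) (· ∈ A.2.1) w,
        connSum P g (fun i : A.1 => τu i) (fun j : A.2.1 => τubar j) A.2.2 *
          totalSum P g (fun i : {i // i ∉ A.1} => τu i) (fun j : {j // j ∉ A.2.1} => τubar j)
            {v // v ∉ A.2.2} := by
  set w' : I ⊕ (J ⊕ V) := Sum.map id Sum.inl w with hw'
  have hmem : ∀ A : Finset I × Finset J × Finset V,
      w' ∈ nodeSet A ↔ Sum.elim (· ∈ A.1) (· ∈ A.2.1) w := by
    rintro ⟨A, B, C⟩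
    rcases w with i | j <;> simp [hw', nodeSet]
  -- Each `φ` has exactly one component of `w'`, hence is counted for exactly one triple `A`.
  have h1 : totalSum P g τu τubar V = ∑ A : Finset I × Finset J × Finset V,
      ∑ φ : J ⊕ V → I ⊕ V with IsComponent φ w' (nodeSet A), diagAmp P g τu τubar φ := by
    simp only [Finset.sum_filter]
    rw [Finset.sum_comm]
    refine Finset.sum_congr rfl fun φ _ => ?_
    obtain ⟨K, hK, hKu⟩ := existsUnique_isComponent φ w'
    obtain ⟨A, rfl, hAu⟩ := existsUnique_nodeSet K
    rw [Finset.sum_eq_single A, if_pos hK]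
    · intro B _ hB
      exact if_neg fun h => hB (hAu B (hKu _ h))
    · simp
  -- A component of `w'` contains `w'`, so triples that miss `w` contribute nothing.
  rw [h1, ← Finset.sum_filter_of_ne
    (p := fun A : Finset I × Finset J × Finset V => Sum.elim (· ∈ A.1) (· ∈ A.2.1) w)]
  swap
  · intro A _ hA
    obtain ⟨φ, hφ, -⟩ := Finset.exists_ne_zero_of_sum_ne_zero hA
    exact (hmem A).1 (Finset.mem_filter.1 hφ).2.2.1
  refine Finset.sum_congr rfl fun A hA => ?_
  have hA := (hmem A).2 (Finset.mem_filter.1 hA).2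
  obtain ⟨A, B, C⟩ := A
  -- Once `I`, `J`, `V` are identified with subset plus complement, the prescribed component is the
  -- left part of a disjoint union.
  set eI := Equiv.sumCompl (· ∈ A)
  set eJ := Equiv.sumCompl (· ∈ B)
  set eV := Equiv.sumCompl (· ∈ C)
  have hpre : nodeEquiv eI eJ eV ⁻¹' nodeSet (A, B, C) = Set.range leftNode := by
    ext x
    constructor
    · rcases x with (⟨i, hi⟩ | ⟨i, hi⟩) | (⟨j, hj⟩ | ⟨j, hj⟩) | (⟨v, hv⟩ | ⟨v, hv⟩)
      · exact fun _ => ⟨Sum.inl ⟨i, hi⟩, rfl⟩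
      · exact fun h => absurd h hi
      · exact fun _ => ⟨Sum.inr (Sum.inl ⟨j, hj⟩), rfl⟩
      · exact fun h => absurd h hj
      · exact fun _ => ⟨Sum.inr (Sum.inr ⟨v, hv⟩), rfl⟩
      · exact fun h => absurd h hv
    · rintro ⟨⟨i, hi⟩ | ⟨j, hj⟩ | ⟨v, hv⟩, rfl⟩
      · exact hi
      · exact hj
      · exact hv
  obtain ⟨y, hy⟩ : (nodeEquiv eI eJ eV).symm w' ∈ Set.range leftNode := by
    rw [← hpre]
    simpa using hA
  have hy' : w' = nodeEquiv eI eJ eV (leftNode y) := by rw [hy]; simp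
  refine Eq.trans ?_ (sum_isComponent_join P g (τu ∘ eI) (τubar ∘ eJ) y)
  symm
  refine Finset.sum_equiv (conjDiag eI eJ eV) (fun φ => ?_) fun φ _ =>
    (diagAmp_conj P g eI eJ eV τu τubar (conjDiag_apply eI eJ eV φ)).symm
  simp only [Finset.mem_filter, Finset.mem_univ, true_and]
  rw [hy', isComponent_conjDiag, hpre]

end Decomposition

end

end FeynmanCluster

namespace FeynmanCluster

noncomputable section

/-! ### Sums over set partitions -/

section Partitions

variable {X : Type*}

/-- `π` is a set partition of the finite set `s`. -/
def IsPartitionOf (s : Finset X) (π : Finset (Finset X)) : Prop :=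
  (∀ B ∈ π, B.Nonempty) ∧ (∀ B ∈ π, ∀ B' ∈ π, B ≠ B' → Disjoint B B') ∧
    (∀ x ∈ s, ∃ B ∈ π, x ∈ B) ∧ ∀ B ∈ π, B ⊆ s

variable [Fintype X] [DecidableEq X] {M : Type*} [CommRing M]

open Classical in
/-- Sorting the partitions of `s` by the block that contains `x`. -/
lemma sum_isPartitionOf (c : Finset X → M) {s : Finset X} {x : X} (hx : x ∈ s) :
    ∑ π : Finset (Finset X) with IsPartitionOf s π, ∏ B ∈ π, c B =
      ∑ B ∈ s.powerset with x ∈ B,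
        c B * ∑ π : Finset (Finset X) with IsPartitionOf (s \ B) π, ∏ B' ∈ π, c B' := by
  have hnot : ∀ {B : Finset X} {π : Finset (Finset X)}, x ∈ B → IsPartitionOf (s \ B) π →
      ∀ B' ∈ π, x ∉ B' := fun hB h B' hB' hx' => (Finset.mem_sdiff.1 (h.2.2.2 B' hB' hx')).2 hB
  simp only [Finset.mul_sum]
  rw [Finset.sum_sigma']
  symm
  -- A partition of `s` is the block of `x` together with a partition of the rest; the block is
  -- recovered as the only one that contains `x`.
  refine Finset.sum_nbij (fun p => insert p.1 p.2) ?_ ?_ ?_ ?_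
  · rintro ⟨B, π⟩ h
    simp only [Finset.mem_sigma, Finset.mem_filter, Finset.mem_powerset, Finset.mem_univ,
      true_and] at h ⊢
    obtain ⟨⟨hBs, hxB⟩, h1, h2, h3, h4⟩ := h
    have hd : ∀ B' ∈ π, Disjoint B B' := fun B' hB' =>
      Finset.disjoint_of_subset_right (h4 B' hB') Finset.disjoint_sdiff
    refine ⟨?_, ?_, ?_, ?_⟩
    · simp only [Finset.forall_mem_insert]
      exact ⟨⟨x, hxB⟩, h1⟩
    · simp only [Finset.forall_mem_insert]
      exact ⟨⟨fun h => absurd rfl h, fun B' hB' _ => hd B' hB'⟩, fun B' hB' =>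
        ⟨fun _ => (hd B' hB').symm, h2 B' hB'⟩⟩
    · intro y hy
      by_cases hyB : y ∈ B
      · exact ⟨B, Finset.mem_insert_self _ _, hyB⟩
      · obtain ⟨B', hB', hyB'⟩ := h3 y (Finset.mem_sdiff.2 ⟨hy, hyB⟩)
        exact ⟨B', Finset.mem_insert_of_mem hB', hyB'⟩
    · simp only [Finset.forall_mem_insert]
      exact ⟨hBs, fun B' hB' => (h4 B' hB').trans Finset.sdiff_subset⟩
  · rintro ⟨B, π⟩ h ⟨B₂, π₂⟩ h₂ heq
    simp only [Finset.coe_sigma, Set.mem_sigma_iff, Finset.mem_coe, Finset.mem_filter,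
      Finset.mem_powerset, Finset.mem_univ, true_and] at h h₂ heq
    have hB : B₂ = B := by
      have := heq ▸ Finset.mem_insert_self B₂ π₂
      rcases Finset.mem_insert.1 this with h' | h'
      · exact h'
      · exact absurd h₂.1.2 (hnot h.1.2 h.2 _ h')
    subst hB
    have h1 : B₂ ∉ π := fun h' => hnot h.1.2 h.2 _ h' h.1.2
    have h2 : B₂ ∉ π₂ := fun h' => hnot h₂.1.2 h₂.2 _ h' h.1.2
    rw [← Finset.erase_insert h1, heq, Finset.erase_insert h2]
  · intro π h
    simp only [Finset.coe_filter, Finset.mem_univ, true_and, Set.mem_ofPred_eq] at h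
    obtain ⟨h1, h2, h3, h4⟩ := h
    obtain ⟨B, hB, hxB⟩ := h3 x hx
    refine ⟨⟨B, π.erase B⟩, ?_, Finset.insert_erase hB⟩
    simp only [Finset.coe_sigma, Set.mem_sigma_iff, Finset.mem_coe, Finset.mem_filter,
      Finset.mem_powerset, Finset.mem_univ, true_and]
    refine ⟨⟨h4 B hB, hxB⟩, fun B' h' => h1 B' (Finset.mem_of_mem_erase h'),
      fun B' h' B'' h'' => h2 B' (Finset.mem_of_mem_erase h') B'' (Finset.mem_of_mem_erase h''),
      fun y hy => ?_, fun B' h' => ?_⟩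
    · obtain ⟨B', hB', hyB'⟩ := h3 y (Finset.mem_sdiff.1 hy).1
      refine ⟨B', Finset.mem_erase.2 ⟨?_, hB'⟩, hyB'⟩
      rintro rfl
      exact (Finset.mem_sdiff.1 hy).2 hyB'
    · refine Finset.subset_sdiff.2 ⟨h4 B' (Finset.mem_of_mem_erase h'), ?_⟩
      exact h2 B' (Finset.mem_of_mem_erase h') B hB (Finset.ne_of_mem_erase h')
  · rintro ⟨B, π⟩ h
    simp only [Finset.mem_sigma, Finset.mem_filter, Finset.mem_univ, true_and] at h
    rw [Finset.prod_insert fun h' => hnot h.1.2 h.2 _ h' h.1.2]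

open Classical in
/-- A function of finite sets that satisfies the recursion of splitting off a block is given by a
sum over set partitions. -/
lemma eq_mul_sum_isPartitionOf (w c : Finset X → M)
    (h : ∀ s : Finset X, ∀ x ∈ s, w s = ∑ B ∈ s.powerset with x ∈ B, c B * w (s \ B))
    (s : Finset X) :
    w s = w ∅ * ∑ π : Finset (Finset X) with IsPartitionOf s π, ∏ B ∈ π, c B := by
  induction s using Finset.strongInduction with
  | H s ih =>
    rcases s.eq_empty_or_nonempty with rfl | ⟨x, hx⟩
    · have : (Finset.univ.filter fun π : Finset (Finset X) => IsPartitionOf ∅ π) = {∅} := by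
        ext π
        simp only [Finset.mem_filter, Finset.mem_univ, true_and, Finset.mem_singleton]
        constructor
        · rintro ⟨h1, -, -, h4⟩
          refine Finset.eq_empty_of_forall_notMem fun B hB => ?_
          exact (h1 B hB).ne_empty (Finset.subset_empty.1 (h4 B hB))
        · rintro rfl
          simp [IsPartitionOf]
      simp [this]
    · rw [h s x hx, sum_isPartitionOf c hx, Finset.mul_sum]
      refine Finset.sum_congr rfl fun B hB => ?_
      obtain ⟨hBs, hxB⟩ := Finset.mem_filter.1 hB
      -- Since `x ∈ B`, the set `s \ B` is strictly smaller than `s`.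
      rw [ih (s \ B) (Finset.sdiff_ssubset (Finset.mem_powerset.1 hBs) ⟨x, hxB⟩)]
      ring

end Partitions

/-! ### Pairs of subsets as subsets of the disjoint union -/

section PairPartitions

variable {I J : Type*} [Fintype I] [Fintype J] {M : Type*} [CommRing M]

open Classical in
-- A pair of subsets of `I` and `J` is a subset of `I ⊕ J`, nonempty if and only if the components
-- are not both empty. This reduces the statement to ordinary set partitions.
lemma sum_isPairPartition (c : Finset I × Finset J → M) :
    ∑ π : Finset (Finset I × Finset J) with IsPairPartition π, ∏ p ∈ π, c p =
      ∑ π : Finset (Finset (I ⊕ J)) with IsPartitionOf Finset.univ π,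
        ∏ B ∈ π, c (Finset.sumEquiv B) := by
  have hmem : ∀ (p : Finset I × Finset J) (x : I ⊕ J),
      x ∈ Finset.sumEquiv.symm p ↔ Sum.elim (· ∈ p.1) (· ∈ p.2) x := by
    rintro p (i | j) <;> simp
  refine Finset.sum_equiv (Equiv.finsetCongr Finset.sumEquiv.symm.toEquiv) (fun π => ?_)
    fun π _ => ?_
  · rw [Finset.mem_filter, Finset.mem_filter]
    have hall : ∀ p : Finset (I ⊕ J) → Prop,
        (∀ B ∈ Equiv.finsetCongr Finset.sumEquiv.symm.toEquiv π, p B) ↔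
          ∀ q ∈ π, p (Finset.sumEquiv.symm q) := fun p => by
      rw [Equiv.finsetCongr_apply]
      exact Finset.forall_mem_map
    refine and_congr (by simp) (and_congr ?_ (and_congr ?_ ?_))
    · rw [hall]
      refine forall₂_congr fun p _ => ?_
      simp only [Finset.Nonempty, hmem, Sum.exists, Sum.elim_inl, Sum.elim_inr]
    · rw [hall]
      refine forall₂_congr fun p _ => ?_
      rw [hall]
      refine forall₂_congr fun q _ => ?_
      simp only [Finset.disjoint_left, hmem, Sum.forall, Sum.elim_inl, Sum.elim_inr, ne_eq,
        EmbeddingLike.apply_eq_iff_eq]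
    · have hex : ∀ x : I ⊕ J, (∃ B ∈ Equiv.finsetCongr Finset.sumEquiv.symm.toEquiv π, x ∈ B) ↔
          ∃ p ∈ π, Sum.elim (· ∈ p.1) (· ∈ p.2) x := fun x => by
        simp only [Equiv.finsetCongr_apply, Finset.mem_map, exists_exists_and_eq_and]
        exact exists_congr fun p => and_congr_right fun _ => hmem p x
      simp only [hex, Finset.mem_univ, forall_const, Finset.subset_univ, implies_true, and_true,
        Sum.forall, Sum.elim_inl, Sum.elim_inr]
  · rw [Equiv.finsetCongr_apply, Finset.prod_map]
    refine Finset.prod_congr rfl fun p _ => ?_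
    exact congrArg c (Finset.sumEquiv.apply_symm_apply p).symm

end PairPartitions

end

end FeynmanCluster

namespace FeynmanCluster

noncomputable section

/-! ### Degree bounds on the number of vertices -/

open MvPowerSeries in
/-- A lower bound for the degrees of the monomials of a product. -/
lemma card_mul_le_of_coeff_prod_ne_zero {σ R ι : Type*} [CommRing R] [Fintype ι] {c : ℕ}
    {f : ι → MvPowerSeries σ R} {k : ι → ℕ}
    (h : ∀ i d, coeff d (f i) ≠ 0 → c ≤ 2 * d.degree + k i) {d : σ →₀ ℕ}
    (hd : coeff d (∏ i, f i) ≠ 0) : c * Fintype.card ι ≤ 2 * d.degree + ∑ i, k i := by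
  classical
  rw [coeff_prod] at hd
  -- A nonzero coefficient of the product comes from a splitting of `d` with a nonzero coefficient
  -- in every factor.
  obtain ⟨l, hl, hne⟩ := Finset.exists_ne_zero_of_sum_ne_zero hd
  have hl' := (Finset.mem_finsuppAntidiag.1 hl).1
  have h1 : ∀ i, c ≤ 2 * (l i).degree + k i := fun i => h i _ fun h0 =>
    hne (Finset.prod_eq_zero (Finset.mem_univ i) h0)
  calc c * Fintype.card ι = ∑ _i : ι, c := by simp [mul_comm]
    _ ≤ ∑ i, (2 * (l i).degree + k i) := Finset.sum_le_sum fun i _ => h1 i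
    _ = 2 * d.degree + ∑ i, k i := by
      rw [Finset.sum_add_distrib, ← Finset.mul_sum, ← hl', map_sum]

lemma coeff_rat_smul {σ R : Type*} [CommRing R] [Algebra ℚ R] (q : ℚ) (f : MvPowerSeries σ R)
    (d : σ →₀ ℕ) : MvPowerSeries.coeff d (q • f) = q • MvPowerSeries.coeff d f := rfl

section VertexFactor

variable {R : Type*} [CommRing R] {n : ℕ} (F : Fin n → MvPowerSeries (Fin n) R)

/-- The factor of an interaction vertex with label `a` at its `ū`-half-line and labels `s` at its
`u`-half-lines. -/
def vertexFactor (a : Fin n) (s : Multiset (Fin n)) : MvPowerSeries (Fin n) R :=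
  MvPowerSeries.C (tensorCoeff (nonlinPart F a) s) + if s = 0 then MvPowerSeries.X a else 0

/-- The propagator `A⁻¹`. -/
def propagator (b a : Fin n) : MvPowerSeries (Fin n) R :=
  MvPowerSeries.C ((linMatrix F)⁻¹ b a)

lemma degree_toFinsupp (s : Multiset (Fin n)) : (Multiset.toFinsupp s).degree = s.card := by
  rw [Finsupp.degree_apply, ← Multiset.toFinsupp_sum_eq]
  rfl

lemma tensorCoeff_nonlinPart_eq_zero (a : Fin n) {s : Multiset (Fin n)} (hs : s.card < 2) :
    tensorCoeff (nonlinPart F a) s = 0 := by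
  have : MvPowerSeries.coeff (Multiset.toFinsupp s) (nonlinPart F a) = 0 := by
    rw [MvPowerSeries.coeff_apply, nonlinPart, degree_toFinsupp, if_neg (by omega)]
  rw [tensorCoeff, this, mul_zero]

lemma vertexFactor_zero (a : Fin n) : vertexFactor F a 0 = MvPowerSeries.X a := by
  simp [vertexFactor, tensorCoeff_nonlinPart_eq_zero F a (s := 0) (by simp)]

lemma vertexFactor_of_ne_zero (a : Fin n) {s : Multiset (Fin n)} (hs : s ≠ 0) :
    vertexFactor F a s = MvPowerSeries.C (tensorCoeff (nonlinPart F a) s) := by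
  simp [vertexFactor, hs]

/-- There are no vertices with a single `u`-half-line because `H` has no linear term. This is why
all maps `φ` may be admitted in the state sums. -/
lemma vertexFactor_eq_zero (a : Fin n) {s : Multiset (Fin n)} (hs : s.card = 1) :
    vertexFactor F a s = 0 := by
  rw [vertexFactor_of_ne_zero, tensorCoeff_nonlinPart_eq_zero, map_zero]
  · omega
  · rintro rfl
    simp at hs

/-- A `Y`-vertex contributes degree one in `Y`, which counts twice; an `H`-vertex has at least two
`u`-half-lines. -/
lemma two_le_of_coeff_vertexFactor_ne_zero {a : Fin n} {s : Multiset (Fin n)} {d : Fin n →₀ ℕ}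
    (h : MvPowerSeries.coeff d (vertexFactor F a s) ≠ 0) : 2 ≤ 2 * d.degree + s.card := by
  classical
  rcases Nat.lt_or_ge s.card 2 with hs | hs
  · by_cases h1 : s.card = 1
    · simp [vertexFactor_eq_zero F a h1] at h
    · obtain rfl : s = 0 := Multiset.card_eq_zero.1 (by omega)
      rw [vertexFactor_zero, MvPowerSeries.coeff_X] at h
      have : d = Finsupp.single a 1 := by
        by_contra h'
        exact h (if_neg h')
      subst this
      simp
  · omega

variable {I J V : Type*} [Fintype I] [Fintype J] [Fintype V]

lemma sum_card_fiberLabels {X T L : Type*} [Fintype X] [Fintype T] (φ : X → T) (b : X → L) :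
    ∑ t, (fiberLabels φ b t).card = Fintype.card X := by
  classical
  simp only [fiberLabels, Multiset.card_map]
  exact (Finset.card_eq_sum_card_fiberwise (f := φ) (s := Finset.univ) (t := Finset.univ)
    (by simp)).symm

lemma fiberLabels_eq_of_stateWeight_ne_zero {L S : Type*} [CommRing S] {P : L → L → S}
    {g : L → Multiset L → S} {τu : I → L} {τubar : J → L} {φ : J ⊕ V → I ⊕ V} {a : V → L}
    {b : J ⊕ V → L} (h : stateWeight P g τu τubar φ a b ≠ 0) (i : I) :
    fiberLabels φ b (Sum.inl i) = {τu i} := by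
  by_contra hi
  refine h ?_
  have : (∏ i, rootFactor S (τu i) (fiberLabels φ b (Sum.inl i))) = 0 :=
    Finset.prod_eq_zero (Finset.mem_univ i) (if_neg hi)
  rw [stateWeight, this, mul_zero, zero_mul]

/-- Summing the bound for single vertices gives `2 #V ≤ 2 deg d + (sum of the arities)`. The
`u`-half-lines of the vertices are at most as many as the `ū`-half-lines, whose number is `#J + #V`.
-/
lemma card_le_of_coeff_stateWeight_ne_zero {τu : I → Fin n} {τubar : J → Fin n}
    {φ : J ⊕ V → I ⊕ V} {a : V → Fin n} {b : J ⊕ V → Fin n} {d : Fin n →₀ ℕ}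
    (h : MvPowerSeries.coeff d
      (stateWeight (propagator F) (vertexFactor F) τu τubar φ a b) ≠ 0) :
    Fintype.card V ≤ 2 * d.degree + Fintype.card J := by
  have hr := fiberLabels_eq_of_stateWeight_ne_zero (V := V) fun h0 => h (by rw [h0, map_zero])
  have hw : stateWeight (propagator F) (vertexFactor F) τu τubar φ a b =
      MvPowerSeries.C (∏ x, (linMatrix F)⁻¹ (b x) (Sum.elim τubar a x)) *
        ∏ v, vertexFactor F (a v) (fiberLabels φ b (Sum.inr v)) := by
    simp [stateWeight, propagator, rootFactor, hr]
  rw [hw, MvPowerSeries.coeff_C_mul] at h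
  have h1 := card_mul_le_of_coeff_prod_ne_zero
    (fun v d => two_le_of_coeff_vertexFactor_ne_zero F) (right_ne_zero_of_mul h)
  have h2 := sum_card_fiberLabels φ b
  rw [Fintype.sum_sum_type, Fintype.card_sum] at h2
  omega

lemma coeff_diagAmp_eq_zero (τu : I → Fin n) (τubar : J → Fin n) (φ : J ⊕ V → I ⊕ V)
    {d : Fin n →₀ ℕ} (h : 2 * d.degree + Fintype.card J < Fintype.card V) :
    MvPowerSeries.coeff d (diagAmp (propagator F) (vertexFactor F) τu τubar φ) = 0 := by
  rw [diagAmp, map_sum]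
  refine Finset.sum_eq_zero fun a _ => ?_
  rw [map_sum]
  refine Finset.sum_eq_zero fun b _ => ?_
  by_contra h0
  have := card_le_of_coeff_stateWeight_ne_zero F h0
  omega

lemma coeff_totalSum_eq_zero (τu : I → Fin n) (τubar : J → Fin n)
    {d : Fin n →₀ ℕ} (h : 2 * d.degree + Fintype.card J < Fintype.card V) :
    MvPowerSeries.coeff d (totalSum (propagator F) (vertexFactor F) τu τubar V) = 0 := by
  rw [totalSum, map_sum]
  exact Finset.sum_eq_zero fun φ _ => coeff_diagAmp_eq_zero F τu τubar φ h

lemma coeff_connSum_eq_zero (τu : I → Fin n) (τubar : J → Fin n)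
    {d : Fin n →₀ ℕ} (h : 2 * d.degree + Fintype.card J < Fintype.card V) :
    MvPowerSeries.coeff d (connSum (propagator F) (vertexFactor F) τu τubar V) = 0 := by
  rw [connSum, map_sum]
  exact Finset.sum_eq_zero fun φ _ => coeff_diagAmp_eq_zero F τu τubar φ h

end VertexFactor

/-! ### Generating series

The number of vertices is recorded by a polynomial variable. -/

section GeneratingSeries

variable {R : Type*} [CommRing R] {n : ℕ}

/-- The series `∑ N, f N * t ^ N` whose coefficients are polynomials in `t`. It is meaningful if the
coefficient of `f N` at `d` vanishes for `2 * d.degree + b < N`. -/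
def genSeries (b : ℕ) (f : ℕ → MvPowerSeries (Fin n) R) :
    MvPowerSeries (Fin n) (Polynomial R) :=
  fun d => ∑ N ∈ Finset.range (2 * d.degree + b + 1),
    Polynomial.monomial N (MvPowerSeries.coeff d (f N))

lemma coeff_coeff_genSeries {b : ℕ} {f : ℕ → MvPowerSeries (Fin n) R}
    (hf : ∀ N d, 2 * d.degree + b < N → MvPowerSeries.coeff d (f N) = 0) (d : Fin n →₀ ℕ)
    (N : ℕ) :
    (MvPowerSeries.coeff d (genSeries b f)).coeff N = MvPowerSeries.coeff d (f N) := by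
  rw [MvPowerSeries.coeff_apply, genSeries, Polynomial.finsetSum_coeff]
  simp only [Polynomial.coeff_monomial]
  rw [Finset.sum_ite_eq']
  split_ifs with h
  · rfl
  · rw [hf]
    simpa using h

/-- Evaluation at `t = 1`. -/
def evalOne (R : Type*) [CommRing R] (n : ℕ) :
    MvPowerSeries (Fin n) (Polynomial R) →+* MvPowerSeries (Fin n) R :=
  MvPowerSeries.map (Polynomial.evalRingHom 1)

lemma coeff_evalOne_genSeries (b : ℕ) (f : ℕ → MvPowerSeries (Fin n) R) (d : Fin n →₀ ℕ) :
    MvPowerSeries.coeff d (evalOne R n (genSeries b f)) =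
      ∑ N ∈ Finset.range (2 * d.degree + b + 1), MvPowerSeries.coeff d (f N) := by
  rw [evalOne, MvPowerSeries.coeff_map, MvPowerSeries.coeff_apply, genSeries, map_sum]
  simp

/-- Reduces products of generating series to convolutions in the number of vertices. -/
lemma coeff_coeff_mul {x y : MvPowerSeries (Fin n) (Polynomial R)}
    {f g : ℕ → MvPowerSeries (Fin n) R}
    (hx : ∀ d N, (MvPowerSeries.coeff d x).coeff N = MvPowerSeries.coeff d (f N))
    (hy : ∀ d N, (MvPowerSeries.coeff d y).coeff N = MvPowerSeries.coeff d (g N))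
    (d : Fin n →₀ ℕ) (N : ℕ) :
    (MvPowerSeries.coeff d (x * y)).coeff N =
      MvPowerSeries.coeff d (∑ p ∈ Finset.HasAntidiagonal.antidiagonal N, f p.1 * g p.2) := by
  classical
  rw [MvPowerSeries.coeff_mul, Polynomial.finsetSum_coeff, map_sum]
  simp only [Polynomial.coeff_mul, MvPowerSeries.coeff_mul, hx, hy]
  exact Finset.sum_comm

end GeneratingSeries

/-! ### The cluster recursion for generating series -/

section ClusterRecursion

variable {R : Type*} [CommRing R] [Algebra ℚ R] {n : ℕ} (F : Fin n → MvPowerSeries (Fin n) R)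
variable {I J : Type*} [Fintype I] [Fintype J]

/-- The generating series of all diagrams of type `(I, J)`. -/
def totalSeries (τu : I → Fin n) (τubar : J → Fin n) : MvPowerSeries (Fin n) (Polynomial R) :=
  genSeries (Fintype.card J) fun N =>
    ((N.factorial : ℚ)⁻¹) • totalSum (propagator F) (vertexFactor F) τu τubar (Fin N)

/-- The generating series of the connected diagrams of type `(I, J)`. -/
def connSeries (τu : I → Fin n) (τubar : J → Fin n) : MvPowerSeries (Fin n) (Polynomial R) :=
  genSeries (Fintype.card J) fun N =>
    ((N.factorial : ℚ)⁻¹) • connSum (propagator F) (vertexFactor F) τu τubar (Fin N)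

lemma coeff_coeff_totalSeries (τu : I → Fin n) (τubar : J → Fin n) (d : Fin n →₀ ℕ) (N : ℕ) :
    (MvPowerSeries.coeff d (totalSeries F τu τubar)).coeff N = MvPowerSeries.coeff d
      (((N.factorial : ℚ)⁻¹) • totalSum (propagator F) (vertexFactor F) τu τubar (Fin N)) :=
  coeff_coeff_genSeries (fun N d h => by
    rw [coeff_rat_smul, coeff_totalSum_eq_zero F τu τubar (by simpa using h),
      smul_zero]) d N

lemma coeff_coeff_connSeries (τu : I → Fin n) (τubar : J → Fin n) (d : Fin n →₀ ℕ) (N : ℕ) :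
    (MvPowerSeries.coeff d (connSeries F τu τubar)).coeff N = MvPowerSeries.coeff d
      (((N.factorial : ℚ)⁻¹) • connSum (propagator F) (vertexFactor F) τu τubar (Fin N)) :=
  coeff_coeff_genSeries (fun N d h => by
    rw [coeff_rat_smul, coeff_connSum_eq_zero F τu τubar (by simpa using h),
      smul_zero]) d N

lemma totalSeries_congr {I J I' J' : Type*} {_ : Fintype I} {_ : Fintype J} {_ : Fintype I'}
    {_ : Fintype J'} (eI : I ≃ I') (eJ : J ≃ J') (τu : I' → Fin n) (τubar : J' → Fin n) :
    totalSeries F (τu ∘ eI) (τubar ∘ eJ) = totalSeries F τu τubar := by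
  simp only [totalSeries, totalSum_congr _ _ τu τubar eI eJ (Equiv.refl _), Fintype.card_congr eJ]

lemma connSeries_congr {I J I' J' : Type*} {_ : Fintype I} {_ : Fintype J} {_ : Fintype I'}
    {_ : Fintype J'} (eI : I ≃ I') (eJ : J ≃ J') (τu : I' → Fin n) (τubar : J' → Fin n) :
    connSeries F (τu ∘ eI) (τubar ∘ eJ) = connSeries F τu τubar := by
  simp only [connSeries, connSum_congr _ _ τu τubar eI eJ (Equiv.refl _), Fintype.card_congr eJ]

/-- There are `N.choose m` subsets of size `m`, and `N.choose m / N! = 1 / (m! (N - m)!)`. This is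
the product rule of exponential generating functions. -/
lemma inv_factorial_smul_sum_powerset {M : Type*} [CommRing M] [Algebra ℚ M] (N : ℕ)
    (f g : ℕ → M) :
    ((N.factorial : ℚ)⁻¹) • ∑ U : Finset (Fin N), f U.card * g (N - U.card) =
      ∑ p ∈ Finset.HasAntidiagonal.antidiagonal N,
        (((p.1.factorial : ℚ)⁻¹) • f p.1) * (((p.2.factorial : ℚ)⁻¹) • g p.2) := by
  have h1 := Finset.sum_powerset_apply_card (fun m => f m * g (N - m))
    (x := (Finset.univ : Finset (Fin N)))
  rw [Finset.powerset_univ, Finset.card_univ, Fintype.card_fin] at h1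
  rw [h1, Finset.Nat.sum_antidiagonal_eq_sum_range_succ_mk, Finset.smul_sum]
  refine Finset.sum_congr rfl fun m hm => ?_
  have hm' : m ≤ N := Nat.lt_succ_iff.1 (Finset.mem_range.1 hm)
  rw [smul_mul_smul_comm, ← Nat.cast_smul_eq_nsmul ℚ, smul_smul]
  congr 1
  rw [Nat.cast_choose ℚ hm']
  have h0 : (N.factorial : ℚ) ≠ 0 := by positivity
  field_simp

open Classical in
-- The coefficient of the `N`-th power of the vertex variable is the splitting of `totalSum`, in
-- which the choice of the vertex subset has been absorbed into a product of exponential generating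
-- functions.
lemma totalSeries_eq_sum (τu : I → Fin n) (τubar : J → Fin n) (w : I ⊕ J) :
    totalSeries F τu τubar =
      ∑ A : Finset I × Finset J with Sum.elim (· ∈ A.1) (· ∈ A.2) w,
        connSeries F (fun i : A.1 => τu i) (fun j : A.2 => τubar j) *
          totalSeries F (fun i : {i // i ∉ A.1} => τu i) (fun j : {j // j ∉ A.2} => τubar j) := by
  ext d N
  rw [coeff_coeff_totalSeries, map_sum, Polynomial.finsetSum_coeff]
  simp only [coeff_coeff_mul (coeff_coeff_connSeries F _ _) (coeff_coeff_totalSeries F _ _)]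
  rw [← map_sum]
  congr 1
  rw [totalSum_eq_sum _ _ _ _ w]
  refine Eq.trans ?_ (Finset.sum_congr rfl fun A _ => inv_factorial_smul_sum_powerset N
    (fun m => connSum (propagator F) (vertexFactor F) (fun i : A.1 => τu i)
      (fun j : A.2 => τubar j) (Fin m))
    (fun m => totalSum (propagator F) (vertexFactor F) (fun i : {i // i ∉ A.1} => τu i)
      (fun j : {j // j ∉ A.2} => τubar j) (Fin m)))
  rw [← Finset.smul_sum]
  congr 1
  rw [Finset.sum_filter, Finset.sum_filter, ← Equiv.sum_comp (Equiv.prodAssoc _ _ _),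
    Fintype.sum_prod_type]
  refine Finset.sum_congr rfl fun A _ => ?_
  simp only [Equiv.prodAssoc_apply]
  split_ifs
  · refine Finset.sum_congr rfl fun U _ => ?_
    -- Both factors depend on the vertex subset `U` only through its size.
    have e1 : U ≃ Fin U.card := U.equivFin
    have e2 : {v // v ∉ U} ≃ Fin (N - U.card) := Fintype.equivFinOfCardEq (by simp)
    exact congrArg₂ (· * ·) (connSum_congr_vertices _ _ _ _ e1)
      (totalSum_congr_vertices _ _ _ _ e2)
  · simp

/-- A subset `A` of `S` as a subset of the ambient type. -/
def mapSubtypeEquiv {X : Type*} {S : Finset X} (A : Finset S) :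
    A ≃ (A.map (.subtype _) : Finset X) where
  toFun i := ⟨i.1, Finset.mem_map_of_mem (.subtype _) i.2⟩
  invFun i := ⟨⟨i.1, Finset.map_subtype_subset A i.2⟩, by
    obtain ⟨j, hj, h⟩ := Finset.mem_map.1 i.2
    rwa [← show j = ⟨i.1, Finset.map_subtype_subset A i.2⟩ from Subtype.ext h]⟩
  left_inv _ := rfl
  right_inv _ := rfl

open Classical in
/-- The complement of a subset `A` of `S` inside `S`. -/
def complSubtypeEquiv {X : Type*} {S : Finset X} (A : Finset S) :
    {i // i ∉ A} ≃ (S \ A.map (.subtype _) : Finset X) where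
  toFun i := ⟨i.1, by simp [i.2]⟩
  invFun i := ⟨⟨i.1, (Finset.mem_sdiff.1 i.2).1⟩, fun h =>
    (Finset.mem_sdiff.1 i.2).2 (Finset.mem_map_of_mem (.subtype _) h)⟩
  left_inv _ := rfl
  right_inv _ := rfl

open Classical in
/-- The cluster expansion of generating series. -/
lemma totalSeries_eq_mul_sum (τu : I → Fin n) (τubar : J → Fin n) :
    totalSeries F τu τubar =
      totalSeries F (fun i : (∅ : Finset I) => τu i) (fun j : (∅ : Finset J) => τubar j) *
        ∑ π : Finset (Finset I × Finset J) with IsPairPartition π,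
          ∏ p ∈ π, connSeries F (fun i : p.1 => τu i) (fun j : p.2 => τubar j) := by
  set W : Finset I × Finset J → MvPowerSeries (Fin n) (Polynomial R) := fun p =>
    totalSeries F (fun i : p.1 => τu i) (fun j : p.2 => τubar j) with hW
  set C : Finset I × Finset J → MvPowerSeries (Fin n) (Polynomial R) := fun p =>
    connSeries F (fun i : p.1 => τu i) (fun j : p.2 => τubar j) with hC
  have h0 : totalSeries F τu τubar = W (Finset.univ, Finset.univ) :=
    (totalSeries_congr F (Equiv.subtypeUnivEquiv (by simp)) (Equiv.subtypeUnivEquiv (by simp))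
      τu τubar).symm
  have hu : (Finset.univ, Finset.univ) = Finset.sumEquiv (Finset.univ : Finset (I ⊕ J)) := by
    ext <;> simp
  have he : (∅, ∅) = Finset.sumEquiv (∅ : Finset (I ⊕ J)) := by
    ext <;> simp
  -- The splitting is applied to the diagrams with external half-lines restricted to `S` and `T`;
  -- the rest of the argument moves subsets of these subtypes back to subsets of `I ⊕ J`.
  have hrec : ∀ s : Finset (I ⊕ J), ∀ x ∈ s, W (Finset.sumEquiv s) =
      ∑ B ∈ s.powerset with x ∈ B, C (Finset.sumEquiv B) * W (Finset.sumEquiv (s \ B)) := by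
    intro s x hx
    obtain ⟨⟨S, T⟩, rfl⟩ := Finset.sumEquiv.symm.surjective s
    have hx' : Sum.elim (· ∈ S) (· ∈ T) x := by rcases x with i | j <;> simpa using hx
    obtain ⟨x, rfl⟩ : ∃ y : S ⊕ T, Sum.map Subtype.val Subtype.val y = x := by
      rcases x with i | j
      · exact ⟨Sum.inl ⟨i, hx'⟩, rfl⟩
      · exact ⟨Sum.inr ⟨j, hx'⟩, rfl⟩
    rw [OrderIso.apply_symm_apply, hW]
    refine (totalSeries_eq_sum F _ _ x).trans ?_
    refine Finset.sum_bij (fun A _ => Finset.sumEquiv.symm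
      (A.1.map (Function.Embedding.subtype _), A.2.map (Function.Embedding.subtype _))) ?_ ?_ ?_ ?_
    · rintro ⟨A, B⟩ hA
      simp only [Finset.mem_filter, Finset.mem_univ, true_and, Finset.mem_powerset] at hA ⊢
      refine ⟨Finset.sumEquiv.symm.monotone ⟨Finset.map_subtype_subset A,
        Finset.map_subtype_subset B⟩, ?_⟩
      rcases x with i | j <;> simpa using hA
    · rintro ⟨A, B⟩ - ⟨A', B'⟩ - h
      have := Finset.sumEquiv.symm.injective h
      simpa using this
    · intro B hB
      obtain ⟨⟨B₁, B₂⟩, rfl⟩ := Finset.sumEquiv.symm.surjective B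
      obtain ⟨h1, h2⟩ := Finset.mem_filter.1 hB
      have h1 := Finset.sumEquiv.symm.le_iff_le.1 (Finset.mem_powerset.1 h1)
      have e1 := Finset.subtype_map_of_mem (p := (· ∈ S)) (s := B₁) fun i hi => h1.1 hi
      have e2 := Finset.subtype_map_of_mem (p := (· ∈ T)) (s := B₂) fun i hi => h1.2 hi
      refine ⟨(B₁.subtype _, B₂.subtype _), ?_, by rw [e1, e2]⟩
      simp only [Finset.mem_filter, Finset.mem_univ, true_and]
      rcases x with i | j <;> simpa using h2
    · rintro ⟨A, B⟩ -
      have hsd : Finset.sumEquiv (Finset.sumEquiv.symm (S, T) \ Finset.sumEquiv.symm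
          (A.map (Function.Embedding.subtype _), B.map (Function.Embedding.subtype _))) =
          (S \ A.map (Function.Embedding.subtype _), T \ B.map (Function.Embedding.subtype _)) := by
        ext <;> simp
      rw [OrderIso.apply_symm_apply, hsd]
      refine congrArg₂ (· * ·) ?_ ?_
      · exact connSeries_congr F (mapSubtypeEquiv A) (mapSubtypeEquiv B)
          (fun i : (A.map (.subtype _) : Finset I) => τu i)
          (fun j : (B.map (.subtype _) : Finset J) => τubar j)
      · exact totalSeries_congr F (complSubtypeEquiv A) (complSubtypeEquiv B)
          (fun i : (S \ A.map (.subtype _) : Finset I) => τu i)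
          (fun j : (T \ B.map (.subtype _) : Finset J) => τubar j)
  rw [h0, sum_isPairPartition C, hu, eq_mul_sum_isPartitionOf (fun s => W (Finset.sumEquiv s))
    (fun s => C (Finset.sumEquiv s)) hrec, ← he]

end ClusterRecursion

end

end FeynmanCluster

namespace FeynmanCluster

noncomputable section

/-! ### Wick's theorem for diagrams -/

open Classical in
/-- Bijections onto a set of coloured points, sorted by the induced colouring. -/
lemma sum_equiv_sigma {X T M : Type*} [Fintype X] [Fintype T] [AddCommMonoid M] (μ : T → ℕ)
    (h : (X → T) → M) :
    ∑ C : X ≃ (Σ t, Fin (μ t)), h (fun x => (C x).1) =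
      (∏ t, (μ t).factorial) •
        ∑ f : X → T with ∀ t, Nat.card {x // f x = t} = μ t, h f := by
  have hmaps : ∀ C ∈ (Finset.univ : Finset (X ≃ (Σ t, Fin (μ t)))),
      (fun x => (C x).1) ∈ Finset.univ.filter
        fun f : X → T => ∀ t, Nat.card {x // f x = t} = μ t := by
    intro C _
    simp only [Finset.mem_filter, Finset.mem_univ, true_and]
    intro t
    rw [Nat.card_congr ((C.subtypeEquiv (q := fun p => p.1 = t) fun x => Iff.rfl).trans
      (Equiv.sigmaSubtype t)), Nat.card_eq_fintype_card, Fintype.card_fin]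
  rw [← Finset.sum_fiberwise_of_maps_to hmaps, Finset.smul_sum]
  refine Finset.sum_congr rfl fun f hf => ?_
  have hf := (Finset.mem_filter.1 hf).2
  rw [Finset.sum_congr rfl (g := fun _ => h f) fun C hC => by
    rw [(Finset.mem_filter.1 hC).2], Finset.sum_const]
  congr 1
  let e : ∀ t, {x // f x = t} ≃ Fin (μ t) := fun t =>
    (Finite.equivFin _).trans (finCongr (hf t))
  let C₀ : X ≃ (Σ t, Fin (μ t)) := (Equiv.sigmaFiberEquiv f).symm.trans (Equiv.sigmaCongrRight e)
  have hC₀ : ∀ x, (C₀ x).1 = f x := fun x => rfl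
  -- Two bijections with the same colouring `f` differ by a permutation of `X` that preserves `f`,
  -- and there are `∏ (μ t)!` of these.
  have hst := DomMulAct.stabilizer_card f
  simp only [← Nat.card_eq_fintype_card, hf] at hst
  rw [← hst, Nat.card_eq_fintype_card, ← Fintype.card_subtype]
  refine Fintype.card_congr ⟨fun C => ⟨C.1.trans C₀.symm, ?_⟩, fun p => ⟨p.1.trans C₀, ?_⟩,
    fun C => ?_, fun p => ?_⟩
  · funext x
    rw [Function.comp_apply, ← hC₀]
    simpa using congrFun C.2 x
  · funext x
    exact congrFun p.2 x
  · ext x : 2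
    simp
  · ext x
    simp

section Wick

variable {R : Type*} [CommRing R] {n : ℕ} (F : Fin n → MvPowerSeries (Fin n) R)

/-- The coefficient of `ū_a u ^ β` in the interaction. -/
def vertexCoeff (a : Fin n) (β : Fin n →₀ ℕ) : MvPowerSeries (Fin n) R :=
  MvPowerSeries.C (MvPowerSeries.coeff β (nonlinPart F a)) + if β = 0 then MvPowerSeries.X a else 0

/-- Tensor coefficients are `β!` times Taylor coefficients; for the `Y`-term, where `β = 0`, the
factorial is `1`. -/
lemma vertexFactor_eq (a : Fin n) (s : Multiset (Fin n)) :
    vertexFactor F a s =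
      (∏ i, (Multiset.toFinsupp s i).factorial) • vertexCoeff F a (Multiset.toFinsupp s) := by
  by_cases hs : s = 0
  · subst hs
    simp [vertexFactor, vertexCoeff, tensorCoeff]
  · have : Multiset.toFinsupp s ≠ 0 := fun h => hs (by simpa using h)
    rw [vertexFactor, if_neg hs, vertexCoeff, if_neg this, add_zero, add_zero, tensorCoeff,
      nsmul_eq_mul, map_mul, map_natCast]
    simp

/-- The wick sum of the monomial with exponents `α₁` and `α₂`. -/
def wickMonomial (A : Matrix (Fin n) (Fin n) R) (α₁ α₂ : Fin n → ℕ) : R :=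
  wickSum A (Sigma.fst : (Σ i : Fin n, Fin (α₁ i)) → Fin n)
      (Sigma.fst : (Σ i : Fin n, Fin (α₂ i)) → Fin n)

lemma wickMonomial_eq (A : Matrix (Fin n) (Fin n) R) {α₁ α₂ : Fin n → ℕ} {κ₁ κ₂ : Type*}
    [Fintype κ₁] [Fintype κ₂] {τ₁ : κ₁ → Fin n} {τ₂ : κ₂ → Fin n}
    (h₁ : ∀ i, Nat.card {k // τ₁ k = i} = α₁ i) (h₂ : ∀ i, Nat.card {k // τ₂ k = i} = α₂ i) :
    wickMonomial A α₁ α₂ = wickSum A τ₁ τ₂ := by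
  obtain ⟨e₁, rfl⟩ := exists_sigma_equiv τ₁ α₁ h₁
  obtain ⟨e₂, rfl⟩ := exists_sigma_equiv τ₂ α₂ h₂
  rw [wickSum_congr, wickMonomial]

/-- Without as many `ū` as `u` there is no bijection to sum over. -/
lemma sum_eq_of_wickMonomial_ne_zero {A : Matrix (Fin n) (Fin n) R} {α₁ α₂ : Fin n → ℕ}
    (h : wickMonomial A α₁ α₂ ≠ 0) : ∑ i, α₁ i = ∑ i, α₂ i := by
  classical
  obtain ⟨σ, -, -⟩ := Finset.exists_ne_zero_of_sum_ne_zero h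
  simpa using Fintype.card_congr σ

variable {I J V : Type*} [Fintype I] [Fintype J] [Fintype V]

/-- The exponent of `ū`. -/
def ubarExponent (τubar : J → Fin n) (a : V → Fin n) : Fin n →₀ ℕ :=
  ∑ j, Finsupp.single (τubar j) 1 + ∑ v, Finsupp.single (a v) 1

/-- The exponent of `u`. -/
def uExponent (τu : I → Fin n) (β : V → Fin n →₀ ℕ) : Fin n →₀ ℕ :=
  ∑ i, Finsupp.single (τu i) 1 + ∑ v, β v

lemma card_fiber_eq_sum_single {κ : Type*} [Fintype κ] (τ : κ → Fin n) (i : Fin n) :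
    Nat.card {k // τ k = i} = (∑ k, Finsupp.single (τ k) 1) i := by
  classical
  rw [Finsupp.finsetSum_apply, Nat.card_eq_fintype_card, Fintype.card_subtype]
  simp [Finsupp.single_apply]

lemma count_fiberLabels {X T : Type*} [Fintype X] (φ : X → T) (b : X → Fin n) (t : T)
    (c : Fin n) :
    (fiberLabels φ b t).count c = Nat.card {x // (φ x, b x) = (t, c)} := by
  classical
  rw [fiberLabels, Multiset.count_map, Nat.card_eq_fintype_card, Fintype.card_subtype]
  simp only [Prod.mk.injEq, eq_comm (a := c)]
  rw [← Finset.filter_val, Finset.filter_filter]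
  rfl

open Classical in
-- The factors `u` are indexed by owner, colour and a running number. A bijection from the
-- `ū`-half-lines to them induces a map to (owner, colour), which is a pair `(φ, b)`. Each pair with
-- the right multiplicities arises from as many bijections as there are permutations of the running
-- numbers.
lemma wickMonomial_exponents (τu : I → Fin n) (τubar : J → Fin n) (a : V → Fin n)
    (β : V → Fin n →₀ ℕ) (A : Matrix (Fin n) (Fin n) R) :
    wickMonomial A (ubarExponent τubar a) (uExponent τu β) =
      (∏ v, ∏ c, (β v c).factorial) •
        ∑ φ : J ⊕ V → I ⊕ V, ∑ b : J ⊕ V → Fin n,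
          if (∀ i, fiberLabels φ b (Sum.inl i) = {τu i}) ∧
              ∀ v, Multiset.toFinsupp (fiberLabels φ b (Sum.inr v)) = β v
          then ∏ x, A⁻¹ (b x) (Sum.elim τubar a x) else 0 := by
  -- `μ (t, c)` is the number of factors `u_c` that belong to the owner `t`.
  let μ : (I ⊕ V) × Fin n → ℕ := fun t =>
    Sum.elim (fun i => Finsupp.single (τu i) 1 t.2) (fun v => β v t.2) t.1
  have h₁ : ∀ i, Nat.card {k // Sum.elim τubar a k = i} = ubarExponent τubar a i := fun i => by
    rw [card_fiber_eq_sum_single, ubarExponent, Fintype.sum_sum_type]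
    rfl
  have h₂ : ∀ i, Nat.card {k : Σ t, Fin (μ t) // k.1.2 = i} = uExponent τu β i := fun i => by
    have e : {k : Σ t, Fin (μ t) // k.1.2 = i} ≃ Σ t : I ⊕ V, Fin (μ (t, i)) :=
      ⟨fun k => ⟨k.1.1.1, k.1.2.cast (congrArg (fun c => μ (k.1.1.1, c)) k.2)⟩, fun k => ⟨⟨(k.1, i), k.2⟩, rfl⟩,
        fun ⟨⟨⟨t, c⟩, l⟩, h⟩ => by subst h; rfl, fun _ => rfl⟩
    rw [Nat.card_congr e, Nat.card_sigma, Fintype.sum_sum_type]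
    simp [μ, uExponent]
  have hs := sum_equiv_sigma μ fun f : J ⊕ V → (I ⊕ V) × Fin n =>
    ∏ x, A⁻¹ (f x).2 (Sum.elim τubar a x)
  -- External owners have multiplicities `0` or `1`, so only the vertices contribute factorials.
  have hμ : ∏ t, (μ t).factorial = ∏ v, ∏ c, (β v c).factorial := by
    rw [Fintype.prod_prod_type, Fintype.prod_sum_type]
    have : ∀ (i : I) (c : Fin n), (μ (Sum.inl i, c)).factorial = 1 := fun i c => by
      simp only [μ, Sum.elim_inl, Finsupp.single_apply]
      split_ifs <;> rfl
    simp only [this, Finset.prod_const_one, one_mul]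
    rfl
  rw [wickMonomial_eq A h₁ h₂, ← hμ]
  refine (Finset.sum_equiv (Equiv.refl _) (by simp) fun C _ => rfl).trans (hs.trans ?_)
  congr 1
  rw [Finset.sum_filter, ← Fintype.sum_prod_type']
  refine Finset.sum_equiv (Equiv.arrowProdEquivProdArrow _ _ _) (by simp) fun f _ => ?_
  refine if_congr ?_ rfl rfl
  have hc : ∀ t c, Nat.card {x // f x = (t, c)} =
      (fiberLabels (fun x => (f x).1) (fun x => (f x).2) t).count c := fun t c =>
    (count_fiberLabels _ _ t c).symm
  simp only [Prod.forall, hc, Sum.forall, Multiset.ext, Finsupp.ext_iff,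
    Multiset.toFinsupp_apply, Multiset.count_singleton]
  refine and_congr (forall₂_congr fun i c => ?_) Iff.rfl
  simp only [μ, Sum.elim_inl, Finsupp.single_apply, eq_comm (a := τu i)]
  rfl

open Classical in
-- A pair `(φ, b)` occurs for exactly one family of exponents `β`, namely the colour multiplicities
-- of its fibres over the vertices; the factorials from Wick's theorem complete `vertexCoeff` to
-- `vertexFactor`. The finite set `D` stands in for all exponents: a fibre has at most `#J + #V`
-- elements.
lemma sum_vertexCoeff_mul_wickMonomial (τu : I → Fin n) (τubar : J → Fin n)
    (D : Finset (Fin n →₀ ℕ))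
    (hD : ∀ β : Fin n →₀ ℕ, β.degree ≤ Fintype.card J + Fintype.card V → β ∈ D) :
    ∑ a : V → Fin n, ∑ β ∈ Fintype.piFinset fun _ : V => D,
        (∏ v, vertexCoeff F (a v) (β v)) * MvPowerSeries.C
          (wickMonomial (linMatrix F) (ubarExponent τubar a) (uExponent τu β)) =
      totalSum (propagator F) (vertexFactor F) τu τubar V := by
  have hterm : ∀ (a : V → Fin n) (β : V → Fin n →₀ ℕ),
      (∏ v, vertexCoeff F (a v) (β v)) * MvPowerSeries.C
          (wickMonomial (linMatrix F) (ubarExponent τubar a) (uExponent τu β)) =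
        ∑ φ : J ⊕ V → I ⊕ V, ∑ b : J ⊕ V → Fin n,
          if (fun v => Multiset.toFinsupp (fiberLabels φ b (Sum.inr v))) = β
          then stateWeight (propagator F) (vertexFactor F) τu τubar φ a b else 0 := by
    intro a β
    rw [wickMonomial_exponents, map_nsmul, mul_smul_comm, map_sum, Finset.mul_sum,
      Finset.smul_sum]
    refine Finset.sum_congr rfl fun φ _ => ?_
    rw [map_sum, Finset.mul_sum, Finset.smul_sum]
    refine Finset.sum_congr rfl fun b _ => ?_
    by_cases hβ : (fun v => Multiset.toFinsupp (fiberLabels φ b (Sum.inr v))) = β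
    · by_cases hi : ∀ i, fiberLabels φ b (Sum.inl i) = {τu i}
      · rw [if_pos ⟨hi, fun v => congrFun hβ v⟩, if_pos hβ]
        simp only [stateWeight, propagator, rootFactor, hi, if_true, Finset.prod_const_one,
          mul_one, vertexFactor_eq, ← hβ, map_prod, nsmul_eq_mul, Finset.prod_mul_distrib,
          Nat.cast_prod]
        ring
      · rw [if_neg fun h => hi h.1, if_pos hβ, map_zero, mul_zero, smul_zero]
        -- The Wick term is absent if a root has the wrong label; the root factors make the weight
        -- vanish as well.
        by_contra h0
        exact hi fun i => fiberLabels_eq_of_stateWeight_ne_zero (Ne.symm h0) i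
    · rw [if_neg fun h => hβ (funext h.2), if_neg hβ, map_zero, mul_zero, smul_zero]
  simp only [hterm]
  have hswap : ∀ a : V → Fin n, (∑ β ∈ Fintype.piFinset fun _ : V => D,
      ∑ φ : J ⊕ V → I ⊕ V, ∑ b : J ⊕ V → Fin n,
          if (fun v => Multiset.toFinsupp (fiberLabels φ b (Sum.inr v))) = β
          then stateWeight (propagator F) (vertexFactor F) τu τubar φ a b else 0) =
      ∑ φ : J ⊕ V → I ⊕ V, ∑ b : J ⊕ V → Fin n,
        stateWeight (propagator F) (vertexFactor F) τu τubar φ a b := by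
    intro a
    rw [Finset.sum_comm]
    refine Finset.sum_congr rfl fun φ _ => ?_
    rw [Finset.sum_comm]
    refine Finset.sum_congr rfl fun b _ => ?_
    rw [Finset.sum_ite_eq, if_pos]
    refine Fintype.mem_piFinset.2 fun v => hD _ ?_
    rw [degree_toFinsupp, card_fiberLabels, ← Fintype.card_sum, ← Nat.card_eq_fintype_card]
    exact Finite.card_subtype_le _
  simp only [hswap]
  rw [Finset.sum_comm]
  rfl

end Wick

end

end FeynmanCluster

namespace FeynmanCluster

noncomputable section

/-! ### Coefficients of the integrand -/

section Exponents

variable {n : ℕ}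

/-- The exponent of the monomial `ū ^ α₁ u ^ α₂ Y ^ α₃`. -/
def exps (α₁ α₂ α₃ : Fin n →₀ ℕ) : Var n →₀ ℕ := Finsupp.sumElim α₁ (Finsupp.sumElim α₂ α₃)

lemma exps_ubarVar (α₁ α₂ α₃ : Fin n →₀ ℕ) (i : Fin n) : exps α₁ α₂ α₃ (ubarVar i) = α₁ i := rfl

lemma exps_uVar (α₁ α₂ α₃ : Fin n →₀ ℕ) (i : Fin n) : exps α₁ α₂ α₃ (uVar i) = α₂ i := rfl

lemma exps_yVar (α₁ α₂ α₃ : Fin n →₀ ℕ) (i : Fin n) : exps α₁ α₂ α₃ (yVar i) = α₃ i := rfl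

lemma exps_ext {m m' : Var n →₀ ℕ} (h₁ : ∀ i, m (ubarVar i) = m' (ubarVar i))
    (h₂ : ∀ i, m (uVar i) = m' (uVar i)) (h₃ : ∀ i, m (yVar i) = m' (yVar i)) : m = m' := by
  ext (i | i | i)
  · exact h₁ i
  · exact h₂ i
  · exact h₃ i

lemma exists_eq_exps (m : Var n →₀ ℕ) : ∃ α₁ α₂ α₃, m = exps α₁ α₂ α₃ := by
  refine ⟨m.comapDomain ubarVar Sum.inl_injective.injOn,
    m.comapDomain uVar (Sum.inr_injective.comp Sum.inl_injective).injOn,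
    m.comapDomain yVar yVar_injective.injOn, exps_ext ?_ ?_ ?_⟩ <;> intro i <;> rfl

lemma exps_inj {α₁ α₂ α₃ β₁ β₂ β₃ : Fin n →₀ ℕ} :
    exps α₁ α₂ α₃ = exps β₁ β₂ β₃ ↔ α₁ = β₁ ∧ α₂ = β₂ ∧ α₃ = β₃ := by
  constructor
  · intro h
    exact ⟨Finsupp.ext fun i => DFunLike.congr_fun h (ubarVar i),
      Finsupp.ext fun i => DFunLike.congr_fun h (uVar i),
      Finsupp.ext fun i => DFunLike.congr_fun h (yVar i)⟩
  · rintro ⟨rfl, rfl, rfl⟩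
    rfl

lemma exps_add (α₁ α₂ α₃ β₁ β₂ β₃ : Fin n →₀ ℕ) :
    exps α₁ α₂ α₃ + exps β₁ β₂ β₃ = exps (α₁ + β₁) (α₂ + β₂) (α₃ + β₃) := by
  refine exps_ext ?_ ?_ ?_ <;> intro i <;> rfl

lemma exps_sum {ι : Type*} (s : Finset ι) (α₁ α₂ α₃ : ι → Fin n →₀ ℕ) :
    ∑ k ∈ s, exps (α₁ k) (α₂ k) (α₃ k) =
      exps (∑ k ∈ s, α₁ k) (∑ k ∈ s, α₂ k) (∑ k ∈ s, α₃ k) := by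
  refine exps_ext ?_ ?_ ?_ <;> intro i <;>
    simp [Finsupp.finsetSum_apply, exps_ubarVar, exps_uVar, exps_yVar]

lemma degree_exps (α₁ α₂ α₃ : Fin n →₀ ℕ) :
    (exps α₁ α₂ α₃).degree = α₁.degree + α₂.degree + α₃.degree := by
  simp only [Finsupp.degree_eq_sum, Fintype.sum_sum_type, add_assoc]
  rfl

lemma comapDomain_exps (α₁ α₂ α₃ : Fin n →₀ ℕ) :
    (exps α₁ α₂ α₃).comapDomain yVar yVar_injective.injOn = α₃ := Finsupp.ext fun _ => rfl

lemma single_ubarVar (i : Fin n) :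
    Finsupp.single (ubarVar i) 1 = exps (Finsupp.single i 1) 0 0 := by
  refine exps_ext ?_ ?_ ?_ <;> intro k <;>
    simp [exps_ubarVar, exps_uVar, exps_yVar, Finsupp.single_apply]

lemma single_uVar (i : Fin n) :
    Finsupp.single (uVar i) 1 = exps 0 (Finsupp.single i 1) 0 := by
  refine exps_ext ?_ ?_ ?_ <;> intro k <;>
    simp [exps_ubarVar, exps_uVar, exps_yVar, Finsupp.single_apply]

lemma mapDomain_uVar (α : Fin n →₀ ℕ) : α.mapDomain uVar = exps 0 α 0 := by
  have hinj : Function.Injective (uVar (n := n)) := Sum.inr_injective.comp Sum.inl_injective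
  refine exps_ext ?_ ?_ ?_ <;> intro k
  · exact Finsupp.mapDomain_of_notMem_range _ _ (by simp)
  · exact Finsupp.mapDomain_apply hinj α k
  · exact Finsupp.mapDomain_of_notMem_range _ _ (by simp)

lemma mapDomain_yVar (α : Fin n →₀ ℕ) : α.mapDomain yVar = exps 0 0 α := by
  refine exps_ext ?_ ?_ ?_ <;> intro k
  · exact Finsupp.mapDomain_of_notMem_range _ _ (by simp)
  · exact Finsupp.mapDomain_of_notMem_range _ _ (by simp)
  · exact Finsupp.mapDomain_apply yVar_injective α k

end Exponents

/-! ### Truncation of the interaction and its powers -/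

section Coefficients

variable {R : Type*} [CommRing R] {n : ℕ}

lemma coeff_mapDomain_rename {σ τ : Type*} {f : σ → τ} [Filter.TendstoCofinite f]
    (hf : Function.Injective f) (p : MvPowerSeries σ R) (x : σ →₀ ℕ) :
    MvPowerSeries.coeff (x.mapDomain f) (MvPowerSeries.rename f p) = MvPowerSeries.coeff x p := by
  rw [MvPowerSeries.coeff_rename, Finset.sum_eq_single x]
  · intro y hy hyx
    exact absurd (Finsupp.mapDomain_injective hf (by simpa using hy)) hyx
  · intro h
    simp at h

lemma coeff_exps_rename_uVar (p : MvPowerSeries (Fin n) R) (α₁ α₂ α₃ : Fin n →₀ ℕ) :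
    MvPowerSeries.coeff (exps α₁ α₂ α₃) (MvPowerSeries.rename uVar p) =
      if α₁ = 0 ∧ α₃ = 0 then MvPowerSeries.coeff α₂ p else 0 := by
  split_ifs with h
  · obtain ⟨rfl, rfl⟩ := h
    rw [← mapDomain_uVar, coeff_mapDomain_rename (f := uVar)
      (Sum.inr_injective.comp Sum.inl_injective)]
  · refine MvPowerSeries.coeff_rename_eq_zero _ _ ?_
    rintro ⟨x, hx⟩
    rw [mapDomain_uVar, exps_inj] at hx
    exact h ⟨hx.1.symm, hx.2.2.symm⟩

lemma coeff_exps_rename_yVar (p : MvPowerSeries (Fin n) R) (α₁ α₂ α₃ : Fin n →₀ ℕ) :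
    MvPowerSeries.coeff (exps α₁ α₂ α₃) (MvPowerSeries.rename yVar p) =
      if α₁ = 0 ∧ α₂ = 0 then MvPowerSeries.coeff α₃ p else 0 := by
  split_ifs with h
  · obtain ⟨rfl, rfl⟩ := h
    rw [← mapDomain_yVar, coeff_mapDomain_rename yVar_injective]
  · refine MvPowerSeries.coeff_rename_eq_zero _ _ ?_
    rintro ⟨x, hx⟩
    rw [mapDomain_yVar, exps_inj] at hx
    exact h ⟨hx.1.symm, hx.2.1.symm⟩

lemma coeff_monomial_mul_rename_uVar (p : MvPowerSeries (Fin n) R)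
    (α₁ α₂ α₃ β₁ : Fin n →₀ ℕ) :
    MvPowerSeries.coeff (exps α₁ α₂ α₃)
        (MvPowerSeries.monomial (exps β₁ 0 0) 1 * MvPowerSeries.rename uVar p) =
      if α₁ = β₁ ∧ α₃ = 0 then MvPowerSeries.coeff α₂ p else 0 := by
  classical
  rw [MvPowerSeries.coeff_monomial_mul]
  by_cases hle : exps β₁ 0 0 ≤ exps α₁ α₂ α₃
  · obtain ⟨m, hm⟩ := exists_add_of_le hle
    obtain ⟨γ₁, γ₂, γ₃, rfl⟩ := exists_eq_exps m
    rw [if_pos hle, hm, add_tsub_cancel_left, coeff_exps_rename_uVar, one_mul]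
    rw [exps_add, exps_inj] at hm
    obtain ⟨rfl, rfl, rfl⟩ := hm
    simp
  · rw [if_neg hle, if_neg]
    rintro ⟨rfl, rfl⟩
    refine hle ?_
    rw [show exps α₁ α₂ 0 = exps α₁ 0 0 + exps 0 α₂ 0 by simp [exps_add]]
    exact le_self_add

lemma coeff_monomial_mul_rename_yVar (p : MvPowerSeries (Fin n) R)
    (α₁ α₂ α₃ β₁ β₂ : Fin n →₀ ℕ) :
    MvPowerSeries.coeff (exps α₁ α₂ α₃)
        (MvPowerSeries.monomial (exps β₁ β₂ 0) 1 * MvPowerSeries.rename yVar p) =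
      if β₁ = α₁ ∧ β₂ = α₂ then MvPowerSeries.coeff α₃ p else 0 := by
  classical
  rw [MvPowerSeries.coeff_monomial_mul]
  by_cases hle : exps β₁ β₂ 0 ≤ exps α₁ α₂ α₃
  · obtain ⟨m, hm⟩ := exists_add_of_le hle
    obtain ⟨γ₁, γ₂, γ₃, rfl⟩ := exists_eq_exps m
    rw [if_pos hle, hm, add_tsub_cancel_left, coeff_exps_rename_yVar, one_mul]
    rw [exps_add, exps_inj] at hm
    obtain ⟨rfl, rfl, rfl⟩ := hm
    simp
  · rw [if_neg hle, if_neg]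
    rintro ⟨rfl, rfl⟩
    refine hle ?_
    rw [show exps β₁ β₂ α₃ = exps β₁ β₂ 0 + exps 0 0 α₃ by simp [exps_add]]
    exact le_self_add

/-- The multiindices of degree at most `M`. -/
def degreeLE (n M : ℕ) : Finset (Fin n →₀ ℕ) := (Finsupp.finite_of_degree_le (σ := Fin n) M).toFinset

lemma mem_degreeLE {M : ℕ} {β : Fin n →₀ ℕ} : β ∈ degreeLE n M ↔ β.degree ≤ M := by
  simp [degreeLE]

variable (F : Fin n → MvPowerSeries (Fin n) R)

/-- The terms of degree at most `M` in `u` of the interaction. -/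
def truncInteraction (M : ℕ) : MvPowerSeries (Var n) R :=
  ∑ a, ∑ β ∈ degreeLE n M, MvPowerSeries.monomial (exps (Finsupp.single a 1) β 0) 1 *
    MvPowerSeries.rename yVar (vertexCoeff F a β)

/-- Terms of degree above `M` in `u` cannot be seen in total degree at most `M`. The truncation
replaces the infinite sum over exponents `β` by a finite one, to which distributivity applies. -/
lemma coeff_truncInteraction {M : ℕ} {m : Var n →₀ ℕ} (hm : m.degree ≤ M) :
    MvPowerSeries.coeff m (truncInteraction F M) = MvPowerSeries.coeff m (interaction F) := by
  classical
  obtain ⟨α₁, α₂, α₃, rfl⟩ := exists_eq_exps m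
  rw [degree_exps] at hm
  rw [truncInteraction, interaction, ← Finset.sum_add_distrib, map_sum, map_sum]
  refine Finset.sum_congr rfl fun a _ => ?_
  rw [map_sum, map_add]
  have hX : (MvPowerSeries.X (ubarVar a) : MvPowerSeries (Var n) R) =
      MvPowerSeries.monomial (exps (Finsupp.single a 1) 0 0) 1 := by
    rw [MvPowerSeries.X, single_ubarVar]
  rw [hX, coeff_monomial_mul_rename_uVar]
  have hY : (MvPowerSeries.X (yVar a) : MvPowerSeries (Var n) R) =
      MvPowerSeries.rename yVar (MvPowerSeries.X a) := by rw [MvPowerSeries.rename_X]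
  rw [hY, coeff_monomial_mul_rename_yVar]
  simp only [coeff_monomial_mul_rename_yVar]
  by_cases ha : Finsupp.single a 1 = α₁
  · simp only [ha, true_and]
    rw [Finset.sum_ite_eq', if_pos (mem_degreeLE.2 (by omega)), vertexCoeff, map_add,
      MvPowerSeries.coeff_C]
    congr 1
    by_cases h2 : α₂ = 0
    · simp [h2]
    · simp [h2, Ne.symm h2]
  · simp [ha, Ne.symm ha]

/-- Degrees add, so a coefficient of a product in degree at most `M` involves only such coefficients
of the factors. -/
lemma coeff_pow_congr {σ : Type*} {f g : MvPowerSeries σ R} {M : ℕ}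
    (h : ∀ m : σ →₀ ℕ, m.degree ≤ M → MvPowerSeries.coeff m f = MvPowerSeries.coeff m g) (N : ℕ) :
    ∀ m : σ →₀ ℕ, m.degree ≤ M →
      MvPowerSeries.coeff m (f ^ N) = MvPowerSeries.coeff m (g ^ N) := by
  classical
  induction N with
  | zero => simp
  | succ N ih =>
    intro m hm
    rw [pow_succ, pow_succ, MvPowerSeries.coeff_mul, MvPowerSeries.coeff_mul]
    refine Finset.sum_congr rfl fun p hp => ?_
    have hp := Finset.HasAntidiagonal.mem_antidiagonal.1 hp
    have := congrArg Finsupp.degree hp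
    rw [map_add] at this
    rw [ih p.1 (by omega), h p.2 (by omega)]

lemma constantCoeff_interaction : MvPowerSeries.constantCoeff (interaction F) = 0 := by
  simp [interaction]

lemma coeff_interaction_pow_eq_zero {m : Var n →₀ ℕ} {N : ℕ} (h : m.degree < N) :
    MvPowerSeries.coeff m (interaction F ^ N) = 0 := by
  refine MvPowerSeries.coeff_of_lt_order (lt_of_lt_of_le ?_
    (MvPowerSeries.le_order_pow_of_constantCoeff_eq_zero N (constantCoeff_interaction F)))
  exact_mod_cast h

/-- Distributivity: each of the `N` factors selects a `ū`-index `a v` and an exponent `β v` of `u`.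
The remaining coefficients depend on `Y` only. -/
lemma prod_X_mul_truncInteraction_pow {I J : Type*} [Fintype I] [Fintype J] (τu : I → Fin n)
    (τubar : J → Fin n) (M N : ℕ) :
    (∏ i, MvPowerSeries.X (uVar (τu i))) * (∏ j, MvPowerSeries.X (ubarVar (τubar j))) *
        truncInteraction F M ^ N =
      ∑ a : Fin N → Fin n, ∑ β ∈ Fintype.piFinset fun _ : Fin N => degreeLE n M,
        MvPowerSeries.monomial (exps (ubarExponent τubar a) (uExponent τu β) 0) 1 *
          MvPowerSeries.rename yVar (∏ v, vertexCoeff F (a v) (β v)) := by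
  classical
  have hI : (∏ i, MvPowerSeries.X (uVar (τu i)) : MvPowerSeries (Var n) R) =
      MvPowerSeries.monomial (exps 0 (∑ i, Finsupp.single (τu i) 1) 0) 1 := by
    simp only [MvPowerSeries.X, MvPowerSeries.prod_monomial, single_uVar, exps_sum,
      Finset.sum_const_zero, Finset.prod_const_one]
  have hJ : (∏ j, MvPowerSeries.X (ubarVar (τubar j)) : MvPowerSeries (Var n) R) =
      MvPowerSeries.monomial (exps (∑ j, Finsupp.single (τubar j) 1) 0 0) 1 := by
    simp only [MvPowerSeries.X, MvPowerSeries.prod_monomial, single_ubarVar, exps_sum,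
      Finset.sum_const_zero, Finset.prod_const_one]
  have hp : truncInteraction F M ^ N = ∏ _v : Fin N, truncInteraction F M := by simp
  rw [hp, hI, hJ, MvPowerSeries.monomial_mul_monomial, exps_add]
  simp only [truncInteraction]
  rw [Fintype.prod_sum]
  simp only [Finset.prod_univ_sum]
  rw [Finset.mul_sum]
  refine Finset.sum_congr rfl fun a _ => ?_
  rw [Finset.mul_sum]
  refine Finset.sum_congr rfl fun β _ => ?_
  rw [Finset.prod_mul_distrib, ← map_prod, MvPowerSeries.prod_monomial, exps_sum, ← mul_assoc,
    MvPowerSeries.monomial_mul_monomial, exps_add]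
  simp [ubarExponent, uExponent]

lemma degree_eq_of_wickMonomial_ne_zero {A : Matrix (Fin n) (Fin n) R} {α₁ α₂ : Fin n →₀ ℕ}
    (h : wickMonomial A α₁ α₂ ≠ 0) : α₁.degree = α₂.degree := by
  simpa [Finsupp.degree_eq_sum] using sum_eq_of_wickMonomial_ne_zero h

lemma coeff_gaussTerm (A : Matrix (Fin n) (Fin n) R) (U : MvPowerSeries (Var n) R)
    (α₁ α₂ α₃ d : Fin n →₀ ℕ) [Decidable (d = α₃)] :
    MvPowerSeries.coeff d (gaussTerm A U (exps α₁ α₂ α₃)) =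
      if d = α₃ then MvPowerSeries.coeff (exps α₁ α₂ α₃) U *
        (Ring.inverse A.det * wickMonomial A α₁ α₂) else 0 := by
  rw [gaussTerm, comapDomain_exps, MvPowerSeries.coeff_monomial]
  congr

lemma coeff_familySum {σ ι : Type*} (f : ι → MvPowerSeries σ R) (d : σ →₀ ℕ) :
    MvPowerSeries.coeff d (familySum f) = ∑ᶠ i, MvPowerSeries.coeff d (f i) := rfl

/-! ### The formal Gaussian integral as a sum over diagrams -/

section Integral

variable [Algebra ℚ R] {I J : Type*} [Fintype I] [Fintype J]

/-- The interaction has no constant term, so its `N`-th power starts in degree `N` and only `N ≤ M`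
matters. -/
lemma coeff_expInteraction {M : ℕ} {m : Var n →₀ ℕ} (hm : m.degree ≤ M) :
    MvPowerSeries.coeff m (expInteraction F) =
      ∑ N ∈ Finset.range (M + 1),
        ((N.factorial : ℚ)⁻¹) • MvPowerSeries.coeff m (truncInteraction F M ^ N) := by
  rw [expInteraction, PowerSeries.coeff_subst
    (PowerSeries.HasSubst.of_constantCoeff_zero (constantCoeff_interaction F)),
    finsum_eq_sum_of_support_subset (s := Finset.range (M + 1))]
  · refine Finset.sum_congr rfl fun N _ => ?_
    rw [PowerSeries.coeff_exp, algebraMap_smul, one_div,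
      coeff_pow_congr (fun m hm => coeff_truncInteraction F hm) N m hm]
  · intro N hN
    by_contra h
    refine hN ?_
    simp only [Finset.coe_range, Set.mem_Iio, not_lt] at h
    simp only [coeff_interaction_pow_eq_zero F (show m.degree < N by omega), smul_zero]

open Classical in
lemma coeff_corrIntegrand (τu : I → Fin n) (τubar : J → Fin n) {M : ℕ} {α₁ α₂ d : Fin n →₀ ℕ}
    (hm : (exps α₁ α₂ d).degree ≤ M) :
    MvPowerSeries.coeff (exps α₁ α₂ d) (corrIntegrand F τu τubar) =
      ∑ N ∈ Finset.range (M + 1), ((N.factorial : ℚ)⁻¹) •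
        ∑ a : Fin N → Fin n, ∑ β ∈ Fintype.piFinset fun _ : Fin N => degreeLE n M,
          if ubarExponent τubar a = α₁ ∧ uExponent τu β = α₂ then
            MvPowerSeries.coeff d (∏ v, vertexCoeff F (a v) (β v)) else 0 := by
  have hN : ∀ N : ℕ, (∑ a : Fin N → Fin n, ∑ β ∈ Fintype.piFinset fun _ : Fin N => degreeLE n M,
        if ubarExponent τubar a = α₁ ∧ uExponent τu β = α₂ then
          MvPowerSeries.coeff d (∏ v, vertexCoeff F (a v) (β v)) else 0) =
      MvPowerSeries.coeff (exps α₁ α₂ d) ((∏ i, MvPowerSeries.X (uVar (τu i))) *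
        (∏ j, MvPowerSeries.X (ubarVar (τubar j))) * truncInteraction F M ^ N) := fun N => by
    simp only [prod_X_mul_truncInteraction_pow, map_sum, coeff_monomial_mul_rename_yVar]
  simp only [hN, corrIntegrand]
  have hX : ∃ e : Var n →₀ ℕ, (∏ i, MvPowerSeries.X (uVar (τu i))) *
      (∏ j, MvPowerSeries.X (ubarVar (τubar j))) =
        (MvPowerSeries.monomial e 1 : MvPowerSeries (Var n) R) :=
    ⟨_, by simp only [MvPowerSeries.X, MvPowerSeries.prod_monomial,
      MvPowerSeries.monomial_mul_monomial, Finset.prod_const_one, mul_one]; rfl⟩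
  obtain ⟨e, he⟩ := hX
  simp only [he, MvPowerSeries.coeff_monomial_mul, one_mul]
  split_ifs with hle
  -- Dividing by the external monomial only lowers the degree, so the same `M` works for the
  -- exponential.
  · refine coeff_expInteraction F (le_trans ?_ hm)
    obtain ⟨m, hm'⟩ := exists_add_of_le hle
    rw [hm', add_tsub_cancel_left, map_add]
    omega
  · simp

/-- The bound for `vertexFactor` carries over because the two differ by a factorial, which is
invertible over `ℚ`. -/
lemma two_le_of_coeff_vertexCoeff_ne_zero {a : Fin n} {β d : Fin n →₀ ℕ}
    (h : MvPowerSeries.coeff d (vertexCoeff F a β) ≠ 0) : 2 ≤ 2 * d.degree + β.degree := by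
  have hβ : Multiset.toFinsupp (Finsupp.toMultiset β) = β := by simp
  rw [← hβ, degree_toFinsupp]
  refine two_le_of_coeff_vertexFactor_ne_zero F (a := a) fun h0 => h ?_
  rw [vertexFactor_eq, hβ, map_nsmul, ← Nat.cast_smul_eq_nsmul ℚ] at h0
  set q : ℚ := ((∏ i, (β i).factorial : ℕ) : ℚ) with hq
  have hq0 : q ≠ 0 := Nat.cast_ne_zero.2 (Finset.prod_ne_zero_iff.2 fun i _ =>
    Nat.factorial_ne_zero _)
  rw [← one_smul ℚ (MvPowerSeries.coeff d (vertexCoeff F a β)), ← inv_mul_cancel₀ hq0, mul_smul,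
    h0, smul_zero]

lemma degree_ubarExponent {V : Type*} [Fintype V] (τubar : J → Fin n) (a : V → Fin n) :
    (ubarExponent τubar a).degree = Fintype.card J + Fintype.card V := by
  simp [ubarExponent]

lemma degree_uExponent {V : Type*} [Fintype V] (τu : I → Fin n) (β : V → Fin n →₀ ℕ) :
    (uExponent τu β).degree = Fintype.card I + ∑ v, (β v).degree := by
  simp [uExponent]

/-- The same count as for diagrams, with exponents for half-lines: a nonzero Wick sum forces `#J +
#V = #I + ∑ deg β(v)`. -/
lemma card_le_of_mul_wickMonomial_ne_zero {V : Type*} [Fintype V] {τu : I → Fin n}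
    {τubar : J → Fin n} {a : V → Fin n} {β : V → Fin n →₀ ℕ} {d : Fin n →₀ ℕ}
    (h : MvPowerSeries.coeff d (∏ v, vertexCoeff F (a v) (β v)) *
      wickMonomial (linMatrix F) (ubarExponent τubar a) (uExponent τu β) ≠ 0) :
    Fintype.card V ≤ 2 * d.degree + Fintype.card J := by
  have h1 := card_mul_le_of_coeff_prod_ne_zero
    (fun v d => two_le_of_coeff_vertexCoeff_ne_zero F) (left_ne_zero_of_mul h)
  have h2 := degree_eq_of_wickMonomial_ne_zero (right_ne_zero_of_mul h)
  rw [degree_ubarExponent, degree_uExponent] at h2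
  omega

/-- The `ū`-degree is `#J + N`, and the half-line count bounds `N` by `2 deg d + #J`. Only finitely
many exponents thus contribute to a monomial in `Y`, which is why the integral exists. -/
lemma degree_le_of_coeff_corrIntegrand_mul_ne_zero {τu : I → Fin n} {τubar : J → Fin n}
    {α₁ α₂ d : Fin n →₀ ℕ}
    (h : MvPowerSeries.coeff (exps α₁ α₂ d) (corrIntegrand F τu τubar) *
      wickMonomial (linMatrix F) α₁ α₂ ≠ 0) :
    α₁.degree ≤ 2 * d.degree + 2 * Fintype.card J ∧
      α₂.degree ≤ 2 * d.degree + 2 * Fintype.card J := by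
  classical
  have h2 := degree_eq_of_wickMonomial_ne_zero (right_ne_zero_of_mul h)
  rw [coeff_corrIntegrand F τu τubar le_rfl, Finset.sum_mul] at h
  obtain ⟨N, -, hN⟩ := Finset.exists_ne_zero_of_sum_ne_zero h
  rw [smul_mul_assoc, Finset.sum_mul] at hN
  obtain ⟨a, -, ha⟩ := Finset.exists_ne_zero_of_sum_ne_zero fun h0 => hN (by rw [h0, smul_zero])
  rw [Finset.sum_mul] at ha
  obtain ⟨β, -, hβ⟩ := Finset.exists_ne_zero_of_sum_ne_zero ha
  split_ifs at hβ with hc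
  · obtain ⟨rfl, rfl⟩ := hc
    have := card_le_of_mul_wickMonomial_ne_zero F hβ
    rw [degree_ubarExponent] at h2 ⊢
    omega
  · simp at hβ

lemma gaussTerm_support (τu : I → Fin n) (τubar : J → Fin n) (d : Fin n →₀ ℕ) {m : Var n →₀ ℕ}
    (hm : MvPowerSeries.coeff d
      (gaussTerm (linMatrix F) (corrIntegrand F τu τubar) m) ≠ 0) :
    ∃ α₁ ∈ degreeLE n (2 * d.degree + 2 * Fintype.card J),
      ∃ α₂ ∈ degreeLE n (2 * d.degree + 2 * Fintype.card J), m = exps α₁ α₂ d := by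
  classical
  obtain ⟨α₁, α₂, α₃, rfl⟩ := exists_eq_exps m
  rw [coeff_gaussTerm] at hm
  split_ifs at hm with h
  · subst h
    have := degree_le_of_coeff_corrIntegrand_mul_ne_zero F (τu := τu) (τubar := τubar)
      (α₁ := α₁) (α₂ := α₂) (d := d) fun h0 => hm (by rw [mul_left_comm, h0, mul_zero])
    exact ⟨α₁, mem_degreeLE.2 this.1, α₂, mem_degreeLE.2 this.2, rfl⟩
  · exact absurd rfl hm

lemma gaussIntegrable_corrIntegrand (τu : I → Fin n) (τubar : J → Fin n) :
    GaussIntegrable (linMatrix F) (corrIntegrand F τu τubar) := by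
  classical
  intro d
  refine ((degreeLE n (2 * d.degree + 2 * Fintype.card J) ×ˢ
    degreeLE n (2 * d.degree + 2 * Fintype.card J)).image fun p => exps p.1 p.2 d).finite_toSet.subset
    fun m hm => ?_
  obtain ⟨α₁, h₁, α₂, h₂, rfl⟩ := gaussTerm_support F τu τubar d hm
  exact Finset.mem_coe.2 (Finset.mem_image.2 ⟨(α₁, α₂), Finset.mk_mem_product h₁ h₂, rfl⟩)

/-- Invertibility of `A` lets the prefactor cancel the inverse determinant in the Gaussian integral.
-/
lemma coeff_unnormCorr (hA : IsUnit (linMatrix F)) (τu : I → Fin n) (τubar : J → Fin n)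
    (d : Fin n →₀ ℕ) :
    MvPowerSeries.coeff d (unnormCorr F τu τubar) =
      ∑ α₁ ∈ degreeLE n (2 * d.degree + 2 * Fintype.card J),
        ∑ α₂ ∈ degreeLE n (2 * d.degree + 2 * Fintype.card J),
          MvPowerSeries.coeff (exps α₁ α₂ d) (corrIntegrand F τu τubar) *
            wickMonomial (linMatrix F) α₁ α₂ := by
  classical
  set D := degreeLE n (2 * d.degree + 2 * Fintype.card J) with hD
  have hdet : (linMatrix F).det * Ring.inverse (linMatrix F).det = 1 :=
    Ring.mul_inverse_cancel _ ((Matrix.isUnit_iff_isUnit_det _).1 hA)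
  have hinj : Set.InjOn (fun p : (Fin n →₀ ℕ) × (Fin n →₀ ℕ) => exps p.1 p.2 d) (D ×ˢ D : Finset _) := by
    rintro ⟨α₁, α₂⟩ - ⟨β₁, β₂⟩ - h
    obtain ⟨rfl, rfl, -⟩ := exps_inj.1 h
    rfl
  rw [unnormCorr, MvPowerSeries.coeff_C_mul, gaussIntegral, coeff_familySum,
    finsum_eq_sum_of_support_subset (s := (D ×ˢ D).image fun p => exps p.1 p.2 d),
    Finset.sum_image hinj, Finset.sum_product, Finset.mul_sum]
  · refine Finset.sum_congr rfl fun α₁ _ => ?_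
    rw [Finset.mul_sum]
    refine Finset.sum_congr rfl fun α₂ _ => ?_
    rw [coeff_gaussTerm, if_pos rfl]
    linear_combination (MvPowerSeries.coeff (exps α₁ α₂ d) (corrIntegrand F τu τubar) *
      wickMonomial (linMatrix F) α₁ α₂) * hdet
  · intro m hm
    obtain ⟨α₁, h₁, α₂, h₂, rfl⟩ := gaussTerm_support F τu τubar d hm
    exact Finset.mem_coe.2 (Finset.mem_image.2 ⟨(α₁, α₂), Finset.mk_mem_product h₁ h₂, rfl⟩)

/-- The unnormalized correlation functions are sums over diagrams. -/
lemma unnormCorr_eq (hA : IsUnit (linMatrix F)) (τu : I → Fin n) (τubar : J → Fin n) :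
    unnormCorr F τu τubar = evalOne R n (totalSeries F τu τubar) := by
  classical
  ext d
  rw [totalSeries, coeff_evalOne_genSeries, coeff_unnormCorr F hA]
  set B := 2 * d.degree + 2 * Fintype.card J with hB
  -- `B` bounds the degrees in `ū` and in `u`, so `M` bounds the total degree of every monomial that
  -- occurs.
  set M := 2 * B + d.degree with hM
  have h1 : ∀ α₁ ∈ degreeLE n B, ∀ α₂ ∈ degreeLE n B,
      MvPowerSeries.coeff (exps α₁ α₂ d) (corrIntegrand F τu τubar) *
            wickMonomial (linMatrix F) α₁ α₂ =
        ∑ N ∈ Finset.range (M + 1), ((N.factorial : ℚ)⁻¹) •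
          ∑ a : Fin N → Fin n, ∑ β ∈ Fintype.piFinset fun _ : Fin N => degreeLE n M,
            if ubarExponent τubar a = α₁ ∧ uExponent τu β = α₂ then
              MvPowerSeries.coeff d (∏ v, vertexCoeff F (a v) (β v)) *
              wickMonomial (linMatrix F) (ubarExponent τubar a) (uExponent τu β) else 0 := by
    intro α₁ h₁ α₂ h₂
    rw [mem_degreeLE] at h₁ h₂
    rw [coeff_corrIntegrand F τu τubar (M := M) (by rw [degree_exps]; omega), Finset.sum_mul]
    refine Finset.sum_congr rfl fun N _ => ?_
    rw [smul_mul_assoc, Finset.sum_mul]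
    congr 1
    refine Finset.sum_congr rfl fun a _ => ?_
    rw [Finset.sum_mul]
    refine Finset.sum_congr rfl fun β _ => ?_
    split_ifs with h
    · rw [h.1, h.2]
    · rw [zero_mul]
  rw [Finset.sum_congr rfl fun α₁ h₁ => Finset.sum_congr rfl fun α₂ h₂ => h1 α₁ h₁ α₂ h₂]
  -- The pair `(a, β)` determines `α₁` and `α₂`; should they exceed the bound `B`, the summand is
  -- zero by the half-line count.
  have h2 : ∀ (N : ℕ) (a : Fin N → Fin n) (β : Fin N → Fin n →₀ ℕ),
      (∑ α₁ ∈ degreeLE n B, ∑ α₂ ∈ degreeLE n B,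
        if ubarExponent τubar a = α₁ ∧ uExponent τu β = α₂ then
              MvPowerSeries.coeff d (∏ v, vertexCoeff F (a v) (β v)) *
              wickMonomial (linMatrix F) (ubarExponent τubar a) (uExponent τu β) else 0) =
        MvPowerSeries.coeff d (∏ v, vertexCoeff F (a v) (β v)) *
              wickMonomial (linMatrix F) (ubarExponent τubar a) (uExponent τu β) := by
    intro N a β
    simp only [ite_and, Finset.sum_ite_irrel, Finset.sum_ite_eq, Finset.sum_const_zero]
    by_contra hne
    have h0 : MvPowerSeries.coeff d (∏ v, vertexCoeff F (a v) (β v)) *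
              wickMonomial (linMatrix F) (ubarExponent τubar a) (uExponent τu β) ≠ 0 := by
      intro h0
      rw [h0] at hne
      simp at hne
    have h3 := card_le_of_mul_wickMonomial_ne_zero F h0
    have h4 := degree_eq_of_wickMonomial_ne_zero (right_ne_zero_of_mul h0)
    rw [Fintype.card_fin] at h3
    have h5 : (ubarExponent τubar a).degree = Fintype.card J + N := by
      rw [degree_ubarExponent, Fintype.card_fin]
    rw [if_pos (mem_degreeLE.2 (by omega)), if_pos (mem_degreeLE.2 (by omega))] at hne
    exact hne rfl
  have h3 : ∀ N, N ∈ Finset.range (2 * d.degree + Fintype.card J + 1) →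
      MvPowerSeries.coeff d (((N.factorial : ℚ)⁻¹) •
        totalSum (propagator F) (vertexFactor F) τu τubar (Fin N)) =
      ((N.factorial : ℚ)⁻¹) • ∑ a : Fin N → Fin n,
        ∑ β ∈ Fintype.piFinset fun _ : Fin N => degreeLE n M,
          MvPowerSeries.coeff d (∏ v, vertexCoeff F (a v) (β v)) *
              wickMonomial (linMatrix F) (ubarExponent τubar a) (uExponent τu β) := by
    intro N hN
    rw [Finset.mem_range] at hN
    rw [coeff_rat_smul, ← sum_vertexCoeff_mul_wickMonomial F τu τubar (degreeLE n M) (fun β hβ =>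
      mem_degreeLE.2 (by rw [Fintype.card_fin] at hβ; omega))]
    simp only [map_sum, MvPowerSeries.coeff_mul_C]
    congr 1
    exact Finset.sum_equiv (Equiv.refl _) (by simp) fun a _ =>
      Finset.sum_equiv (Equiv.refl _) (by simp) fun β _ => rfl
  rw [Finset.sum_congr rfl h3]
  -- The orders `N` between the bound of `genSeries` and `M` contribute nothing.
  refine Eq.trans ?_ (Finset.sum_subset (s₂ := Finset.range (M + 1))
    (Finset.range_subset_range.2 (by omega)) fun N _ hN => ?_).symm
  · simp only [Finset.sum_comm (s := degreeLE n B) (t := Finset.range (M + 1)), ← Finset.smul_sum]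
    refine Finset.sum_congr rfl fun N _ => ?_
    congr 1
    simp only [Finset.sum_comm (s := degreeLE n B) (t := Finset.univ)]
    refine Finset.sum_congr rfl fun a _ => ?_
    simp only [Finset.sum_comm (s := degreeLE n B)
      (t := Fintype.piFinset fun _ : Fin N => degreeLE n M), h2]
  · rw [Finset.sum_eq_zero, smul_zero]
    intro a _
    refine Finset.sum_eq_zero fun β _ => ?_
    by_contra h0
    have := card_le_of_mul_wickMonomial_ne_zero F h0
    rw [Fintype.card_fin] at this
    exact hN (Finset.mem_range.2 (by omega))

lemma corrIntegrand_of_isEmpty [IsEmpty I] [IsEmpty J] (τu : I → Fin n) (τubar : J → Fin n) :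
    corrIntegrand F τu τubar = expInteraction F := by
  simp [corrIntegrand]

end Integral

end Coefficients

end

end FeynmanCluster

namespace FeynmanCluster

noncomputable section

/-! ### Feynman diagrams and reduced diagrams -/

section ToFeynman

variable {I J V V' E E' : Type*}

/-- The arities of a reduced diagram that comes from a Feynman diagram. -/
def IsValid (φ : J ⊕ V → I ⊕ V) : Prop :=
  (∀ i, ∃! x, φ x = Sum.inl i) ∧ ∀ v, Nat.card {x // φ x = Sum.inr v} ≠ 1

/-- The node to which a half-line belongs; `Sum.inl x` is the `ū`-half-line of `x` and `Sum.inr x`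
the `u`-half-line with which it is contracted. -/
def owner (φ : J ⊕ V → I ⊕ V) : (J ⊕ V) ⊕ (J ⊕ V) → I ⊕ (J ⊕ V) :=
  Sum.elim Sum.inr fun x => headNode J (φ x)

/-- The `ū`-half-line contracted with the external `u`-half-line `i`. -/
def rootOf {φ : J ⊕ V → I ⊕ V} (hv : IsValid φ) (i : I) : J ⊕ V := (hv.1 i).choose

lemma apply_eq_inl_iff {φ : J ⊕ V → I ⊕ V} (hv : IsValid φ) (i : I) (x : J ⊕ V) :
    φ x = Sum.inl i ↔ x = rootOf hv i :=
  ⟨fun h => (hv.1 i).choose_spec.2 x h, fun h => h ▸ (hv.1 i).choose_spec.1⟩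

lemma apply_rootOf {φ : J ⊕ V → I ⊕ V} (hv : IsValid φ) (i : I) : φ (rootOf hv i) = Sum.inl i :=
  (hv.1 i).choose_spec.1

lemma headNode_eq_inl_iff {t : I ⊕ V} {i : I} : headNode J t = Sum.inl i ↔ t = Sum.inl i := by
  rcases t with i' | v <;> simp [headNode]

lemma headNode_eq_inr_iff {t : I ⊕ V} {v : V} :
    headNode J t = Sum.inr (Sum.inr v) ↔ t = Sum.inr v := by
  rcases t with i' | v <;> simp [headNode]

/-- The exchange of the two ends of each contraction. -/
def swapEnds (h : (J ⊕ V) ⊕ (J ⊕ V) ≃ E) : E ≃ E :=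
  h.symm.trans ((Equiv.sumComm _ _).trans h)

lemma swapEnds_apply (h : (J ⊕ V) ⊕ (J ⊕ V) ≃ E) (p : (J ⊕ V) ⊕ (J ⊕ V)) :
    swapEnds h (h p) = h p.swap := by
  simp [swapEnds]

variable [Fintype E]

open Classical in
/-- The half-lines of a node. -/
def nodeBlock (φ : J ⊕ V → I ⊕ V) (h : (J ⊕ V) ⊕ (J ⊕ V) ≃ E) (w : I ⊕ (J ⊕ V)) : Finset E :=
  Finset.univ.filter fun e => owner φ (h.symm e) = w

lemma mem_nodeBlock {φ : J ⊕ V → I ⊕ V} {h : (J ⊕ V) ⊕ (J ⊕ V) ≃ E} {w : I ⊕ (J ⊕ V)}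
    {p : (J ⊕ V) ⊕ (J ⊕ V)} : h p ∈ nodeBlock φ h w ↔ owner φ p = w := by
  simp [nodeBlock]

/-- An external `u`-node owns a half-line only if something is contracted with it, which validity
guarantees. Hence node blocks are nonempty and determine their nodes. -/
lemma owner_surjective {φ : J ⊕ V → I ⊕ V} (hv : IsValid φ) : Function.Surjective (owner φ) := by
  rintro (i | x)
  · exact ⟨Sum.inr (rootOf hv i), by simp [owner, apply_rootOf, headNode]⟩
  · exact ⟨Sum.inl x, rfl⟩

lemma nodeBlock_nonempty {φ : J ⊕ V → I ⊕ V} (hv : IsValid φ) (h : (J ⊕ V) ⊕ (J ⊕ V) ≃ E)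
    (w : I ⊕ (J ⊕ V)) : (nodeBlock φ h w).Nonempty := by
  obtain ⟨p, hp⟩ := owner_surjective hv w
  exact ⟨h p, mem_nodeBlock.2 hp⟩

lemma nodeBlock_injective {φ : J ⊕ V → I ⊕ V} (hv : IsValid φ) (h : (J ⊕ V) ⊕ (J ⊕ V) ≃ E) :
    Function.Injective (nodeBlock φ h) := by
  intro w w' hw
  obtain ⟨p, hp⟩ := owner_surjective hv w
  have : h p ∈ nodeBlock φ h w' := hw ▸ mem_nodeBlock.2 hp
  rw [← hp, mem_nodeBlock.1 this]

lemma disjoint_nodeBlock (φ : J ⊕ V → I ⊕ V) (h : (J ⊕ V) ⊕ (J ⊕ V) ≃ E)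
    {w w' : I ⊕ (J ⊕ V)} (hw : w ≠ w') : Disjoint (nodeBlock φ h w) (nodeBlock φ h w') := by
  refine Finset.disjoint_left.2 fun e he he' => ?_
  obtain ⟨p, rfl⟩ := h.surjective e
  exact hw ((mem_nodeBlock.1 he).symm.trans (mem_nodeBlock.1 he'))

/-- The `ū`-half-lines. -/
def tails (h : (J ⊕ V) ⊕ (J ⊕ V) ≃ E) : Finset E :=
  Finset.univ.filter fun e => (h.symm e).isLeft

/-- The `u`-half-lines. -/
def heads (h : (J ⊕ V) ⊕ (J ⊕ V) ≃ E) : Finset E :=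
  Finset.univ.filter fun e => (h.symm e).isRight

lemma mem_tails {h : (J ⊕ V) ⊕ (J ⊕ V) ≃ E} {p} : h p ∈ tails h ↔ p.isLeft := by simp [tails]

lemma mem_heads {h : (J ⊕ V) ⊕ (J ⊕ V) ≃ E} {p} : h p ∈ heads h ↔ p.isRight := by simp [heads]

open Classical in
/-- The half-lines of the interaction vertices. -/
def internals (φ : J ⊕ V → I ⊕ V) (h : (J ⊕ V) ⊕ (J ⊕ V) ≃ E) : Finset E :=
  Finset.univ.filter fun e => ∃ v, owner φ (h.symm e) = Sum.inr (Sum.inr v)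

lemma mem_internals {φ : J ⊕ V → I ⊕ V} {h : (J ⊕ V) ⊕ (J ⊕ V) ≃ E} {p} :
    h p ∈ internals φ h ↔ ∃ v, owner φ p = Sum.inr (Sum.inr v) := by
  simp [internals]

variable [DecidableEq E]

lemma nodeBlock_inter_tails (φ : J ⊕ V → I ⊕ V) (h : (J ⊕ V) ⊕ (J ⊕ V) ≃ E) (x : J ⊕ V) :
    nodeBlock φ h (Sum.inr x) ∩ tails h = {h (Sum.inl x)} := by
  ext e
  obtain ⟨p, rfl⟩ := h.surjective e
  rcases p with y | y <;> simp [mem_nodeBlock, mem_tails, owner]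

variable [Fintype J] [Fintype V]

open Classical in
lemma nodeBlock_inter_heads (φ : J ⊕ V → I ⊕ V) (h : (J ⊕ V) ⊕ (J ⊕ V) ≃ E) (v : V) :
    nodeBlock φ h (Sum.inr (Sum.inr v)) ∩ heads h =
      (Finset.univ.filter fun x => φ x = Sum.inr v).map
        (Function.Embedding.inr.trans h.toEmbedding) := by
  ext e
  obtain ⟨p, rfl⟩ := h.surjective e
  rcases p with y | y <;> simp [mem_nodeBlock, mem_heads, owner, headNode_eq_inr_iff]

open Classical in
/-- The Feynman diagram of a reduced diagram. -/
def toFeynman (φ : J ⊕ V → I ⊕ V) (hv : IsValid φ) (h : (J ⊕ V) ⊕ (J ⊕ V) ≃ E) :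
    Feynman I J E where
  Eubar := tails h
  Eu := heads h
  Eint := internals φ h
  Eext := (internals φ h)ᶜ
  piH := (Finset.univ.filter fun v => ∃ x, φ x = Sum.inr v).image
    fun v => nodeBlock φ h (Sum.inr (Sum.inr v))
  piY := (Finset.univ.filter fun v => ¬ ∃ x, φ x = Sum.inr v).image
    fun v => nodeBlock φ h (Sum.inr (Sum.inr v))
  rhoU i := h (Sum.inr (rootOf hv i))
  rhoUbar j := h (Sum.inl (Sum.inl j))
  disjoint_u_ubar := by
    refine Finset.disjoint_left.2 fun e he he' => ?_
    obtain ⟨p, rfl⟩ := h.surjective e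
    rw [mem_heads] at he
    rw [mem_tails] at he'
    rcases p with x | x <;> simp at he he'
  union_u_ubar := by
    ext e
    obtain ⟨p, rfl⟩ := h.surjective e
    rcases p with x | x <;> simp [mem_heads, mem_tails]
  disjoint_int_ext := disjoint_compl_right
  union_int_ext := Finset.union_compl _
  bijOn_rhoU := by
    refine ⟨fun i _ => ?_, fun i _ i' _ hi => ?_, fun e he => ?_⟩
    · simp [mem_heads, mem_internals, owner, apply_rootOf, headNode]
    · have h1 := Sum.inr_injective (h.injective hi)
      exact Sum.inl_injective (by rw [← apply_rootOf hv i, h1, apply_rootOf hv i'])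
    · obtain ⟨p, rfl⟩ := h.surjective e
      rcases p with x | x
      · simp [mem_heads] at he
      · simp only [Finset.coe_inter, Set.mem_inter_iff, Finset.mem_coe, Finset.mem_compl,
          mem_internals, owner, Sum.elim_inr, headNode_eq_inr_iff] at he
        rcases hx : φ x with i | v
        · exact ⟨i, trivial, by rw [(apply_eq_inl_iff hv i x).1 hx]⟩
        · exact absurd ⟨v, hx⟩ he.1
  bijOn_rhoUbar := by
    refine ⟨fun i _ => ?_, fun i _ i' _ hi => ?_, fun e he => ?_⟩
    · simp [mem_tails, mem_internals, owner]
    · exact Sum.inl_injective (Sum.inl_injective (h.injective hi))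
    · obtain ⟨p, rfl⟩ := h.surjective e
      rcases p with (j | v) | x
      · exact ⟨j, trivial, rfl⟩
      · simp [mem_tails, mem_internals, owner] at he
      · simp [mem_tails] at he
  disjoint_piH_piY := by
    refine Finset.disjoint_left.2 fun B hB hB' => ?_
    obtain ⟨v, hv1, rfl⟩ := Finset.mem_image.1 hB
    obtain ⟨v', hv2, heq⟩ := Finset.mem_image.1 hB'
    obtain rfl : v' = v := by simpa using nodeBlock_injective hv h heq
    exact (Finset.mem_filter.1 hv2).2 (Finset.mem_filter.1 hv1).2
  blocks_nonempty := by
    intro B hB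
    rw [← Finset.image_union] at hB
    obtain ⟨v, -, rfl⟩ := Finset.mem_image.1 hB
    exact nodeBlock_nonempty hv h _
  blocks_disjoint := by
    intro B hB B' hB' hne
    rw [← Finset.image_union] at hB hB'
    obtain ⟨v, -, rfl⟩ := Finset.mem_image.1 hB
    obtain ⟨v', -, rfl⟩ := Finset.mem_image.1 hB'
    exact disjoint_nodeBlock φ h fun h' => hne (by rw [h'])
  blocks_cover := by
    rw [← Finset.image_union, Finset.filter_union_filter_not_eq]
    ext e
    obtain ⟨p, rfl⟩ := h.surjective e
    simp [mem_internals, mem_nodeBlock]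
  card_ubar_piH := by
    intro B hB
    obtain ⟨v, -, rfl⟩ := Finset.mem_image.1 hB
    rw [nodeBlock_inter_tails, Finset.card_singleton]
  card_u_piH := by
    intro B hB
    obtain ⟨v, hv', rfl⟩ := Finset.mem_image.1 hB
    rw [nodeBlock_inter_heads, Finset.card_map]
    -- An arity that is neither `0` nor `1` is at least `2`.
    have h1 := hv.2 v
    rw [Nat.card_eq_fintype_card, Fintype.card_subtype] at h1
    obtain ⟨x, hx⟩ := (Finset.mem_filter.1 hv').2
    have h2 : 0 < (Finset.univ.filter fun x => φ x = Sum.inr v).card :=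
      Finset.card_pos.2 ⟨x, Finset.mem_filter.2 ⟨Finset.mem_univ _, hx⟩⟩
    omega
  card_ubar_piY := by
    intro B hB
    obtain ⟨v, -, rfl⟩ := Finset.mem_image.1 hB
    rw [nodeBlock_inter_tails, Finset.card_singleton]
  inter_u_piY := by
    intro B hB
    obtain ⟨v, hv', rfl⟩ := Finset.mem_image.1 hB
    rw [nodeBlock_inter_heads, Finset.map_eq_empty]
    have := (Finset.mem_filter.1 hv').2
    exact Finset.filter_eq_empty_iff.2 fun x _ hx => this ⟨x, hx⟩
  contr := (swapEnds h).subtypeEquiv fun e => by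
    obtain ⟨p, rfl⟩ := h.surjective e
    rw [swapEnds_apply, mem_tails, mem_heads]
    rcases p with x | x <;> simp

variable [Fintype V'] [Fintype E'] [DecidableEq E']

lemma toFeynman_contr {φ : J ⊕ V → I ⊕ V} (hv : IsValid φ) (h : (J ⊕ V) ⊕ (J ⊕ V) ≃ E)
    (x : J ⊕ V) (e : (toFeynman φ hv h).Eubar) (he : (e : E) = h (Sum.inl x)) :
    ((toFeynman φ hv h).contr e : E) = h (Sum.inr x) := by
  change swapEnds h e = _
  rw [he, swapEnds_apply]
  rfl

open Classical in
lemma mem_piH_union_piY_toFeynman {φ : J ⊕ V → I ⊕ V} (hv : IsValid φ)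
    (h : (J ⊕ V) ⊕ (J ⊕ V) ≃ E) (B : Finset E) :
    B ∈ (toFeynman φ hv h).piH ∪ (toFeynman φ hv h).piY ↔
      ∃ v, nodeBlock φ h (Sum.inr (Sum.inr v)) = B := by
  rw [toFeynman, ← Finset.image_union, Finset.filter_union_filter_not_eq]
  simp

end ToFeynman

end

end FeynmanCluster

namespace FeynmanCluster

noncomputable section

/-! ### Isomorphisms of Feynman diagrams as relabellings of vertices -/

section Isomorphisms

variable {I J V V' E E' : Type*}

/-- The relabelling of half-lines induced by a relabelling of the vertices. -/
def liftEquiv (J : Type*) (e : V ≃ V') : (J ⊕ V) ⊕ (J ⊕ V) ≃ (J ⊕ V') ⊕ (J ⊕ V') :=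
  Equiv.sumCongr (Equiv.sumCongr (Equiv.refl J) e) (Equiv.sumCongr (Equiv.refl J) e)

/-- A relabelling of the vertices that takes `φ` to `φ'`. -/
def Intertwines (φ : J ⊕ V → I ⊕ V) (φ' : J ⊕ V' → I ⊕ V') (e : V ≃ V') : Prop :=
  ∀ x, φ' (Sum.map id e x) = Sum.map id e (φ x)

/-- Relabelling of the nodes of a diagram along `e`. -/
def nodeMap (I J : Type*) (e : V ≃ V') : I ⊕ (J ⊕ V) ≃ I ⊕ (J ⊕ V') :=
  nodeEquiv (Equiv.refl I) (Equiv.refl J) e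

lemma Intertwines.owner_liftEquiv {φ : J ⊕ V → I ⊕ V} {φ' : J ⊕ V' → I ⊕ V'} {e : V ≃ V'}
    (he : Intertwines φ φ' e) (p : (J ⊕ V) ⊕ (J ⊕ V)) :
    owner φ' (liftEquiv J e p) = nodeMap I J e (owner φ p) := by
  rcases p with (j | v) | x
  · rfl
  · rfl
  · have h1 := he x
    have h2 : ∀ t : I ⊕ V, headNode J (Sum.map id e t) = nodeMap I J e (headNode J t) := by
      rintro (i | v) <;> rfl
    change headNode J (φ' (Sum.map id e x)) = nodeMap I J e (headNode J (φ x))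
    rw [h1, h2]

variable [Fintype E] [Fintype E'] [DecidableEq E']

lemma Intertwines.image_nodeBlock {φ : J ⊕ V → I ⊕ V} {φ' : J ⊕ V' → I ⊕ V'} {e : V ≃ V'}
    (he : Intertwines φ φ' e) {h : (J ⊕ V) ⊕ (J ⊕ V) ≃ E} {h' : (J ⊕ V') ⊕ (J ⊕ V') ≃ E'}
    {σ : E ≃ E'} (hσ : ∀ p, σ (h p) = h' (liftEquiv J e p)) (w : I ⊕ (J ⊕ V)) :
    (nodeBlock φ h w).image σ = nodeBlock φ' h' (nodeMap I J e w) := by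
  ext e'
  obtain ⟨e₀, rfl⟩ := σ.surjective e'
  obtain ⟨p, rfl⟩ := h.surjective e₀
  rw [σ.injective.mem_finset_image, hσ, mem_nodeBlock, mem_nodeBlock, he.owner_liftEquiv,
    EmbeddingLike.apply_eq_iff_eq]

variable [Fintype J] [Fintype V] [Fintype V'] [DecidableEq E]

/-- All parts of the structure are expressed through the owner and the type of a half-line and the
two ends of a contraction, and each of these is compatible with the relabelling. -/
lemma Intertwines.isTransport {φ : J ⊕ V → I ⊕ V} {φ' : J ⊕ V' → I ⊕ V'} {e : V ≃ V'}
    (he : Intertwines φ φ' e) (hv : IsValid φ) (hv' : IsValid φ')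
    {h : (J ⊕ V) ⊕ (J ⊕ V) ≃ E} {h' : (J ⊕ V') ⊕ (J ⊕ V') ≃ E'}
    {σ : E ≃ E'} (hσ : ∀ p, σ (h p) = h' (liftEquiv J e p)) :
    Feynman.IsTransport σ (toFeynman φ hv h) (toFeynman φ' hv' h') := by
  classical
  have key : ∀ {s : Finset E} {s' : Finset E'}, (∀ p, h' (liftEquiv J e p) ∈ s' ↔ h p ∈ s) →
      s' = s.image σ := by
    intro s s' hs
    ext e'
    obtain ⟨e₀, rfl⟩ := σ.surjective e'
    obtain ⟨p, rfl⟩ := h.surjective e₀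
    rw [σ.injective.mem_finset_image, hσ, hs]
  have hint : ∀ p, h' (liftEquiv J e p) ∈ internals φ' h' ↔ h p ∈ internals φ h := by
    intro p
    rw [mem_internals, mem_internals, he.owner_liftEquiv, e.surjective.exists]
    exact exists_congr fun v => (nodeMap I J e).apply_eq_iff_eq (y := Sum.inr (Sum.inr v))
  have hblock : ∀ v, (nodeBlock φ h (Sum.inr (Sum.inr v))).image σ =
      nodeBlock φ' h' (Sum.inr (Sum.inr (e v))) := fun v => he.image_nodeBlock hσ _
  have hex : ∀ v, (∃ x, φ' x = Sum.inr (e v)) ↔ ∃ x, φ x = Sum.inr v := by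
    intro v
    rw [(Equiv.sumCongr (Equiv.refl J) e).surjective.exists]
    refine exists_congr fun x => ?_
    rw [show φ' (Equiv.sumCongr (Equiv.refl J) e x) = Sum.map id e (φ x) from he x]
    rcases φ x with i | w <;> simp
  exact
    { Eubar_eq := key fun p => by
        rw [toFeynman, toFeynman, mem_tails, mem_tails]
        rcases p with x | x <;> rfl
      Eu_eq := key fun p => by
        rw [toFeynman, toFeynman, mem_heads, mem_heads]
        rcases p with x | x <;> rfl
      Eint_eq := key hint
      Eext_eq := key fun p => by
        rw [toFeynman, toFeynman, Finset.mem_compl, Finset.mem_compl, hint]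
      piH_eq := by
        ext B
        simp only [toFeynman, Finset.mem_image, Finset.mem_filter, Finset.mem_univ, true_and,
          exists_exists_and_eq_and, hblock]
        rw [e.surjective.exists]
        simp only [hex]
      piY_eq := by
        ext B
        simp only [toFeynman, Finset.mem_image, Finset.mem_filter, Finset.mem_univ, true_and,
          exists_exists_and_eq_and, hblock]
        rw [e.surjective.exists]
        simp only [hex]
      rhoU_eq := by
        funext i
        change h' _ = σ (h _)
        rw [hσ]
        refine congrArg h' (congrArg Sum.inr ?_)
        refine ((apply_eq_inl_iff hv' i _).1 ?_).symm
        refine (he (rootOf hv i)).trans ?_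
        rw [apply_rootOf hv i]
        rfl
      rhoUbar_eq := by
        funext j
        change h' _ = σ (h _)
        rw [hσ]
        rfl
      contr_eq := by
        intro x x' hx
        obtain ⟨p, hp⟩ := h.surjective x
        obtain ⟨y, rfl⟩ : ∃ y, p = Sum.inl y := by
          rcases p with y | y
          · exact ⟨y, rfl⟩
          · have h1 := x.2
            rw [← hp, toFeynman, mem_tails] at h1
            simp at h1
        rw [toFeynman_contr hv h y x hp.symm, hσ]
        refine toFeynman_contr hv' h' _ x' ?_
        rw [hx, ← hp, hσ]
        rfl }

/-- An isomorphism permutes `ū`-half-lines by some `ε`, and the contractions force the same `ε` on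
`u`-half-lines. The external `ū`-half-lines are fixed, so `ε` is the identity on `J` and a bijection
`e` on vertices. Preservation of `ρ_u` and of the blocks then says that `e` intertwines the owner
maps. -/
lemma exists_intertwines {φ : J ⊕ V → I ⊕ V} {φ' : J ⊕ V' → I ⊕ V'} (hv : IsValid φ)
    (hv' : IsValid φ') {h : (J ⊕ V) ⊕ (J ⊕ V) ≃ E} {h' : (J ⊕ V') ⊕ (J ⊕ V') ≃ E'}
    {σ : E ≃ E'} (ht : Feynman.IsTransport σ (toFeynman φ hv h) (toFeynman φ' hv' h')) :
    ∃ e : V ≃ V', Intertwines φ φ' e ∧ ∀ p, σ (h p) = h' (liftEquiv J e p) := by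
  classical
  have h1 : ∀ x, ∃ y, σ (h (Sum.inl x)) = h' (Sum.inl y) := by
    intro x
    have hm : σ (h (Sum.inl x)) ∈ tails h' := by
      rw [show tails h' = (tails h).image σ from ht.Eubar_eq]
      exact Finset.mem_image_of_mem _ (mem_tails.2 rfl)
    obtain ⟨p, hp⟩ := h'.surjective (σ (h (Sum.inl x)))
    rcases p with y | y
    · exact ⟨y, hp.symm⟩
    · rw [← hp, mem_tails] at hm
      simp at hm
  choose ε hε using h1
  have hε' : ∀ x, σ (h (Sum.inr x)) = h' (Sum.inr (ε x)) := by
    intro x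
    have hm : h (Sum.inl x) ∈ tails h := mem_tails.2 rfl
    have hm' : h' (Sum.inl (ε x)) ∈ tails h' := mem_tails.2 rfl
    have := ht.contr_eq ⟨_, hm⟩ ⟨_, hm'⟩ (hε x).symm
    rw [toFeynman_contr hv h x _ rfl, toFeynman_contr hv' h' (ε x) _ rfl] at this
    exact this.symm
  have hεJ : ∀ j, ε (Sum.inl j) = Sum.inl j := fun j => by
    have h2 : h' (Sum.inl (Sum.inl j)) = σ (h (Sum.inl (Sum.inl j))) := congrFun ht.rhoUbar_eq j
    rw [hε] at h2
    exact (Sum.inl_injective (h'.injective h2)).symm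
  have hεinj : Function.Injective ε := fun x y hxy => by
    have : σ (h (Sum.inl x)) = σ (h (Sum.inl y)) := by rw [hε, hε, hxy]
    exact Sum.inl_injective (h.injective (σ.injective this))
  have hεV : ∀ v, ∃ v', ε (Sum.inr v) = Sum.inr v' := fun v => by
    rcases hv : ε (Sum.inr v) with j | v'
    · rw [← hεJ j] at hv
      exact absurd (hεinj hv) (by simp)
    · exact ⟨v', rfl⟩
  choose e₀ he₀ using hεV
  have hbij : Function.Bijective e₀ := by
    refine ⟨fun v w hvw => ?_, fun v' => ?_⟩
    · exact Sum.inr_injective (hεinj (by rw [he₀, he₀, hvw]))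
    · obtain ⟨x, hx⟩ := σ.surjective (h' (Sum.inl (Sum.inr v')))
      obtain ⟨p, rfl⟩ := h.surjective x
      rcases p with (j | v) | x
      · rw [hε, hεJ] at hx
        simp at hx
      · rw [hε, he₀] at hx
        exact ⟨v, by simpa using hx⟩
      · rw [hε'] at hx
        simp at hx
  set e := Equiv.ofBijective e₀ hbij with he
  have hεe : ∀ x, ε x = Sum.map id e x := by
    rintro (j | v)
    · exact hεJ j
    · exact he₀ v
  have hσ : ∀ p, σ (h p) = h' (liftEquiv J e p) := by
    rintro (x | x)
    · rw [hε, hεe]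
      rfl
    · rw [hε', hεe]
      rfl
  refine ⟨e, fun x => ?_, hσ⟩
  rcases hx : φ x with i | v
  · have h2 : h' (Sum.inr (rootOf hv' i)) = σ (h (Sum.inr (rootOf hv i))) :=
      congrFun ht.rhoU_eq i
    rw [← (apply_eq_inl_iff hv i x).1 hx, hε', hεe] at h2
    rw [← Sum.inr_injective (h'.injective h2), apply_rootOf hv' i]
    rfl
  -- The image of the block of `v` is a block of some `v'`; its `ū`-half-line identifies `v'` as `e
  -- v`, its `u`-half-line `x` gives the value of `φ'`.
  · have hB : (nodeBlock φ h (Sum.inr (Sum.inr v))).image σ ∈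
        (toFeynman φ' hv' h').piH ∪ (toFeynman φ' hv' h').piY := by
      rw [ht.piH_eq, ht.piY_eq, ← Finset.image_union]
      exact Finset.mem_image_of_mem _ ((mem_piH_union_piY_toFeynman hv h _).2 ⟨v, rfl⟩)
    obtain ⟨v', hv''⟩ := (mem_piH_union_piY_toFeynman hv' h' _).1 hB
    have h2 : σ (h (Sum.inl (Sum.inr v))) ∈ nodeBlock φ' h' (Sum.inr (Sum.inr v')) := by
      rw [hv'']
      exact Finset.mem_image_of_mem _ (mem_nodeBlock.2 rfl)
    have h3 : σ (h (Sum.inr x)) ∈ nodeBlock φ' h' (Sum.inr (Sum.inr v')) := by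
      rw [hv'']
      exact Finset.mem_image_of_mem _ (mem_nodeBlock.2 (headNode_eq_inr_iff.2 hx))
    rw [hε, he₀, mem_nodeBlock] at h2
    rw [hε', hεe, mem_nodeBlock] at h3
    rw [headNode_eq_inr_iff.1 h3]
    exact congrArg Sum.inr (Sum.inr_injective (Sum.inr_injective h2)).symm

end Isomorphisms

end

end FeynmanCluster

namespace FeynmanCluster

noncomputable section

/-! ### From Feynman diagrams to reduced diagrams -/

section Reduction

variable {I J E : Type*} [Fintype E] [DecidableEq E]

lemma Feynman.ext_of_eq {D D' : Feynman I J E} (h₁ : D.Eubar = D'.Eubar) (h₂ : D.Eu = D'.Eu)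
    (h₃ : D.Eint = D'.Eint) (h₄ : D.Eext = D'.Eext) (h₅ : D.piH = D'.piH) (h₆ : D.piY = D'.piY)
    (h₇ : D.rhoU = D'.rhoU) (h₈ : D.rhoUbar = D'.rhoUbar)
    (h₉ : ∀ (x : D.Eubar) (x' : D'.Eubar), (x : E) = x' → (D.contr x : E) = D'.contr x') :
    D = D' := by
  obtain ⟨⟨a, b, c, d, e, f, g, k⟩, m⟩ := D
  obtain ⟨⟨a', b', c', d', e', f', g', k'⟩, m'⟩ := D'
  dsimp only at *
  subst h₁ h₂ h₃ h₄ h₅ h₆ h₇ h₈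
  congr 1
  ext x
  exact h₉ x x rfl

/-- Every Feynman diagram comes from a reduced diagram. -/
lemma exists_eq_toFeynman [Fintype J] (D : Feynman I J E) :
    ∃ (N : ℕ) (φ : J ⊕ Fin N → I ⊕ Fin N) (hv : IsValid φ)
      (h : (J ⊕ Fin N) ⊕ (J ⊕ Fin N) ≃ E), D = toFeynman φ hv h := by
  classical
  -- A vertex is represented by its unique `ū`-half-line, so the vertices are numbered by the
  -- internal `ū`-half-lines.
  have e := (D.Eint ∩ D.Eubar).equivFin.symm
  set N := (D.Eint ∩ D.Eubar).card
  let tail : J ⊕ Fin N → E := Sum.elim D.rhoUbar fun v => (e v).1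
  have hdis : ∀ x, x ∈ D.Eint → x ∈ D.Eext → False := fun x h1 h2 =>
    Finset.disjoint_left.1 D.disjoint_int_ext h1 h2
  have hdis' : ∀ x, x ∈ D.Eu → x ∈ D.Eubar → False := fun x h1 h2 =>
    Finset.disjoint_left.1 D.disjoint_u_ubar h1 h2
  have hintext : ∀ x, x ∈ D.Eint ∨ x ∈ D.Eext := fun x => by
    rw [← Finset.mem_union, D.union_int_ext]
    exact Finset.mem_univ x
  have hall : ∀ x, x ∈ D.Eu ∨ x ∈ D.Eubar := fun x => by
    rw [← Finset.mem_union, D.union_u_ubar]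
    exact Finset.mem_univ x
  have hrhoUbar : ∀ j, D.rhoUbar j ∈ D.Eext ∩ D.Eubar := fun j => D.bijOn_rhoUbar.1 (Set.mem_univ j)
  have hrhoU : ∀ j, D.rhoU j ∈ D.Eext ∩ D.Eu := fun j => D.bijOn_rhoU.1 (Set.mem_univ j)
  have htail : ∀ x, tail x ∈ D.Eubar := by
    rintro (j | v)
    · exact (Finset.mem_inter.1 (hrhoUbar j)).2
    · exact (Finset.mem_inter.1 (e v).2).2
  have htailV : ∀ v, tail (Sum.inr v) ∈ D.Eint := fun v => (Finset.mem_inter.1 (e v).2).1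
  have htailJ : ∀ j, tail (Sum.inl j) ∈ D.Eext := fun j => (Finset.mem_inter.1 (hrhoUbar j)).1
  have htinj : Function.Injective tail := by
    rintro (j | v) (j' | v') hxy
    · exact congrArg Sum.inl (D.bijOn_rhoUbar.2.1 (Set.mem_univ j) (Set.mem_univ j') hxy)
    · exact (hdis _ (htailV v') (hxy ▸ htailJ j)).elim
    · exact (hdis _ (htailV v) (hxy ▸ htailJ j')).elim
    · exact congrArg Sum.inr (e.injective (Subtype.ext hxy))
  have htsurj : ∀ y ∈ D.Eubar, ∃ x, tail x = y := by
    intro y hy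
    rcases hintext y with h1 | h1
    · exact ⟨Sum.inr (e.symm ⟨y, Finset.mem_inter.2 ⟨h1, hy⟩⟩), by simp [tail]⟩
    · obtain ⟨j, -, hj⟩ := D.bijOn_rhoUbar.2.2 (Finset.mem_coe.2 (Finset.mem_inter.2 ⟨h1, hy⟩))
      exact ⟨Sum.inl j, hj⟩
  -- The `u`-half-lines are numbered through their contraction partners.
  let head : J ⊕ Fin N → E := fun x => D.contr ⟨tail x, htail x⟩
  have hhead : ∀ x, head x ∈ D.Eu := fun x => (D.contr ⟨tail x, htail x⟩).2
  have hhinj : Function.Injective head := fun x y hxy =>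
    htinj (congrArg Subtype.val (D.contr.injective (Subtype.ext hxy)))
  have hhsurj : ∀ y ∈ D.Eu, ∃ x, head x = y := by
    intro y hy
    obtain ⟨x, hx⟩ := htsurj _ (D.contr.symm ⟨y, hy⟩).2
    refine ⟨x, ?_⟩
    have : (⟨tail x, htail x⟩ : D.Eubar) = D.contr.symm ⟨y, hy⟩ := Subtype.ext hx
    simp [head, this]
  have hbij : Function.Bijective (Sum.elim tail head) := by
    constructor
    · rintro (x | x) (y | y) hxy
      · exact congrArg _ (htinj hxy)
      · exact (hdis' _ (hhead y) ((show tail x = head y from hxy) ▸ htail x)).elim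
      · exact (hdis' _ (hhead x) ((show tail y = head x from hxy.symm) ▸ htail y)).elim
      · exact congrArg _ (hhinj hxy)
    · intro y
      rcases hall y with hy | hy
      · obtain ⟨x, rfl⟩ := hhsurj y hy
        exact ⟨Sum.inr x, rfl⟩
      · obtain ⟨x, rfl⟩ := htsurj y hy
        exact ⟨Sum.inl x, rfl⟩
  let h : (J ⊕ Fin N) ⊕ (J ⊕ Fin N) ≃ E := Equiv.ofBijective _ hbij
  have hl : ∀ x, h (Sum.inl x) = tail x := fun _ => rfl
  have hr : ∀ x, h (Sum.inr x) = head x := fun _ => rfl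
  have hblockint : ∀ B ∈ D.piH ∪ D.piY, ∀ x ∈ B, x ∈ D.Eint := fun B hB x hx => by
    rw [← D.blocks_cover]
    exact Finset.mem_biUnion.2 ⟨B, hB, hx⟩
  have hblockubar : ∀ B ∈ D.piH ∪ D.piY, (B ∩ D.Eubar).card = 1 := fun B hB => by
    rcases Finset.mem_union.1 hB with h1 | h1
    · exact D.card_ubar_piH B h1
    · exact D.card_ubar_piY B h1
  have hblocktail : ∀ B ∈ D.piH ∪ D.piY, ∃ v, tail (Sum.inr v) ∈ B := fun B hB => by
    obtain ⟨y, hy⟩ := Finset.card_pos.1 (lt_of_lt_of_eq Nat.zero_lt_one (hblockubar B hB).symm)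
    obtain ⟨hyB, hyu⟩ := Finset.mem_inter.1 hy
    obtain ⟨x | v, rfl⟩ := htsurj y hyu
    · exact (hdis _ (hblockint B hB _ hyB) (htailJ x)).elim
    · exact ⟨v, hyB⟩
  have hblocktail' : ∀ B ∈ D.piH ∪ D.piY, ∀ v x, tail (Sum.inr v) ∈ B → tail x ∈ B →
      x = Sum.inr v := fun B hB v x h1 h2 =>
    htinj (Finset.card_le_one.1 (hblockubar B hB).le _ (Finset.mem_inter.2 ⟨h2, htail x⟩) _
      (Finset.mem_inter.2 ⟨h1, htail _⟩))
  have hblockuniq : ∀ B ∈ D.piH ∪ D.piY, ∀ B' ∈ D.piH ∪ D.piY, ∀ x, x ∈ B → x ∈ B' → B = B' :=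
    fun B hB B' hB' x hx hx' => by
      by_contra hne
      exact Finset.disjoint_left.1 (D.blocks_disjoint B hB B' hB' hne) hx hx'
  have hblockof : ∀ x ∈ D.Eint, ∃ B ∈ D.piH ∪ D.piY, x ∈ B := fun x hx => by
    rw [← D.blocks_cover] at hx
    simpa only [Finset.mem_biUnion, id] using hx
  -- The value of `φ` is the owner of `head x`: the external `i`, or the vertex whose block contains
  -- it.
  have hφ : ∀ x, ∃ t : I ⊕ Fin N, (∀ i, t = Sum.inl i ↔ D.rhoU i = head x) ∧
      ∀ v, ∀ B ∈ D.piH ∪ D.piY, tail (Sum.inr v) ∈ B → (t = Sum.inr v ↔ head x ∈ B) := by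
    intro x
    rcases hintext (head x) with h1 | h1
    · obtain ⟨B, hB, hxB⟩ := hblockof _ h1
      obtain ⟨v, hv⟩ := hblocktail B hB
      refine ⟨Sum.inr v, fun i => ⟨fun h' => by simp at h', fun h' => ?_⟩,
        fun v' B' hB' hv' => ⟨fun h' => ?_, fun h' => ?_⟩⟩
      · exact (hdis _ h1 (h' ▸ (Finset.mem_inter.1 (hrhoU i)).1)).elim
      · rw [← Sum.inr_injective h'] at hv'
        rwa [hblockuniq B' hB' B hB _ hv' hv]
      · obtain rfl := hblockuniq B' hB' B hB _ h' hxB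
        exact congrArg Sum.inr (Sum.inr_injective (hblocktail' _ hB v' (Sum.inr v) hv' hv))
    · obtain ⟨i, -, hi⟩ := D.bijOn_rhoU.2.2 (Finset.mem_coe.2 (Finset.mem_inter.2 ⟨h1, hhead x⟩))
      refine ⟨Sum.inl i, fun i' => ⟨fun h' => ?_, fun h' => ?_⟩,
        fun v B hB hv => ⟨fun h' => by simp at h', fun h' => ?_⟩⟩
      · rw [← Sum.inl_injective h', hi]
      · exact congrArg Sum.inl (D.bijOn_rhoU.2.1 (Set.mem_univ _) (Set.mem_univ _) (hi.trans h'.symm))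
      · exact (hdis _ (hblockint B hB _ h') h1).elim
  choose φ hφI hφV using hφ
  have hvalid : IsValid φ := by
    constructor
    · intro i
      obtain ⟨x, hx⟩ := hhsurj _ (Finset.mem_inter.1 (hrhoU i)).2
      refine ⟨x, (hφI x i).2 hx.symm, fun y hy => hhinj ?_⟩
      rw [hx, (hφI y i).1 hy]
    · intro v
      obtain ⟨B, hB, hvB⟩ := hblockof _ (htailV v)
      -- The arity of a block is the size of the fibre: at least two for an `H`-block and zero for a
      -- `Y`-block, hence never one.
      have hcard : (B ∩ D.Eu).card = Nat.card {x // φ x = Sum.inr v} := by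
        have : B ∩ D.Eu = (Finset.univ.filter fun x => φ x = Sum.inr v).map ⟨head, hhinj⟩ := by
          ext y
          simp only [Finset.mem_inter, Finset.mem_map, Finset.mem_filter, Finset.mem_univ,
            true_and, Function.Embedding.coeFn_mk, hφV _ v B hB hvB]
          constructor
          · rintro ⟨h1, h2⟩
            obtain ⟨x, rfl⟩ := hhsurj y h2
            exact ⟨x, h1, rfl⟩
          · rintro ⟨x, h1, rfl⟩
            exact ⟨h1, hhead x⟩
        rw [this, Finset.card_map, Nat.card_eq_fintype_card, Fintype.card_subtype]
      rw [← hcard]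
      rcases Finset.mem_union.1 hB with h1 | h1
      · have := D.card_u_piH B h1
        omega
      · rw [D.inter_u_piY B h1]
        simp
  have hblock : ∀ v, ∀ B ∈ D.piH ∪ D.piY, tail (Sum.inr v) ∈ B →
      nodeBlock φ h (Sum.inr (Sum.inr v)) = B := by
    intro v B hB hvB
    ext y
    obtain ⟨p, rfl⟩ := h.surjective y
    rw [mem_nodeBlock]
    rcases p with x | x
    · rw [hl]
      refine ⟨fun h' => ?_, fun h' => congrArg Sum.inr (hblocktail' B hB v x hvB h')⟩
      rw [Sum.inr_injective h']
      exact hvB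
    · rw [hr]
      exact headNode_eq_inr_iff.trans (hφV x v B hB hvB)
  have hnonempty : ∀ B ∈ D.piH ∪ D.piY, ∀ v, tail (Sum.inr v) ∈ B →
      ((∃ x, φ x = Sum.inr v) ↔ B ∈ D.piH) := by
    intro B hB v hvB
    simp only [hφV _ v B hB hvB]
    constructor
    · rintro ⟨x, hx⟩
      rcases Finset.mem_union.1 hB with h1 | h1
      · exact h1
      · have := Finset.mem_inter.2 ⟨hx, hhead x⟩
        rw [D.inter_u_piY B h1] at this
        simp at this
    · intro h1
      have := D.card_u_piH B h1
      obtain ⟨y, hy⟩ := Finset.card_pos.1 (show 0 < (B ∩ D.Eu).card by omega)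
      obtain ⟨x, rfl⟩ := hhsurj y (Finset.mem_inter.1 hy).2
      exact ⟨x, (Finset.mem_inter.1 hy).1⟩
  have hEint : D.Eint = internals φ h := by
    ext y
    obtain ⟨p, rfl⟩ := h.surjective y
    rw [mem_internals]
    rcases p with (j | v) | x
    · exact iff_of_false (fun h1 => hdis _ h1 (htailJ j)) (by simp [owner])
    · exact iff_of_true (htailV v) ⟨v, rfl⟩
    · change head x ∈ _ ↔ ∃ v, headNode J (φ x) = _
      simp only [headNode_eq_inr_iff]
      rcases hx : φ x with i | v
      · refine iff_of_false (fun h1 => hdis _ h1 ?_) (by simp)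
        rw [← (hφI x i).1 hx]
        exact (Finset.mem_inter.1 (hrhoU i)).1
      · obtain ⟨B, hB, hvB⟩ := hblockof _ (htailV v)
        exact iff_of_true (hblockint B hB _ ((hφV x v B hB hvB).1 hx)) ⟨v, rfl⟩
  refine ⟨N, φ, hvalid, h, Feynman.ext_of_eq ?_ ?_ hEint ?_ ?_ ?_ ?_ rfl ?_⟩
  · ext y
    obtain ⟨p, rfl⟩ := h.surjective y
    refine Iff.trans ?_ mem_tails.symm
    rcases p with x | x
    · exact iff_of_true (htail x) rfl
    · exact iff_of_false (hdis' _ (hhead x)) (by simp)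
  · ext y
    obtain ⟨p, rfl⟩ := h.surjective y
    refine Iff.trans ?_ mem_heads.symm
    rcases p with x | x
    · exact iff_of_false (fun h1 => hdis' _ h1 (htail x)) (by simp)
    · exact iff_of_true (hhead x) rfl
  · change D.Eext = (internals φ h)ᶜ
    rw [← hEint]
    ext y
    rw [Finset.mem_compl]
    exact ⟨fun h1 h2 => hdis _ h2 h1, fun h1 => (hintext y).resolve_left h1⟩
  · ext B
    simp only [toFeynman, Finset.mem_image, Finset.mem_filter, Finset.mem_univ, true_and]
    constructor
    · intro hB
      have hB' := Finset.mem_union_left D.piY hB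
      obtain ⟨v, hv⟩ := hblocktail B hB'
      exact ⟨v, (hnonempty B hB' v hv).2 hB, hblock v B hB' hv⟩
    · rintro ⟨v, hv, rfl⟩
      obtain ⟨B, hB, hvB⟩ := hblockof _ (htailV v)
      rw [hblock v B hB hvB]
      exact (hnonempty B hB v hvB).1 hv
  · ext B
    simp only [toFeynman, Finset.mem_image, Finset.mem_filter, Finset.mem_univ, true_and]
    constructor
    · intro hB
      have hB' := Finset.mem_union_right D.piH hB
      obtain ⟨v, hv⟩ := hblocktail B hB'
      refine ⟨v, fun h1 => ?_, hblock v B hB' hv⟩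
      exact Finset.disjoint_left.1 D.disjoint_piH_piY ((hnonempty B hB' v hv).1 h1) hB
    · rintro ⟨v, hv, rfl⟩
      obtain ⟨B, hB, hvB⟩ := hblockof _ (htailV v)
      rw [hblock v B hB hvB]
      exact (Finset.mem_union.1 hB).resolve_left fun h1 => hv ((hnonempty B hB v hvB).2 h1)
  · funext i
    change D.rhoU i = head (rootOf hvalid i)
    exact (hφI _ i).1 (apply_rootOf hvalid i)
  · intro x x' hx
    obtain ⟨y, hy⟩ := htsurj x x.2
    rw [toFeynman_contr hvalid h y x' (by rw [← hx, ← hy]; rfl), hr]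
    have : (⟨tail y, htail y⟩ : D.Eubar) = x := Subtype.ext hy
    simp only [head, this]

end Reduction

/-! ### Connectedness of the digraph and of the reduced diagram -/

section Connectivity

/-- A set that no link leaves or enters is a union of components, and the points reachable from `a`
form such a set. The loops dropped by `fromRel` impose no condition. -/
lemma connected_fromRel_iff {α : Type*} (r : α → α → Prop) :
    (SimpleGraph.fromRel r).Connected ↔
      Nonempty α ∧ ∀ K : Set α, (∀ a b, r a b → (a ∈ K ↔ b ∈ K)) → K = ∅ ∨ K = Set.univ := by
  rw [SimpleGraph.connected_iff, and_comm]
  refine and_congr_right fun _ => ⟨fun h K hK => ?_, fun h a b => ?_⟩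
  · rcases K.eq_empty_or_nonempty with h0 | ⟨a, ha⟩
    · exact Or.inl h0
    · refine Or.inr (Set.eq_univ_of_forall fun b => ?_)
      obtain ⟨p⟩ := h a b
      induction p with
      | nil => exact ha
      | cons hadj p ih =>
        refine ih ?_
        rw [SimpleGraph.fromRel_adj] at hadj
        rcases hadj.2 with h1 | h1
        · exact (hK _ _ h1).1 ha
        · exact (hK _ _ h1).2 ha
  · have hK : ∀ b c, r b c → (b ∈ {b | (SimpleGraph.fromRel r).Reachable a b} ↔
        c ∈ {b | (SimpleGraph.fromRel r).Reachable a b}) := fun b c hbc => by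
      by_cases hne : b = c
      · rw [hne]
      · have hadj : (SimpleGraph.fromRel r).Adj b c := (SimpleGraph.fromRel_adj r b c).2
          ⟨hne, Or.inl hbc⟩
        exact ⟨fun h' => h'.trans hadj.reachable, fun h' => h'.trans hadj.symm.reachable⟩
    rcases h _ hK with h0 | h1
    · exact absurd (SimpleGraph.Reachable.refl a) (Set.eq_empty_iff_forall_notMem.1 h0 a)
    · exact Set.eq_univ_iff_forall.1 h1 b

variable {I J V E : Type*} [Fintype J] [Fintype V] [Fintype E] [DecidableEq E]
  {φ : J ⊕ V → I ⊕ V} (hv : IsValid φ) (h : (J ⊕ V) ⊕ (J ⊕ V) ≃ E)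

/-- External nodes own a single half-line each, so their blocks are the singletons among the
vertices of the digraph. -/
lemma mem_vertices_toFeynman (B : Finset E) :
    B ∈ (toFeynman φ hv h).vertices ↔ ∃ w, nodeBlock φ h w = B := by
  classical
  have hI : ∀ i, nodeBlock φ h (Sum.inl i) = {h (Sum.inr (rootOf hv i))} := by
    intro i
    ext e
    obtain ⟨p, rfl⟩ := h.surjective e
    rw [mem_nodeBlock, Finset.mem_singleton, h.apply_eq_iff_eq]
    rcases p with x | x
    · simp [owner]
    · simp [owner, headNode_eq_inl_iff, apply_eq_inl_iff hv]
  have hJ : ∀ j, nodeBlock φ h (Sum.inr (Sum.inl j)) = {h (Sum.inl (Sum.inl j))} := by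
    intro j
    ext e
    obtain ⟨p, rfl⟩ := h.surjective e
    rw [mem_nodeBlock, Finset.mem_singleton, h.apply_eq_iff_eq]
    rcases p with x | x
    · simp [owner]
    · rcases hx : φ x with i | v <;> simp [owner, headNode, hx]
  rw [Feynman.vertices, Finset.union_assoc, Finset.mem_union, mem_piH_union_piY_toFeynman,
    Finset.mem_union, Finset.mem_image, Finset.mem_image, Sum.exists, Sum.exists, or_assoc]
  refine or_congr ?_ (or_congr ?_ Iff.rfl)
  · constructor
    · rintro ⟨e, he, rfl⟩
      obtain ⟨i, -, rfl⟩ := (toFeynman φ hv h).bijOn_rhoU.2.2 (Finset.mem_coe.2 he)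
      exact ⟨i, hI i⟩
    · rintro ⟨i, rfl⟩
      exact ⟨_, (toFeynman φ hv h).bijOn_rhoU.1 (Set.mem_univ i), (hI i).symm⟩
  · constructor
    · rintro ⟨e, he, rfl⟩
      obtain ⟨i, -, rfl⟩ := (toFeynman φ hv h).bijOn_rhoUbar.2.2 (Finset.mem_coe.2 he)
      exact ⟨i, hJ i⟩
    · rintro ⟨i, rfl⟩
      exact ⟨_, (toFeynman φ hv h).bijOn_rhoUbar.1 (Set.mem_univ i), (hJ i).symm⟩

/-- The nodes of a reduced diagram are the vertices of its Feynman diagram. -/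
def verticesEquiv : I ⊕ (J ⊕ V) ≃ (toFeynman φ hv h).vertices :=
  Equiv.ofBijective (fun w => ⟨nodeBlock φ h w, (mem_vertices_toFeynman hv h _).2 ⟨w, rfl⟩⟩)
    ⟨fun _ _ hw => nodeBlock_injective hv h (congrArg Subtype.val hw), fun B => by
      obtain ⟨w, hw⟩ := (mem_vertices_toFeynman hv h B.1).1 B.2
      exact ⟨w, Subtype.ext hw⟩⟩

lemma link_verticesEquiv (w w' : I ⊕ (J ⊕ V)) :
    (toFeynman φ hv h).link (verticesEquiv hv h w) (verticesEquiv hv h w') ↔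
      ∃ x, w = Sum.inr x ∧ w' = headNode J (φ x) := by
  constructor
  · rintro ⟨e, he, he'⟩
    obtain ⟨p, hp⟩ := h.surjective e
    obtain ⟨x, rfl⟩ : ∃ y, p = Sum.inl y := by
      rcases p with y | y
      · exact ⟨y, rfl⟩
      · have h1 := e.2
        rw [← hp, toFeynman, mem_tails] at h1
        simp at h1
    rw [toFeynman_contr hv h x e hp.symm] at he'
    rw [← hp] at he
    exact ⟨x, (mem_nodeBlock.1 he).symm, (mem_nodeBlock.1 he').symm⟩
  · rintro ⟨x, rfl, rfl⟩
    refine ⟨⟨h (Sum.inl x), mem_tails.2 rfl⟩, mem_nodeBlock.2 rfl, ?_⟩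
    rw [toFeynman_contr hv h x _ rfl]
    exact mem_nodeBlock.2 rfl

/-- Links of the digraph are the arrows from `x` to the node of `φ x`, so sets closed under links
are the saturated sets. -/
lemma isConnected_toFeynman : (toFeynman φ hv h).IsConnected ↔ IsConn φ := by
  rw [Feynman.IsConnected, connected_fromRel_iff]
  refine and_congr (verticesEquiv hv h).nonempty_congr.symm ?_
  refine Iff.trans ?_ (verticesEquiv hv h).injective.preimage_surjective.forall.symm
  refine forall_congr' fun K => ?_
  rw [Set.preimage_eq_univ_iff, (verticesEquiv hv h).range_eq_univ,
    Set.preimage_eq_empty_iff, (verticesEquiv hv h).range_eq_univ, Set.univ_subset_iff,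
    Set.disjoint_univ]
  refine imp_congr ?_ Iff.rfl
  rw [(verticesEquiv hv h).surjective.forall₂]
  simp only [link_verticesEquiv]
  constructor
  · intro hK x
    exact hK _ _ ⟨x, rfl, rfl⟩
  · rintro hK _ _ ⟨x, rfl, rfl⟩
    exact hK x

end Connectivity

end

end FeynmanCluster

namespace FeynmanCluster

noncomputable section

/-! ### Comparison of amplitudes -/

section Amplitudes

variable {R : Type*} [CommRing R] {n : ℕ} (F : Fin n → MvPowerSeries (Fin n) R)
variable {I J V E : Type*} [Fintype J] [Fintype V] [Fintype E] [DecidableEq E]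
  {φ : J ⊕ V → I ⊕ V} (hv : IsValid φ) (h : (J ⊕ V) ⊕ (J ⊕ V) ≃ E)

lemma fiberLabels_inl (b : J ⊕ V → Fin n) (i : I) :
    fiberLabels φ b (Sum.inl i) = {b (rootOf hv i)} := by
  unfold fiberLabels
  exact congrArg (fun s : Finset (J ⊕ V) => s.val.map b) (show _ = {rootOf hv i} by
    ext x
    simp [apply_eq_inl_iff hv])

lemma prod_contr_toFeynman (α : E → Fin n) (A : Matrix (Fin n) (Fin n) R) :
    ∏ x : (toFeynman φ hv h).Eubar, A (α ((toFeynman φ hv h).contr x)) (α x) =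
      ∏ x : J ⊕ V, A (α (h (Sum.inr x))) (α (h (Sum.inl x))) := by
  refine (Fintype.prod_bijective (fun x : J ⊕ V =>
    (⟨h (Sum.inl x), mem_tails.2 rfl⟩ : (toFeynman φ hv h).Eubar)) ⟨fun x y hxy => ?_,
    fun e => ?_⟩ _ _ fun x => ?_).symm
  · exact Sum.inl_injective (h.injective (congrArg Subtype.val hxy))
  · obtain ⟨p, hp⟩ := h.surjective e
    rcases p with x | x
    · exact ⟨x, Subtype.ext hp⟩
    · have h1 := e.2
      rw [← hp, toFeynman, mem_tails] at h1
      simp at h1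
  · rw [toFeynman_contr hv h x _ rfl]

/-- The vertices split by whether their fibre is empty: the empty ones are the `Y`-blocks, the
others the `H`-blocks, and `vertexFactor` specializes accordingly. -/
lemma prod_blocks_toFeynman (α : E → Fin n) :
    MvPowerSeries.C (∏ B ∈ (toFeynman φ hv h).piH, (toFeynman φ hv h).vertexH F B α) *
        ∏ B ∈ (toFeynman φ hv h).piY, (toFeynman φ hv h).vertexY R B α =
      ∏ v, vertexFactor F (α (h (Sum.inl (Sum.inr v))))
        (fiberLabels φ (fun x => α (h (Sum.inr x))) (Sum.inr v)) := by
  classical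
  have hinj : Function.Injective fun v => nodeBlock φ h (Sum.inr (Sum.inr v)) := fun v v' hvv => by
    simpa using nodeBlock_injective hv h hvv
  have hH : ∀ v, (∃ x, φ x = Sum.inr v) → MvPowerSeries.C ((toFeynman φ hv h).vertexH F
      (nodeBlock φ h (Sum.inr (Sum.inr v))) α) = vertexFactor F (α (h (Sum.inl (Sum.inr v))))
        (fiberLabels φ (fun x => α (h (Sum.inr x))) (Sum.inr v)) := by
    rintro v ⟨x, hx⟩
    rw [vertexFactor_of_ne_zero]
    · have h1 : nodeBlock φ h (Sum.inr (Sum.inr v)) ∩ (toFeynman φ hv h).Eubar =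
          {h (Sum.inl (Sum.inr v))} := nodeBlock_inter_tails φ h _
      have h2 : nodeBlock φ h (Sum.inr (Sum.inr v)) ∩ (toFeynman φ hv h).Eu =
          (Finset.univ.filter fun x => φ x = Sum.inr v).map
            (Function.Embedding.inr.trans h.toEmbedding) := nodeBlock_inter_heads φ h v
      rw [Feynman.vertexH, h1, h2, Finset.prod_singleton, Finset.map_val, Multiset.map_map,
        fiberLabels]
      congr!
    · intro h0
      have := card_fiberLabels φ (fun x => α (h (Sum.inr x))) (Sum.inr v)
      rw [h0, Multiset.card_zero, eq_comm, Finite.card_eq_zero_iff] at this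
      exact this.elim ⟨x, hx⟩
  have hY : ∀ v, (¬ ∃ x, φ x = Sum.inr v) → (toFeynman φ hv h).vertexY R
      (nodeBlock φ h (Sum.inr (Sum.inr v))) α = vertexFactor F (α (h (Sum.inl (Sum.inr v))))
        (fiberLabels φ (fun x => α (h (Sum.inr x))) (Sum.inr v)) := by
    intro v hx
    have h0 : fiberLabels φ (fun x => α (h (Sum.inr x))) (Sum.inr v) = 0 := by
      rw [← Multiset.card_eq_zero, card_fiberLabels, Finite.card_eq_zero_iff]
      exact ⟨fun x => hx ⟨x.1, x.2⟩⟩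
    have h1 : nodeBlock φ h (Sum.inr (Sum.inr v)) ∩ (toFeynman φ hv h).Eubar =
          {h (Sum.inl (Sum.inr v))} := nodeBlock_inter_tails φ h _
    rw [Feynman.vertexY, h1, Finset.prod_singleton, h0, vertexFactor_zero]
  rw [map_prod, show (toFeynman φ hv h).piH = (Finset.univ.filter fun v => ∃ x, φ x = Sum.inr v).image
    fun v => nodeBlock φ h (Sum.inr (Sum.inr v)) from rfl,
    show (toFeynman φ hv h).piY = (Finset.univ.filter fun v => ¬ ∃ x, φ x = Sum.inr v).image
    fun v => nodeBlock φ h (Sum.inr (Sum.inr v)) from rfl,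
    Finset.prod_image hinj.injOn, Finset.prod_image hinj.injOn,
    ← Finset.prod_filter_mul_prod_filter_not Finset.univ fun v => ∃ x, φ x = Sum.inr v]
  congr 1
  · exact Finset.prod_congr rfl fun v hv' => hH v (Finset.mem_filter.1 hv').2
  · exact Finset.prod_congr rfl fun v hv' => hY v (Finset.mem_filter.1 hv').2

variable [Fintype I]

/-- An attribution is determined by its values `a` at the internal `ū`-half-lines and `b` at all
`u`-half-lines, since the external `ū`-values are prescribed. -/
lemma amplitude_toFeynman (τu : I → Fin n) (τubar : J → Fin n) :
    (toFeynman φ hv h).amplitude F τu τubar =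
      diagAmp (propagator F) (vertexFactor F) τu τubar φ := by
  classical
  rw [Feynman.amplitude, diagAmp, ← Fintype.sum_prod_type']
  refine Finset.sum_of_injOn (fun α => (fun v => α (h (Sum.inl (Sum.inr v))),
    fun x => α (h (Sum.inr x)))) ?_ (fun _ _ => Finset.mem_coe.2 (Finset.mem_univ _)) ?_ ?_
  · intro α hα α' hα' heq
    have h1 := (Finset.mem_filter.1 (Finset.mem_coe.1 hα)).2
    have h2 := (Finset.mem_filter.1 (Finset.mem_coe.1 hα')).2
    obtain ⟨e1, e2⟩ := Prod.mk.inj heq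
    funext e
    obtain ⟨(j | v) | x, rfl⟩ := h.surjective e
    · exact (h1.2 j).trans (h2.2 j).symm
    · exact congrFun e1 v
    · exact congrFun e2 x
  -- The prescription at external `u`-half-lines is not built into `(a, b)`; states that violate it
  -- have root factor zero.
  · rintro ⟨a, b⟩ - hab
    by_contra h0
    have hr := fiberLabels_eq_of_stateWeight_ne_zero h0
    refine hab ⟨fun e => Sum.elim (Sum.elim τubar a) b (h.symm e), ?_, ?_⟩
    · refine Finset.mem_coe.2 (Finset.mem_filter.2 ⟨Finset.mem_univ _, fun i => ?_, fun j => ?_⟩)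
      · have := hr i
        rw [fiberLabels_inl hv] at this
        simpa [toFeynman] using this
      · simp [toFeynman]
    · simp
  · intro α hα
    obtain ⟨h1, h2⟩ := (Finset.mem_filter.1 hα).2
    have hroot : ∀ i, rootFactor (MvPowerSeries (Fin n) R) (τu i)
        (fiberLabels φ (fun x => α (h (Sum.inr x))) (Sum.inl i)) = 1 := fun i => by
      rw [fiberLabels_inl hv, rootFactor, if_pos]
      rw [← h1 i]
      rfl
    have helim : ∀ x, Sum.elim τubar (fun v => α (h (Sum.inl (Sum.inr v)))) x = α (h (Sum.inl x)) := by
      rintro (j | v)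
      · exact (h2 j).symm
      · rfl
    rw [mul_assoc, prod_blocks_toFeynman, prod_contr_toFeynman]
    simp only [stateWeight, hroot, Finset.prod_const_one, mul_one, helim, map_prod]
    rfl

end Amplitudes

/-! ### Automorphisms and orbit counting -/

section Counting

variable {I J V V' E : Type*}

lemma intertwines_iff {φ : J ⊕ V → I ⊕ V} {φ' : J ⊕ V' → I ⊕ V'} {e : V ≃ V'} :
    Intertwines φ φ' e ↔ conjDiag (Equiv.refl I) (Equiv.refl J) e φ = φ' := by
  rw [funext_iff, (Equiv.sumCongr (Equiv.refl J) e).surjective.forall]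
  refine forall_congr' fun x => ?_
  have := conjDiag_apply (Equiv.refl I) (Equiv.refl J) e φ x
  rw [Equiv.sumCongr_apply, this]
  exact eq_comm

lemma Intertwines.isConn {φ : J ⊕ V → I ⊕ V} {φ' : J ⊕ V' → I ⊕ V'} {e : V ≃ V'}
    (he : Intertwines φ φ' e) (h : IsConn φ) : IsConn φ' := by
  rw [← intertwines_iff.1 he]
  exact (isConn_conjDiag _ _ _ _).2 h

lemma Intertwines.isValid {φ : J ⊕ V → I ⊕ V} {φ' : J ⊕ V' → I ⊕ V'} {e : V ≃ V'}
    (he : Intertwines φ φ' e) (h : IsValid φ) : IsValid φ' := by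
  let ε := Equiv.sumCongr (Equiv.refl J) e
  have hε : ∀ x, φ' (ε x) = Sum.map id e (φ x) := he
  constructor
  · intro i
    refine (ε.existsUnique_congr fun {x} => ?_).1 (h.1 i)
    rw [hε]
    rcases φ x with i' | v <;> simp
  · intro v'
    obtain ⟨v, rfl⟩ := e.surjective v'
    rw [← Nat.card_congr (ε.subtypeEquiv (p := fun x => φ x = Sum.inr v) fun x => ?_)]
    · exact h.2 v
    · rw [hε]
      rcases φ x with i' | v <;> simp

/-- Relabelling of the vertices as a group action. -/
abbrev relabelAction (I J V : Type*) : MulAction (Equiv.Perm V) (J ⊕ V → I ⊕ V) where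
  smul e φ := conjDiag (Equiv.refl I) (Equiv.refl J) e φ
  one_smul φ := intertwines_iff.1 fun x => by
    rcases x with j | v <;> simp
  mul_smul e e' φ := by
    refine intertwines_iff.1 fun x => ?_
    change conjDiag _ _ e (conjDiag _ _ e' φ) _ = _
    have h1 := conjDiag_apply (Equiv.refl I) (Equiv.refl J) e' φ x
    have h2 := conjDiag_apply (Equiv.refl I) (Equiv.refl J) e
      (conjDiag (Equiv.refl I) (Equiv.refl J) e' φ) (Sum.map (Equiv.refl J) e' x)
    rw [h1] at h2
    simpa [Sum.map_map] using h2

/-- Orbit counting for reduced diagrams. -/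
lemma card_orbit_mul_card_intertwines [Fintype V] (φ : J ⊕ V → I ⊕ V) :
    Nat.card {φ' : J ⊕ V → I ⊕ V // ∃ e, Intertwines φ φ' e} *
      Nat.card {e : Equiv.Perm V // Intertwines φ φ e} = (Fintype.card V).factorial := by
  classical
  let _ := relabelAction I J V
  have h1 : Nat.card (MulAction.orbit (Equiv.Perm V) φ) =
      Nat.card {φ' : J ⊕ V → I ⊕ V // ∃ e, Intertwines φ φ' e} :=
    Nat.card_congr (Equiv.subtypeEquivRight fun φ' => exists_congr fun e => intertwines_iff.symm)
  have h2 : Nat.card (MulAction.stabilizer (Equiv.Perm V) φ) =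
      Nat.card {e : Equiv.Perm V // Intertwines φ φ e} :=
    Nat.card_congr (Equiv.subtypeEquivRight fun e => intertwines_iff.symm)
  rw [← h1, ← h2, ← Nat.card_prod, Nat.card_congr
    (MulAction.orbitProdStabilizerEquivGroup (Equiv.Perm V) φ), Nat.card_eq_fintype_card,
    Fintype.card_perm]

/-- Automorphisms of the half-lines are lifts of vertex permutations that fix `φ`; such a
permutation can be read off at the `ū`-half-lines of the vertices. -/
lemma card_autSet_toFeynman [Fintype J] [Fintype V] [Fintype E] [DecidableEq E]
    {φ : J ⊕ V → I ⊕ V} (hv : IsValid φ) (h : (J ⊕ V) ⊕ (J ⊕ V) ≃ E) :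
    Nat.card (toFeynman φ hv h).autSet = Nat.card {e : Equiv.Perm V // Intertwines φ φ e} := by
  refine (Nat.card_eq_of_bijective (fun e : {e : Equiv.Perm V // Intertwines φ φ e} =>
    (⟨h.symm.trans ((liftEquiv J e.1).trans h), e.2.isTransport hv hv fun p => by simp⟩ :
      (toFeynman φ hv h).autSet)) ⟨fun e e' hee => ?_, fun σ => ?_⟩).symm
  · refine Subtype.ext (Equiv.ext fun v => ?_)
    have := DFunLike.congr_fun (congrArg Subtype.val hee) (h (Sum.inl (Sum.inr v)))
    simpa [liftEquiv] using this
  · obtain ⟨e, he, hσ⟩ := exists_intertwines hv hv σ.2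
    refine ⟨⟨e, he⟩, Subtype.ext (Equiv.ext fun x => ?_)⟩
    obtain ⟨p, rfl⟩ := h.surjective x
    simp [hσ]

end Counting

end

end FeynmanCluster

namespace FeynmanCluster

noncomputable section

/-! ### Diagrams with forbidden arities -/

section InvalidDiagrams

variable {R : Type*} [CommRing R] {n : ℕ} (F : Fin n → MvPowerSeries (Fin n) R)
variable {I J V : Type*} [Fintype I] [Fintype J] [Fintype V]

/-- A bad fibre over `I` kills the root factor, a one-element fibre over a vertex kills its vertex
factor, whatever the labels are. -/
lemma diagAmp_eq_zero_of_not_isValid (τu : I → Fin n) (τubar : J → Fin n) {φ : J ⊕ V → I ⊕ V}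
    (hφ : ¬ IsValid φ) : diagAmp (propagator F) (vertexFactor F) τu τubar φ = 0 := by
  rw [diagAmp]
  refine Finset.sum_eq_zero fun a _ => Finset.sum_eq_zero fun b _ => ?_
  by_contra h0
  refine hφ ⟨fun i => ?_, fun v hcard => h0 ?_⟩
  · have h1 := card_fiberLabels φ b (Sum.inl i)
    rw [fiberLabels_eq_of_stateWeight_ne_zero h0 i, Multiset.card_singleton, eq_comm,
      Nat.card_eq_one_iff_unique] at h1
    obtain ⟨hs, ⟨x⟩⟩ := h1
    exact ⟨x.1, x.2, fun y hy => congrArg Subtype.val (hs.elim ⟨y, hy⟩ x)⟩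
  · rw [stateWeight, Finset.prod_eq_zero (Finset.mem_univ v), mul_zero]
    exact vertexFactor_eq_zero F _ (by rw [card_fiberLabels, hcard])

end InvalidDiagrams

/-- Connected reduced diagrams of type `(I, J)` that come from Feynman diagrams. -/
abbrev ReducedDiagram (I J : Type*) : Type _ :=
  Σ N : ℕ, {φ : J ⊕ Fin N → I ⊕ Fin N // IsValid φ ∧ IsConn φ}

/-! ### Connected correlation functions as sums over reduced diagrams -/

section Classes

variable {I J : Type*} [Fintype J]

/-- The isomorphism class of Feynman diagrams that is given by a reduced diagram. -/
def ReducedDiagram.toClass (s : ReducedDiagram I J) : ConnectedClass I J :=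
  Quotient.mk (connectedSetoid I J)
    ⟨⟨_, toFeynman s.2.1 s.2.2.1 (Fintype.equivFin _)⟩, (isConnected_toFeynman _ _).2 s.2.2.2⟩

lemma ReducedDiagram.toClass_eq_iff (s : ReducedDiagram I J) {N k : ℕ}
    {φ : J ⊕ Fin N → I ⊕ Fin N} (hv : IsValid φ) (h : (J ⊕ Fin N) ⊕ (J ⊕ Fin N) ≃ Fin k)
    (hc : (toFeynman φ hv h).IsConnected) :
    s.toClass = Quotient.mk (connectedSetoid I J) ⟨⟨k, toFeynman φ hv h⟩, hc⟩ ↔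
      ∃ e : Fin N ≃ Fin s.1, Intertwines φ s.2.1 e := by
  refine eq_comm.trans (Quotient.eq.trans ?_)
  constructor
  · rintro ⟨σ, hσ⟩
    obtain ⟨e, he, -⟩ := exists_intertwines hv s.2.2.1 hσ
    exact ⟨e, he⟩
  · rintro ⟨e, he⟩
    exact ⟨h.symm.trans ((liftEquiv J e).trans (Fintype.equivFin _)),
      he.isTransport hv s.2.2.1 fun p => by simp⟩

variable [Fintype I] {R : Type*} [CommRing R] [Algebra ℚ R] {n : ℕ}
  (F : Fin n → MvPowerSeries (Fin n) R)

/-- Supplies a reduced representative that describes the members of the class by intertwiners and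
the term of the class by data of `φ`. -/
lemma exists_reducedDiagram (τu : I → Fin n) (τubar : J → Fin n) (c : ConnectedClass I J) :
    ∃ r : ReducedDiagram I J,
      (∀ s : ReducedDiagram I J, s.toClass = c ↔ ∃ e : Fin r.1 ≃ Fin s.1, Intertwines r.2.1 s.2.1 e) ∧
      connectedTerm F τu τubar c =
        ((Nat.card {e : Equiv.Perm (Fin r.1) // Intertwines r.2.1 r.2.1 e} : ℚ)⁻¹) •
          diagAmp (propagator F) (vertexFactor F) τu τubar r.2.1 := by
  have hout := Quotient.out_eq c
  unfold connectedTerm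
  -- The argument uses only that the chosen representative belongs to `c`.
  generalize c.out = D at hout
  obtain ⟨⟨k, D⟩, hD⟩ := D
  obtain ⟨N, φ, hv, h, rfl⟩ := exists_eq_toFeynman D
  refine ⟨⟨N, φ, hv, (isConnected_toFeynman hv h).1 hD⟩, fun s => ?_, ?_⟩
  · rw [← hout]
    exact s.toClass_eq_iff hv h hD
  · dsimp only
    rw [card_autSet_toFeynman, amplitude_toFeynman]

open Classical in
/-- The connected reduced diagrams with at most `b` vertices. -/
def reducedDiagrams (I J : Type*) [Fintype I] [Fintype J] (b : ℕ) : Finset (ReducedDiagram I J) :=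
  (Finset.range (b + 1)).sigma fun _ => Finset.univ

lemma mem_reducedDiagrams {b : ℕ} {s : ReducedDiagram I J} :
    s ∈ reducedDiagrams I J b ↔ s.1 ≤ b := by
  simp [reducedDiagrams]

lemma coeff_evalOne_connSeries (τu : I → Fin n) (τubar : J → Fin n) (d : Fin n →₀ ℕ) :
    MvPowerSeries.coeff d (evalOne R n (connSeries F τu τubar)) =
      ∑ s ∈ reducedDiagrams I J (2 * d.degree + Fintype.card J), ((s.1.factorial : ℚ)⁻¹) •
        MvPowerSeries.coeff d (diagAmp (propagator F) (vertexFactor F) τu τubar s.2.1) := by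
  classical
  rw [connSeries, coeff_evalOne_genSeries, reducedDiagrams, Finset.sum_sigma]
  refine Finset.sum_congr rfl fun N _ => ?_
  rw [coeff_rat_smul, connSum, map_sum, Finset.smul_sum]
  refine (Finset.sum_of_injOn (fun φ : {φ : J ⊕ Fin N → I ⊕ Fin N // IsValid φ ∧ IsConn φ} => φ.1)
    Subtype.val_injective.injOn (fun φ _ => by simp [φ.2.2]) ?_ fun _ _ => rfl).symm
  intro φ hφ hφ'
  rw [diagAmp_eq_zero_of_not_isValid F, map_zero, smul_zero]
  exact fun hv => hφ' ⟨⟨φ, hv, (Finset.mem_filter.1 hφ).2⟩, by simp⟩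

open Classical in
-- The reduced diagrams in a class form one orbit under relabelling and share one amplitude. The
-- orbit has `N!/#Aut` elements, so the weights `1/N!` add up to `1/#Aut`.
lemma sum_filter_toClass (τu : I → Fin n) (τubar : J → Fin n) (d : Fin n →₀ ℕ) {b : ℕ}
    {r : ReducedDiagram I J} (hr : r ∈ reducedDiagrams I J b) :
    ∑ s ∈ reducedDiagrams I J b with s.toClass = r.toClass, ((s.1.factorial : ℚ)⁻¹) •
        MvPowerSeries.coeff d (diagAmp (propagator F) (vertexFactor F) τu τubar s.2.1) =
      MvPowerSeries.coeff d (connectedTerm F τu τubar r.toClass) := by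
  obtain ⟨r₀, h₁, h₂⟩ := exists_reducedDiagram F τu τubar r.toClass
  obtain ⟨N, φ, hv, hc⟩ := r₀
  obtain ⟨e₀, -⟩ := (h₁ r).1 rfl
  have hN : N ≤ b := by
    rw [show N = r.1 by simpa using Fintype.card_congr e₀]
    exact mem_reducedDiagrams.1 hr
  dsimp only at h₁ h₂
  -- Intertwined diagrams have equally many vertices, so the whole class lives on `Fin N`.
  have hsum : ∑ s ∈ reducedDiagrams I J b with s.toClass = r.toClass, ((s.1.factorial : ℚ)⁻¹) •
        MvPowerSeries.coeff d (diagAmp (propagator F) (vertexFactor F) τu τubar s.2.1) =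
      ∑ _φ' : {φ' : J ⊕ Fin N → I ⊕ Fin N // ∃ e, Intertwines φ φ' e}, ((N.factorial : ℚ)⁻¹) •
        MvPowerSeries.coeff d (diagAmp (propagator F) (vertexFactor F) τu τubar φ) := by
    refine (Finset.sum_bij (fun φ' _ => (⟨N, φ'.1, φ'.2.elim fun e he =>
      ⟨he.isValid hv, he.isConn hc⟩⟩ : ReducedDiagram I J)) ?_ ?_ ?_ ?_).symm
    · intro φ' _
      rw [Finset.mem_filter, mem_reducedDiagrams, h₁]
      exact ⟨hN, φ'.2⟩
    · intro φ' _ φ'' _ h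
      refine Subtype.ext ?_
      simpa using h
    · rintro ⟨N', φ', hφ'⟩ hs
      obtain ⟨e, he⟩ := (h₁ _).1 (Finset.mem_filter.1 hs).2
      obtain rfl : N = N' := by simpa using Fintype.card_congr e
      exact ⟨⟨φ', e, he⟩, Finset.mem_univ _, rfl⟩
    · rintro ⟨φ', e, he⟩ _
      rw [diagAmp_conj (propagator F) (vertexFactor F) (Equiv.refl I) (Equiv.refl J) e τu τubar he]
      rfl
  have hcard := card_orbit_mul_card_intertwines φ
  rw [Fintype.card_fin] at hcard
  rw [hsum, h₂, coeff_rat_smul, Finset.sum_const, Finset.card_univ, ← Nat.card_eq_fintype_card,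
    ← Nat.cast_smul_eq_nsmul ℚ, smul_smul, ← hcard]
  have hne := hcard ▸ N.factorial_ne_zero
  have h₃ : (Nat.card {φ' : J ⊕ Fin N → I ⊕ Fin N // ∃ e, Intertwines φ φ' e} : ℚ) ≠ 0 :=
    Nat.cast_ne_zero.2 (left_ne_zero_of_mul hne)
  rw [Nat.cast_mul, mul_inv, mul_inv_cancel_left₀ h₃]

open Classical in
lemma support_coeff_connectedTerm_subset (τu : I → Fin n) (τubar : J → Fin n) (d : Fin n →₀ ℕ) :
    (Function.support fun c : ConnectedClass I J =>
      MvPowerSeries.coeff d (connectedTerm F τu τubar c)) ⊆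
      ((reducedDiagrams I J (2 * d.degree + Fintype.card J)).image ReducedDiagram.toClass :
        Finset (ConnectedClass I J)) := by
  intro c hc
  obtain ⟨r, h₁, h₂⟩ := exists_reducedDiagram F τu τubar c
  refine Finset.mem_coe.2 (Finset.mem_image.2 ⟨r, mem_reducedDiagrams.2 ?_, ?_⟩)
  · by_contra hlt
    refine hc ?_
    dsimp only
    rw [h₂, coeff_rat_smul, coeff_diagAmp_eq_zero, smul_zero]
    simpa using hlt
  · refine (h₁ r).2 ⟨Equiv.refl _, fun x => ?_⟩
    simp

lemma summableFamily_connectedTerm (τu : I → Fin n) (τubar : J → Fin n) :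
    SummableFamily (connectedTerm F τu τubar) := fun d =>
  (Finset.finite_toSet _).subset (support_coeff_connectedTerm_subset F τu τubar d)

/-- Group the connected reduced diagrams by isomorphism class; coefficientwise only finitely many
classes contribute. -/
lemma connCorr_eq (τu : I → Fin n) (τubar : J → Fin n) :
    connCorr F τu τubar = evalOne R n (connSeries F τu τubar) := by
  classical
  ext d
  rw [coeff_evalOne_connSeries, connCorr, coeff_familySum,
    finsum_eq_sum_of_support_subset _ (support_coeff_connectedTerm_subset F τu τubar d),
    ← Finset.sum_fiberwise_of_maps_to (g := ReducedDiagram.toClass)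
      (fun s hs => Finset.mem_image_of_mem _ hs)]
  refine Finset.sum_congr rfl fun c hc => ?_
  obtain ⟨r, hr, rfl⟩ := Finset.mem_image.1 hc
  exact (sum_filter_toClass F τu τubar d hr).symm

end Classes

end

end FeynmanCluster

/-! ### The cluster expansion -/

open FeynmanCluster in
open Classical in
theorem theorem6 {R : Type*} [CommRing R] [Algebra ℚ R] {n : ℕ}
    (F : Fin n → MvPowerSeries (Fin n) R)
    (hF : ∀ i, MvPowerSeries.constantCoeff (F i) = 0)
    (hA : IsUnit (linMatrix F))
    {I J : Type*} [Fintype I] [Fintype J]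
    (τu : I → Fin n) (τubar : J → Fin n) :
    GaussIntegrable (linMatrix F) (corrIntegrand F τu τubar) ∧
    GaussIntegrable (linMatrix F) (expInteraction F) ∧
    (∀ (S : Finset I) (T : Finset J), SummableFamily
      (connectedTerm F (fun i : S => τu i) (fun j : T => τubar j))) ∧
    unnormCorr F τu τubar =
      partitionFunction F *
        ∑ π : Finset (Finset I × Finset J) with IsPairPartition π,
          ∏ p ∈ π, connCorr F (fun i : p.1 => τu i) (fun j : p.2 => τubar j) := by
  have hZ : corrIntegrand F (fun i : (∅ : Finset I) => τu i) (fun j : (∅ : Finset J) => τubar j) =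
      expInteraction F := corrIntegrand_of_isEmpty F _ _
  refine ⟨gaussIntegrable_corrIntegrand F τu τubar, ?_,
    fun S T => summableFamily_connectedTerm F _ _, ?_⟩
  · rw [← hZ]
    exact gaussIntegrable_corrIntegrand F _ _
  -- `Z` is the correlation function without external half-lines, hence the factor `W(∅)` of the
  -- expansion.
  · have hpart : partitionFunction F = unnormCorr F (fun i : (∅ : Finset I) => τu i)
        (fun j : (∅ : Finset J) => τubar j) := by
      rw [unnormCorr, hZ, partitionFunction]
    -- Setting the vertex variable to `1` is a ring homomorphism, so it passes through the product
    -- and the sum over partitions.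
    rw [hpart, unnormCorr_eq F hA, unnormCorr_eq F hA, totalSeries_eq_mul_sum, map_mul, map_sum]
    congr 1
    refine Finset.sum_congr (by congr!) fun π _ => ?_
    rw [map_prod]
    exact Finset.prod_congr rfl fun p _ => (connCorr_eq F _ _).symm
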